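/- **Setting.** Let $\mathcal A$ be a finite essential real complexified toric arrangement in $T=(\mathbb C^*)^d$: a finite set of pairwise distinct connected hypertori $H=\{z : z^{\chi_H}=e^{2\pi i t_H}\}$ with $\chi_H\in\mathbb Z^d$ primitive and $t_H\in\mathbb R$, such that the $\chi_H$ span $\mathbb R^d$. It is studied through its trace on the compact torus $T_c=(\mathbb R/\mathbb Z)^d$; layers (connected components of intersections of hypertori) and faces are taken there. Let $H_0=\{x\in\mathbb R^d:\chi_H\cdot x=0\}$ and $\mathcal A_0=\{H_0 : H\in\mathcal A\}$. Let $\mathcal F(\mathcal A)$ be the face category of $T_c$, i.e. the quotient by $\mathbb Z^d$ of the poset of faces of the periodic arrangement in $\mathbb R^d$ that lifts $\mathcal A$ (ordered by inclusion of closures). For a face or layer $F$ let $\mathcal A_F$ be the set of hypertori containing $F$, let $\mathcal A[F]=\{H_0: H\in\mathcal A_F\}$ and let $X_F=\bigcap_{H\in\mathcal A_F}H_0$. The support of a face is the smallest layer containing it. For a chamber or face $C$ of $\mathcal A_0$ let $C(F)$ be the chamber or face of $\mathcal A[F]$ containing it. For a face $G$ and a chamber $C$ of a real arrangement $\mathscr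 H$, $C_G$ is the chamber having $G$ as a face that is separated from $C$ by no hyperplane containing $G$. The Salvetti poset $\mathcal S(\mathscr H)$ is the set of pairs $[G,C]$, $G$ a face of the chamber $C$, with $[G,C]\ge[G',C']$ if $G\subseteq\overline{G'}$ and $C_{G'}=C'$. A morphism $m:F\to G$ of $\mathcal F(\mathcal A)$ induces an inclusion $i_m$ of the faces of $\mathcal A[G]$ into those of $\mathcal A[F]$ (signs on $\mathcal A[G]$ are kept; on the rest of $\mathcal A[F]$ the sign is that of $F_m$, the face of $\mathcal A[F]$ into which the lift of $G$ determined by $m$ points from the lift of $F$), hence a poset map $\mathscr D(m):\mathcal S(\mathcal A[G])\to\mathcal S(\mathcal A[F])$, $[K,C]\mapsto[i_m(K),i_m(C)]$. Let $\int\mathscr D$ be the Grothendieck construction of $\mathscr D:\mathcal F(\mathcal A)^{op}\to\mathrm{Pos}$, $F\mapsto\mathcal S(\mathcal A[F])$, and $\operatorname{Sal}(\mathcal A)$ its nerve, which is homotopy equivalent to $T\setminus\bigcup\mathcal A$. Chains and homology are with integer coefficients. **The cycles $\Lambda$.** Let $M$ be a $1$-dimensional layer. Fix a chamber ${}^MC$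 of $\mathcal A_0$ adjacent to $X_M$ (i.e. having a face with linear hull $X_M$) and a minimal gallery ${}^MC=C_0,W_0,C_1,\dots,C_n=\operatorname{op}_{X_M}(-{}^MC)$ in $\mathcal A_0$, where $\operatorname{op}_{X_M}(C)$ is the chamber whose closure meets $X_M$ in the same set as $\overline C$ and which is separated from $C$ by exactly the hyperplanes containing $X_M$. For a face $F\subseteq M$ let $C_0^F,\dots,C_{k}^F$ ($k=k(M,F)$) be the distinct chambers among the $C_i(F)$, in increasing order of index, and $W_i^F$ the wall of $\mathcal A[F]$ between $C_i^F$ and $C_{i+1}^F$. For a chamber $B$ of $\mathcal A_0$ put $v_i=[C_i^F,C_i^F]$ ($0\le i\le k$), $e_i(B)=[W_i^F,B(F)_{W_i^F}]$ and $\overline e_i(B)=[W_i^F,(-B(F))_{W_i^F}]$ ($0\le i<k$). The arrows $(F,v_i)\to(F,e_i(B))\leftarrow(F,v_{i+1})$ for faces $F\subseteq M$, together with the arrows $(G,v_0)\to(P,v_l)$ of $\int\mathscr D$ for faces $G,P\subseteq M$ of dimension $1$ and $0$, respectively, form a closed path $\Lambda^M_B$. Fix a $0$-dimensional face $P_0\subseteq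 M$. For $F\subseteq M$ and $H\in\mathcal A_F\setminus\mathcal A_M$ let $i$ be the index such that $W_i^F$ has linear hull $H_0$, and let $[\Xi(H;B,F)]$ be the $1$-cycle supported on the square with vertices $v_i,v_{i+1},e_i(B),\overline e_i(B)$ over $F$ that has coefficient $1$ on $v_i\to e_i(B)$. **The classes $\widehat\omega$.** For every $H\in\mathcal A$ choose a chamber ${}^HC$ of $\mathcal A_0$. For $m:F\to G$ with $\operatorname{supp}(G)=H$ let $C_1=({}^HC(F))_{F_m}$, $C_2=(-{}^HC(F))_{F_m}$, and let $[\Omega^{(m)}]$ be the $1$-cycle supported on the square $[C_1,C_1],[F_m,C_1],[C_2,C_2],[F_m,C_2]$ over $F$ that has coefficient $1$ on $[C_1,C_1]\to[F_m,C_1]$. Let $\widehat\omega_H\in H_1(\operatorname{Sal}(\mathcal A);\mathbb Z)$ be the homology class of any such $[\Omega^{(m)}]$. For a chamber $B$ of $\mathcal A_0$ let $\epsilon(H,B)=1$ if $H_0$ does not separate ${}^HC$ from $B$, and $\epsilon(H,B)=-1$ otherwise. Finally, for chambers $B,B'$ of $\mathcal A_0$ let $S_F(B,B')=\{H\in\mathcal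 A_F : H_0 \text{ separates } B \text{ from } B'\}$. **Proposition.** 1. For every chamber $B$ of $\mathcal A_0$ there is exactly one $1$-cycle $[\Lambda^M_B]$ of $\operatorname{Sal}(\mathcal A)$ that is supported on the arrows of the closed path $\Lambda^M_B$ and has coefficient $1$ on the arrow $v_0\to e_0(B)$ over $P_0$. Let $\widehat\lambda^M_B$ be its homology class. 2. For all chambers $B,B'$ of $\mathcal A_0$, as $1$-chains, $$[\Lambda^M_B]-[\Lambda^M_{B'}]=\sum_{F\subseteq M}\ \sum_{H\in S_F(B,B')\setminus\mathcal A_M}[\Xi(H;B,F)].$$ 3. For all chambers $B,B'$ of $\mathcal A_0$, in $H_1(\operatorname{Sal}(\mathcal A);\mathbb Z)$, $$\widehat\lambda^M_B-\widehat\lambda^M_{B'}=\sum_{F\subseteq M}\ \sum_{H\in S_F(B,B')\setminus\mathcal A_M}\epsilon(H,{}^MC)\,\epsilon(H,B)\,\widehat\omega_H .$$ In particular, if for every $H\not\supseteq M$ the chamber ${}^HC$ lies on the same side of $H_0$ as ${}^MC$, then $$\widehat\lambda^M_B-\widehat\lambda^M_{B'}=\sum_{F\subseteq M}\ \sum_{H\in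 S_F(B,B')\setminus\mathcal A_M}\epsilon(H,B)\,\widehat\omega_H .$$ -/

import Mathlib

open CategoryTheory

/-! ### Arrangements of affine hyperplanes in `ℝ ^ d` and their faces -/

namespace RealArr

section Affine

variable {d : ℕ} {κ : Type}

/-- The sign vector of a point with respect to a family of affine forms (one for each
hyperplane; the sign of the form says on which side of the hyperplane the point lies). -/
noncomputable def signVector (f : κ → (Fin d → ℝ) →ᵃ[ℝ] ℝ) (x : Fin d → ℝ) : κ → SignType :=
  fun k => SignType.sign (f k x)

/-- A face of the arrangement of the hyperplanes `{f k = 0}`: a sign vector that is the sign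
vector of some point. -/
@[ext]
structure Face (f : κ → (Fin d → ℝ) →ᵃ[ℝ] ℝ) where
  sign : κ → SignType
  realized : ∃ x, signVector f x = sign

variable {f : κ → (Fin d → ℝ) →ᵃ[ℝ] ℝ}

namespace Face

/-- The face as a set of points. -/
def cell (F : Face f) : Set (Fin d → ℝ) := {x | signVector f x = F.sign}

/-- The face through a given point. -/
noncomputable def ofPoint (f : κ → (Fin d → ℝ) →ᵃ[ℝ] ℝ) (x : Fin d → ℝ) : Face f :=
  ⟨signVector f x, x, rfl⟩

/-- Some point of the face. -/
noncomputable def pt (F : Face f) : Fin d → ℝ := F.realized.choose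

theorem pt_mem (F : Face f) : F.pt ∈ F.cell := F.realized.choose_spec

theorem sign_of_mem {F : Face f} {x : Fin d → ℝ} (hx : x ∈ F.cell) (k : κ) :
    SignType.sign (f k x) = F.sign k := congrFun hx k

theorem lineMap_apply_form (f : κ → (Fin d → ℝ) →ᵃ[ℝ] ℝ) (x y : Fin d → ℝ) (s : ℝ) (k : κ) :
    f k (AffineMap.lineMap x y s) = (1 - s) * f k x + s * f k y := by
  rw [AffineMap.apply_lineMap, AffineMap.lineMap_apply_module]; simp

/-- Faces are ordered by inclusion of closures. -/
instance : LE (Face f) := ⟨fun F G => F.cell ⊆ closure G.cell⟩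

/-- The order in terms of sign vectors. -/
theorem le_iff {F G : Face f} : F ≤ G ↔ ∀ k, F.sign k = 0 ∨ F.sign k = G.sign k := by
  constructor
  · intro h k
    have hx := h F.pt_mem
    have hc : Continuous (f k) := (f k).continuous_of_finiteDimensional
    have hs := sign_of_mem F.pt_mem k
    rcases lt_trichotomy (f k F.pt) 0 with h0 | h0 | h0
    · right
      obtain ⟨y, hy, hyG⟩ := mem_closure_iff.1 hx _ (isOpen_lt hc continuous_const) h0
      rw [← hs, ← sign_of_mem hyG k, sign_neg h0, sign_neg hy]
    · left; rw [← hs, h0, sign_zero]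
    · right
      obtain ⟨y, hy, hyG⟩ := mem_closure_iff.1 hx _ (isOpen_lt continuous_const hc) h0
      rw [← hs, ← sign_of_mem hyG k, sign_pos h0, sign_pos hy]
  · intro h x hx
    have hy := G.pt_mem
    have hc : Continuous (fun s : ℝ => (AffineMap.lineMap x G.pt s : Fin d → ℝ)) :=
      AffineMap.lineMap_continuous
    have h0 : (AffineMap.lineMap x G.pt (0 : ℝ) : Fin d → ℝ) = x := AffineMap.lineMap_apply_zero _ _
    have hcl : (0 : ℝ) ∈ closure (Set.Ioo (0 : ℝ) 1) := by
      rw [closure_Ioo (by norm_num)]; simp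
    rw [← h0]
    refine map_mem_closure hc hcl ?_
    intro s hs
    funext k
    change SignType.sign (f k (AffineMap.lineMap x G.pt s)) = G.sign k
    rw [lineMap_apply_form]
    have hsx := sign_of_mem hx k
    have hsy := sign_of_mem hy k
    have h1 : 0 < 1 - s := by linarith [hs.2]
    rcases h k with h' | h'
    · rw [h', sign_eq_zero_iff] at hsx
      rw [hsx, mul_zero, zero_add, sign_mul, sign_pos hs.1, one_mul, hsy]
    · rw [← h'] at hsy
      rw [← h']
      rcases lt_trichotomy (f k x) 0 with h0 | h0 | h0
      · rw [← hsx, sign_neg h0]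
        rw [← hsx, sign_neg h0, sign_eq_neg_one_iff] at hsy
        exact sign_neg (by nlinarith [mul_neg_of_pos_of_neg h1 h0, mul_neg_of_pos_of_neg hs.1 hsy])
      · rw [← hsx, h0, sign_zero]
        rw [← hsx, h0, sign_zero, sign_eq_zero_iff] at hsy
        simp [hsy]
      · rw [← hsx, sign_pos h0]
        rw [← hsx, sign_pos h0, sign_eq_one_iff] at hsy
        exact sign_pos (by nlinarith [mul_pos h1 h0, mul_pos hs.1 hsy])

instance : PartialOrder (Face f) where
  le_refl F := le_iff.2 fun _ => Or.inr rfl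
  le_trans F G K h h' := le_iff.2 fun k => by
    rcases le_iff.1 h k with h1 | h1
    · exact Or.inl h1
    · rcases le_iff.1 h' k with h2 | h2
      · exact Or.inl (h1.trans h2)
      · exact Or.inr (h1.trans h2)
  le_antisymm F G h h' := by
    ext1; funext k
    rcases le_iff.1 h k with h1 | h1
    · rcases le_iff.1 h' k with h2 | h2
      · rw [h1, h2]
      · exact h2.symm
    · exact h1

/-- Dimension of a face. -/
noncomputable def dim (F : Face f) : ℕ := Module.finrank ℝ (vectorSpan ℝ F.cell)

/-- Linear hull of a face. -/
def hull (F : Face f) : Submodule ℝ (Fin d → ℝ) := Submodule.span ℝ F.cell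

theorem exists_comp [Finite κ] (F G : Face f) :
    ∃ x, signVector f x = fun k => if F.sign k = 0 then G.sign k else F.sign k := by
  have key : ∀ k, ∀ᶠ s in nhdsWithin (0 : ℝ) (Set.Ioi 0),
      SignType.sign (f k (AffineMap.lineMap F.pt G.pt s)) =
        if F.sign k = 0 then G.sign k else F.sign k := by
    intro k
    have hsx := sign_of_mem F.pt_mem k
    have hsy := sign_of_mem G.pt_mem k
    have hc : Continuous (fun s : ℝ => f k (AffineMap.lineMap F.pt G.pt s)) :=
      (f k).continuous_of_finiteDimensional.comp AffineMap.lineMap_continuous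
    have hc0 : f k (AffineMap.lineMap F.pt G.pt (0 : ℝ)) = f k F.pt := by simp
    rcases lt_trichotomy (f k F.pt) 0 with h0 | h0 | h0
    · have : ∀ᶠ s in nhds (0 : ℝ), f k (AffineMap.lineMap F.pt G.pt s) < 0 :=
        hc.continuousAt.eventually (Iio_mem_nhds (hc0.trans_lt h0))
      filter_upwards [nhdsWithin_le_nhds this] with s hs
      rw [sign_neg hs, ← hsx, sign_neg h0]; simp
    · filter_upwards [self_mem_nhdsWithin] with s hs
      rw [lineMap_apply_form, h0, mul_zero, zero_add, sign_mul, sign_pos hs, one_mul, hsy,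
        if_pos (by rw [← hsx, h0, sign_zero])]
    · have : ∀ᶠ s in nhds (0 : ℝ), 0 < f k (AffineMap.lineMap F.pt G.pt s) :=
        hc.continuousAt.eventually (Ioi_mem_nhds (h0.trans_eq hc0.symm))
      filter_upwards [nhdsWithin_le_nhds this] with s hs
      rw [sign_pos hs, ← hsx, sign_pos h0]; simp
  obtain ⟨s, hs⟩ := (Filter.eventually_all.2 key).exists
  exact ⟨_, funext hs⟩

/-- The face `G_F` ("first `F`, then `G`"): the face that one enters when leaving a point of `F`
by a small step in the direction of a point of `G`. For a chamber `G` it is the unique chamber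
having `F` as a face that is not separated from `G` by any hyperplane containing `F`. -/
noncomputable def comp [Finite κ] (F G : Face f) : Face f :=
  ⟨fun k => if F.sign k = 0 then G.sign k else F.sign k, exists_comp F G⟩

theorem le_comp [Finite κ] (F G : Face f) : F ≤ F.comp G := le_iff.2 fun k => by
  by_cases h : F.sign k = 0
  · exact Or.inl h
  · right; simp [comp, h]

/-- A chamber is a face that lies on none of the hyperplanes. -/
def IsChamber (F : Face f) : Prop := ∀ k, F.sign k ≠ 0

theorem IsChamber.comp [Finite κ] (F : Face f) {C : Face f} (hC : C.IsChamber) :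
    (F.comp C).IsChamber := fun k => by
  by_cases h : F.sign k = 0
  · simpa [Face.comp, h] using hC k
  · simp [Face.comp, h]

theorem comp_of_isChamber [Finite κ] {C : Face f} (hC : C.IsChamber) (G : Face f) :
    C.comp G = C := by
  ext1; funext k; simp [comp, hC k]

theorem comp_of_le [Finite κ] {F G : Face f} (h : F ≤ G) : F.comp G = G := by
  ext1; funext k
  rcases le_iff.1 h k with h1 | h1
  · simp [comp, h1]
  · by_cases h2 : F.sign k = 0
    · simp [comp, h2]
    · simp only [comp, if_neg h2]; exact h1

/-- `W` is a wall of `C`: a face of `C` of codimension one. -/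
def IsWall (W C : Face f) : Prop := W ≤ C ∧ W.dim + 1 = C.dim

end Face

/-- The chambers of an arrangement. -/
abbrev Chamber (f : κ → (Fin d → ℝ) →ᵃ[ℝ] ℝ) : Type := {C : Face f // C.IsChamber}

/-- The chamber `C_F`. -/
noncomputable def Face.compChamber [Finite κ] (F : Face f) (C : Chamber f) : Chamber f :=
  ⟨F.comp C.1, C.2.comp F⟩

/-- A gallery `C₀, W₀, C₁, …, W_{n-1}, C_n`, where `W_i` is a wall of `C_i` and of `C_{i+1}`. -/
structure Gallery (f : κ → (Fin d → ℝ) →ᵃ[ℝ] ℝ) (n : ℕ) where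
  chamber : Fin (n + 1) → Chamber f
  wall : Fin n → Face f
  wall_left : ∀ i, (wall i).IsWall (chamber i.castSucc).1
  wall_right : ∀ i, (wall i).IsWall (chamber i.succ).1

/-- A gallery is minimal if no gallery with the same ends is shorter. -/
def Gallery.IsMinimal {n : ℕ} (g : Gallery f n) : Prop :=
  ∀ (l : ℕ) (g' : Gallery f l), g'.chamber 0 = g.chamber 0 →
    g'.chamber (Fin.last l) = g.chamber (Fin.last n) → n ≤ l

/-! ### The Salvetti poset -/

/-- Elements `[G, C]` of the Salvetti poset: `C` is a chamber and `G` a face of `C`. -/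
@[ext]
structure SalPoset (f : κ → (Fin d → ℝ) →ᵃ[ℝ] ℝ) where
  face : Face f
  chamber : Chamber f
  face_le : face ≤ chamber.1

/-- `[G', C'] ≤ [G, C]` if `G` is a face of `G'` and `C_{G'} = C'`. -/
instance [Finite κ] : PartialOrder (SalPoset f) where
  le x y := y.face ≤ x.face ∧ x.face.compChamber y.chamber = x.chamber
  le_refl x := ⟨le_rfl, Subtype.ext (Face.comp_of_le x.face_le)⟩
  le_trans x y z hxy hyz := by
    refine ⟨hyz.1.trans hxy.1, ?_⟩
    rw [← hxy.2, ← hyz.2]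
    apply Subtype.ext
    ext1; funext k
    rcases Face.le_iff.1 hxy.1 k with h | h <;>
      simp only [Face.compChamber, Face.comp] <;> split_ifs <;> simp_all
  le_antisymm x y hxy hyx := by
    have h : x.face = y.face := le_antisymm hyx.1 hxy.1
    have h' : x.chamber = y.chamber := by
      rw [← hxy.2, h]; exact Subtype.ext (Face.comp_of_le y.face_le)
    exact SalPoset.ext h h'

/-- `[C, C]` -/
def SalPoset.vertex (C : Chamber f) : SalPoset f := ⟨C.1, C, le_rfl⟩

/-- `[W, C_W]` -/
noncomputable def SalPoset.edge [Finite κ] (W : Face f) (C : Chamber f) : SalPoset f :=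
  ⟨W, W.compChamber C, W.le_comp C.1⟩

theorem SalPoset.vertex_le_edge [Finite κ] {W : Face f} {C : Chamber f} (h : W ≤ C.1)
    (B : Chamber f) : SalPoset.vertex C ≤ SalPoset.edge W B :=
  ⟨h, Subtype.ext (Face.comp_of_isChamber C.2 _)⟩

end Affine

/-! ### Central arrangements -/

section Linear

variable {d : ℕ} {κ : Type}

/-- The forms of a central arrangement. -/
noncomputable def linForms (φ : κ → (Fin d → ℝ) →ₗ[ℝ] ℝ) : κ → (Fin d → ℝ) →ᵃ[ℝ] ℝ :=
  fun k => (φ k).toAffineMap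

variable {φ : κ → (Fin d → ℝ) →ₗ[ℝ] ℝ}

/-- The negative `-C` of a chamber of a central arrangement. -/
noncomputable def negChamber (C : Chamber (linForms φ)) : Chamber (linForms φ) :=
  ⟨⟨fun k => -C.1.sign k, -C.1.pt, funext fun k => by
      have h := Face.sign_of_mem C.1.pt_mem k
      rw [← h]
      change SignType.sign (φ k (-C.1.pt)) = -SignType.sign (φ k C.1.pt)
      rw [map_neg, Left.sign_neg]⟩,
    fun k h => C.2 k (by simpa using h)⟩

/-- The face of the subarrangement indexed by `s` that contains the face `F`. -/
noncomputable def restrict (s : Set κ) (F : Face (linForms φ)) :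
    Face (linForms fun i : s => φ i) :=
  ⟨fun i => F.sign i, F.pt, funext fun i => Face.sign_of_mem F.pt_mem i.1⟩

theorem restrict_mono (s : Set κ) {F G : Face (linForms φ)} (h : F ≤ G) :
    restrict s F ≤ restrict s G :=
  Face.le_iff.2 fun i => Face.le_iff.1 h i.1

/-- The chamber of the subarrangement indexed by `s` that contains the chamber `C`. -/
noncomputable def restrictChamber (s : Set κ) (C : Chamber (linForms φ)) :
    Chamber (linForms fun i : s => φ i) :=
  ⟨restrict s C.1, fun i => C.2 i.1⟩

/-- The chamber `C` is adjacent to the flat `X`: some face of `C` has linear hull `X`. -/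
def AdjacentTo (C : Chamber (linForms φ)) (X : Submodule ℝ (Fin d → ℝ)) : Prop :=
  ∃ F : Face (linForms φ), F ≤ C.1 ∧ F.hull = X

/-- The `k`-th hyperplane separates `C` from `D`. -/
def Separates (k : κ) (C D : Chamber (linForms φ)) : Prop := C.1.sign k ≠ D.1.sign k

/-- `D = op_X(C)`: the closures of `C` and `D` meet `X` in the same set, and the hyperplanes
that separate `C` from `D` are exactly those that contain `X`. -/
def IsOp (X : Submodule ℝ (Fin d → ℝ)) (C D : Chamber (linForms φ)) : Prop :=
  closure C.1.cell ∩ (X : Set (Fin d → ℝ)) = closure D.1.cell ∩ (X : Set (Fin d → ℝ)) ∧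
    ∀ k, Separates k C D ↔ X ≤ LinearMap.ker (φ k)

end Linear

end RealArr

/-! ### First homology of (the nerve of) a small category -/

namespace NerveChains

variable (C : Type) [Category.{0} C]

/-- `1`-simplices of the nerve: arrows. -/
abbrev Arr : Type := Σ x y : C, x ⟶ y

/-- `2`-simplices of the nerve: composable pairs of arrows. -/
abbrev Pair : Type := Σ x y z : C, (x ⟶ y) × (y ⟶ z)

/-- The boundary `C₁ → C₀` of the simplicial chain complex of the nerve:
`∂(x ⟶ y) = y - x`. -/
noncomputable def bd₁ : (Arr C →₀ ℤ) →ₗ[ℤ] (C →₀ ℤ) :=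
  Finsupp.lift (C →₀ ℤ) ℤ (Arr C) fun a => Finsupp.single a.2.1 1 - Finsupp.single a.1 1

/-- The boundary `C₂ → C₁` of the simplicial chain complex of the nerve:
`∂(f, g) = g - (f ≫ g) + f`. -/
noncomputable def bd₂ : (Pair C →₀ ℤ) →ₗ[ℤ] (Arr C →₀ ℤ) :=
  Finsupp.lift (Arr C →₀ ℤ) ℤ (Pair C) fun p =>
    Finsupp.single ⟨p.2.1, p.2.2.1, p.2.2.2.2⟩ 1
      - Finsupp.single ⟨p.1, p.2.2.1, p.2.2.2.1 ≫ p.2.2.2.2⟩ 1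
      + Finsupp.single ⟨p.1, p.2.1, p.2.2.2.1⟩ 1

/-- `1`-cycles. -/
noncomputable abbrev Cycles : Submodule ℤ (Arr C →₀ ℤ) := LinearMap.ker (bd₁ C)

/-- The first integral homology group of the nerve. -/
abbrev H₁ : Type := Cycles C ⧸ (LinearMap.range (bd₂ C)).submoduleOf (Cycles C)

variable {C}

/-- The homology class of a `1`-cycle. -/
noncomputable def homologyClass (z : Arr C →₀ ℤ) (hz : z ∈ Cycles C) : H₁ C :=
  Submodule.Quotient.mk ⟨z, hz⟩

end NerveChains

/-! ### Toric arrangements -/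

open RealArr NerveChains

/-- The hypertorus `χ = t` in the compact torus `(ℝ / ℤ) ^ d` (in multiplicative notation
`{z | z ^ χ = exp (2 π i t)}`). -/
def hypertorus {d : ℕ} (χ : Fin d → ℤ) (t : ℝ) : Set (Fin d → UnitAddCircle) :=
  {x | ∑ j, χ j • x j = (t : UnitAddCircle)}

/-- A real complexified toric arrangement, indexed by `ι`: pairwise distinct connected hypertori,
each given by a primitive character and a level. A primitive `χ` is in particular nonzero. -/
structure ToricArrangement (d : ℕ) (ι : Type) where
  char : ι → Fin d → ℤ
  level : ι → ℝ
  primitive : ∀ i, ∀ n : ℤ, (∀ j, n ∣ char i j) → IsUnit n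
  distinct : Function.Injective fun i => hypertorus (char i) (level i)

namespace ToricArrangement

variable {d : ℕ} {ι : Type} (A : ToricArrangement d ι)

/-- The hypertorus with index `i`. -/
def tor (i : ι) : Set (Fin d → UnitAddCircle) := hypertorus (A.char i) (A.level i)

/-- The character as a linear form on the universal cover `ℝ ^ d`. -/
noncomputable def lin (i : ι) : (Fin d → ℝ) →ₗ[ℝ] ℝ :=
  ∑ j, (A.char i j : ℝ) • LinearMap.proj j

theorem lin_apply (i : ι) (x : Fin d → ℝ) : A.lin i x = ∑ j, (A.char i j : ℝ) * x j := by
  simp [lin]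

/-- The linear hyperplane `H₀` of a hypertorus `H`. -/
noncomputable def hyp (i : ι) : Submodule ℝ (Fin d → ℝ) := LinearMap.ker (A.lin i)

/-- The forms of the central arrangement `𝒜₀` of all `H₀`. Two parallel hypertori give
the same hyperplane; such a repetition changes neither the faces nor their order. -/
noncomputable abbrev central : ι → (Fin d → ℝ) →ᵃ[ℝ] ℝ := linForms A.lin

/-- The arrangement is essential: the characters span. -/
def IsEssential : Prop := ⨅ i, A.hyp i = ⊥

/-- The forms of the lifted periodic arrangement in the universal cover: hyperplanes
`χ_i = t_i + k` for all `i` and all integers `k`. -/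
noncomputable def lifted : ι × ℤ → (Fin d → ℝ) →ᵃ[ℝ] ℝ := fun p =>
  (A.lin p.1).toAffineMap - AffineMap.const ℝ (Fin d → ℝ) (A.level p.1 + p.2)

theorem lifted_apply (p : ι × ℤ) (x : Fin d → ℝ) :
    A.lifted p x = A.lin p.1 x - (A.level p.1 + p.2) := by
  simp [lifted]

/-- Integer vectors as real vectors. -/
def intVec {d : ℕ} (v : Fin d → ℤ) : Fin d → ℝ := fun j => (v j : ℝ)

theorem intVec_add {d : ℕ} (v w : Fin d → ℤ) : intVec (v + w) = intVec v + intVec w := by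
  funext j; simp [intVec]

theorem lin_intVec (i : ι) (v : Fin d → ℤ) :
    A.lin i (intVec v) = ((∑ j, A.char i j * v j : ℤ) : ℝ) := by
  simp [lin_apply, intVec]

theorem lifted_add_intVec (i : ι) (k : ℤ) (v : Fin d → ℤ) (x : Fin d → ℝ) :
    A.lifted (i, k) (x + intVec v) = A.lifted (i, k - ∑ j, A.char i j * v j) x := by
  simp only [lifted_apply, map_add, lin_intVec]; push_cast; ring

/-- Deck transformations act on the lifted faces by translation. -/
noncomputable instance : AddAction (Fin d → ℤ) (Face A.lifted) where
  vadd v F := ⟨fun p => F.sign (p.1, p.2 - ∑ j, A.char p.1 j * v j), F.pt + intVec v, by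
    funext p
    change SignType.sign (A.lifted (p.1, p.2) (F.pt + intVec v)) = _
    rw [lifted_add_intVec]; exact Face.sign_of_mem F.pt_mem _⟩
  zero_vadd F := by
    apply Face.ext; funext p
    change F.sign (p.1, p.2 - ∑ j, A.char p.1 j * (0 : Fin d → ℤ) j) = _
    simp
  add_vadd v w F := by
    apply Face.ext; funext p
    change F.sign (p.1, p.2 - ∑ j, A.char p.1 j * (v + w) j) =
      F.sign (p.1, p.2 - ∑ j, A.char p.1 j * v j - ∑ j, A.char p.1 j * w j)
    simp [mul_add, Finset.sum_add_distrib, sub_sub]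

theorem vadd_sign (v : Fin d → ℤ) (F : Face A.lifted) (p : ι × ℤ) :
    (v +ᵥ F).sign p = F.sign (p.1, p.2 - ∑ j, A.char p.1 j * v j) := rfl

theorem add_mem_vadd_cell {v : Fin d → ℤ} {F : Face A.lifted} {x : Fin d → ℝ}
    (hx : x ∈ F.cell) : x + intVec v ∈ (v +ᵥ F).cell := by
  funext p
  change SignType.sign (A.lifted (p.1, p.2) (x + intVec v)) = _
  rw [lifted_add_intVec]; exact Face.sign_of_mem hx _

theorem vadd_mono (v : Fin d → ℤ) {F G : Face A.lifted} (h : F ≤ G) : v +ᵥ F ≤ v +ᵥ G :=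
  Face.le_iff.2 fun _ => Face.le_iff.1 h _

/-- The faces of the cellularization of the compact torus: the lifted faces modulo deck
transformations. -/
def TFace : Type := AddAction.orbitRel.Quotient (Fin d → ℤ) (Face A.lifted)

namespace TFace

variable {A}

/-- A lift of the face to the universal cover. -/
noncomputable def rep (F : A.TFace) : Face A.lifted := Quotient.out F

/-- The face as a subset of the compact torus. -/
def carrier (F : A.TFace) : Set (Fin d → UnitAddCircle) :=
  (fun (x : Fin d → ℝ) (j : Fin d) => (x j : UnitAddCircle)) '' F.rep.cell

/-- The dimension of the face. -/
noncomputable def dim (F : A.TFace) : ℕ := F.rep.dim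

/-- The (index set of the) subarrangement `𝒜_F` of the hypertori that contain `F`. -/
def through (F : A.TFace) : Set ι := {i | F.carrier ⊆ A.tor i}

theorem mem_tor_iff (i : ι) (x : Fin d → ℝ) :
    (fun j => (x j : UnitAddCircle)) ∈ A.tor i ↔ ∃ k : ℤ, A.lifted (i, k) x = 0 := by
  have h1 : (∑ j, A.char i j • (x j : UnitAddCircle)) = ((A.lin i x : ℝ) : UnitAddCircle) := by
    rw [lin_apply]
    simp only [← zsmul_eq_mul]
    symm
    exact (map_sum (QuotientAddGroup.mk' (AddSubgroup.zmultiples (1 : ℝ))) _ _).trans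
      (Finset.sum_congr rfl fun j _ => map_zsmul (QuotientAddGroup.mk' _) _ _)
  change (∑ j, A.char i j • (x j : UnitAddCircle)) = _ ↔ _
  rw [h1, ← sub_eq_zero, ← AddCircle.coe_sub, AddCircle.coe_eq_zero_iff]
  refine exists_congr fun k => ?_
  rw [lifted_apply, zsmul_eq_mul, mul_one]
  constructor <;> intro h <;> linarith

theorem mem_through_iff {F : A.TFace} {i : ι} :
    i ∈ F.through ↔ ∃ k : ℤ, F.rep.sign (i, k) = 0 := by
  constructor
  · intro h
    obtain ⟨k, hk⟩ := (mem_tor_iff i F.rep.pt).1 (h ⟨_, F.rep.pt_mem, rfl⟩)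
    exact ⟨k, by rw [← Face.sign_of_mem F.rep.pt_mem, hk, sign_zero]⟩
  · rintro ⟨k, hk⟩ _ ⟨x, hx, rfl⟩
    refine (mem_tor_iff i x).2 ⟨k, ?_⟩
    rw [← sign_eq_zero_iff, Face.sign_of_mem hx, hk]

/-- The sign vector of a lifted face at a point of the unit cube takes finitely many values. -/
theorem finite_signVector [Finite ι] :
    (signVector A.lifted '' Set.Icc (0 : Fin d → ℝ) 1).Finite := by
  classical
  let φ : (ι → ℤ × ℤ) → (ι × ℤ → SignType) := fun c p =>
    if p.2 < (c p.1).1 then 1 else if (c p.1).2 < p.2 then -1 else 0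
  let N : ι → ℝ := fun i => ∑ j, |(A.char i j : ℝ)| + |A.level i|
  let S : Set (ι → ℤ × ℤ) :=
    Set.univ.pi fun i => Set.Icc (⌊-N i⌋) ⌈N i⌉ ×ˢ Set.Icc (⌊-N i⌋) ⌈N i⌉
  have hS : S.Finite := Set.Finite.pi fun i => (Set.finite_Icc _ _).prod (Set.finite_Icc _ _)
  refine (hS.image φ).subset ?_
  rintro _ ⟨x, hx, rfl⟩
  refine ⟨fun i => (⌈A.lin i x - A.level i⌉, ⌊A.lin i x - A.level i⌋), ?_, ?_⟩
  · intro i _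
    have hb : |A.lin i x - A.level i| ≤ N i := by
      refine (abs_sub _ _).trans (add_le_add ?_ le_rfl)
      rw [lin_apply]
      refine (Finset.abs_sum_le_sum_abs _ _).trans (Finset.sum_le_sum fun j _ => ?_)
      rw [abs_mul]
      refine mul_le_of_le_one_right (abs_nonneg _) ?_
      rw [abs_of_nonneg (hx.1 j)]; exact hx.2 j
    obtain ⟨h1, h2⟩ := abs_le.1 hb
    refine ⟨⟨?_, Int.ceil_le_ceil h2⟩, Int.floor_le_floor h1, ?_⟩
    · exact (Int.floor_le_floor h1).trans (Int.floor_le_ceil _)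
    · exact (Int.floor_le_ceil _).trans (Int.ceil_le_ceil h2)
  · funext ⟨i, k⟩
    change (if k < ⌈A.lin i x - A.level i⌉ then (1 : SignType)
      else if ⌊A.lin i x - A.level i⌋ < k then -1 else 0) = SignType.sign (A.lifted (i, k) x)
    rw [lifted_apply]
    simp only [Int.lt_ceil, Int.floor_lt]
    split_ifs with h1 h2
    · exact (sign_pos (by linarith)).symm
    · exact (sign_neg (by linarith)).symm
    · have : A.lin i x - (A.level i + k) = 0 := by linarith
      simp [this]

/-- A toric arrangement has finitely many faces. -/
instance [Finite ι] : Finite A.TFace := by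
  have hfin := finite_signVector (A := A)
  have key : ∀ F : A.TFace, ∃ x ∈ Set.Icc (0 : Fin d → ℝ) 1,
      F = Quotient.mk (AddAction.orbitRel _ _) (Face.ofPoint A.lifted x) := by
    intro F
    let y := F.rep.pt
    let v : Fin d → ℤ := fun j => -⌊y j⌋
    refine ⟨y + intVec v, ⟨fun j => ?_, fun j => ?_⟩, ?_⟩
    · have := Int.floor_le (y j)
      simp only [Pi.zero_apply, Pi.add_apply, intVec, v]; push_cast; linarith
    · have := Int.lt_floor_add_one (y j)
      simp only [Pi.one_apply, Pi.add_apply, intVec, v]; push_cast; linarith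
    · have h : Face.ofPoint A.lifted (y + intVec v) = v +ᵥ F.rep :=
        Face.ext (add_mem_vadd_cell A F.rep.pt_mem)
      rw [h]
      have h2 : F = Quotient.mk (AddAction.orbitRel _ _) F.rep := (Quotient.out_eq F).symm
      conv_lhs => rw [h2]
      exact (Quotient.sound ⟨v, rfl⟩ : (Quotient.mk (AddAction.orbitRel _ _) (v +ᵥ F.rep)) =
        Quotient.mk (AddAction.orbitRel _ _) F.rep).symm
  choose pnt hp hF using key
  have : Finite (signVector A.lifted '' Set.Icc (0 : Fin d → ℝ) 1) := hfin
  refine Finite.of_injective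
    (fun F : A.TFace => (⟨signVector A.lifted (pnt F), pnt F, hp F, rfl⟩ :
      (signVector A.lifted '' Set.Icc (0 : Fin d → ℝ) 1))) ?_
  intro F G h
  have h' : signVector A.lifted (pnt F) = signVector A.lifted (pnt G) := congrArg Subtype.val h
  rw [hF F, hF G]
  exact congrArg _ (Face.ext h')

/-- The face category of the arrangement, i.e. the quotient of the poset of lifted faces by
the deck transformations. An arrow `F ⟶ G` is an orbit of pairs `F' ≤ G'` of lifts; such an orbit
contains exactly one pair of the form `F.rep ≤ v +ᵥ G.rep` (for essential arrangements the action
is free), and is recorded by `v`. -/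
noncomputable instance : Category A.TFace where
  Hom F G := {v : Fin d → ℤ // F.rep ≤ v +ᵥ G.rep}
  id F := ⟨0, by rw [zero_vadd]⟩
  comp m n := ⟨m.1 + n.1, by
    rw [add_vadd]; exact m.2.trans (vadd_mono A m.1 n.2)⟩
  id_comp m := Subtype.ext (zero_add _)
  comp_id m := Subtype.ext (add_zero _)
  assoc m n k := Subtype.ext (add_assoc _ _ _)

/-- The local central arrangement `𝒜[F]`: the hyperplanes `H₀` for the hypertori `H` through
`F`. -/
noncomputable abbrev loc (F : A.TFace) : F.through → (Fin d → ℝ) →ᵃ[ℝ] ℝ :=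
  linForms fun i : F.through => A.lin i

/-- The face of `𝒜[F]` that contains a given face of `𝒜₀`. -/
noncomputable abbrev res (F : A.TFace) (K : Face A.central) : Face F.loc := restrict F.through K

/-- The chamber `C(F)` of `𝒜[F]` that contains a given chamber `C` of `𝒜₀`. -/
noncomputable abbrev resC (F : A.TFace) (C : Chamber A.central) : Chamber F.loc :=
  restrictChamber F.through C

/-- For an arrow `m : F ⟶ G`, the face `F_m` of `𝒜[F]`: the face that contains the directions
pointing from the lift of `F` into the corresponding lift of `G`. -/
noncomputable def dir {F G : A.TFace} (m : F ⟶ G) : Face F.loc :=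
  Face.ofPoint F.loc ((m.1 +ᵥ G.rep).pt - F.rep.pt)

theorem eq_level {L : Face A.lifted} {i : ι} {k : ℤ} (h : L.sign (i, k) = 0) {x : Fin d → ℝ}
    (hx : x ∈ L.cell) : A.lin i x = A.level i + k := by
  have h1 := Face.sign_of_mem hx (i, k)
  rw [h, sign_eq_zero_iff, lifted_apply] at h1
  exact sub_eq_zero.1 h1

theorem sign_sub_level {L : Face A.lifted} (i : ι) (k : ℤ) {x : Fin d → ℝ} (hx : x ∈ L.cell) :
    SignType.sign (A.lin i x - (A.level i + k)) = L.sign (i, k) := by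
  rw [← Face.sign_of_mem hx, lifted_apply]

theorem dir_sign {F G : A.TFace} (m : F ⟶ G) (i : F.through) {p q : Fin d → ℝ}
    (hp : p ∈ F.rep.cell) (hq : q ∈ (m.1 +ᵥ G.rep).cell) :
    (dir m).sign i = SignType.sign (A.lin i (q - p)) := by
  obtain ⟨k, hk⟩ := mem_through_iff.1 i.2
  change SignType.sign (A.lin i ((m.1 +ᵥ G.rep).pt - F.rep.pt)) = _
  rw [map_sub (A.lin i), map_sub (A.lin i), eq_level hk hp, eq_level hk F.rep.pt_mem, sign_sub_level _ _ hq,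
    sign_sub_level _ _ (Face.pt_mem _)]

theorem exists_level {F G : A.TFace} (m : F ⟶ G) {i : ι} (hi : i ∈ G.through) :
    ∃ k : ℤ, (m.1 +ᵥ G.rep).sign (i, k) = 0 ∧ F.rep.sign (i, k) = 0 := by
  obtain ⟨k, hk⟩ := mem_through_iff.1 hi
  have h : (m.1 +ᵥ G.rep).sign (i, k + ∑ j, A.char i j * m.1 j) = 0 := by
    rw [vadd_sign]; simpa using hk
  refine ⟨_, h, ?_⟩
  rcases Face.le_iff.1 m.2 (i, k + ∑ j, A.char i j * m.1 j) with h' | h'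
  · exact h'
  · exact h'.trans h

theorem through_subset {F G : A.TFace} (m : F ⟶ G) : G.through ⊆ F.through := fun _ hi =>
  let ⟨k, _, hk⟩ := exists_level m hi
  mem_through_iff.2 ⟨k, hk⟩

theorem dir_eq_zero {F G : A.TFace} (m : F ⟶ G) (i : F.through) (hi : (i : ι) ∈ G.through) :
    (dir m).sign i = 0 := by
  obtain ⟨k, hk, hk'⟩ := exists_level m hi
  rw [dir_sign m i F.rep.pt_mem (Face.pt_mem _), map_sub (A.lin i), eq_level hk (Face.pt_mem _),
    eq_level hk' F.rep.pt_mem, sub_self, sign_zero]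

theorem dir_ne_zero {F G : A.TFace} (m : F ⟶ G) (i : F.through) (hi : (i : ι) ∉ G.through) :
    (dir m).sign i ≠ 0 := by
  obtain ⟨k, hk⟩ := mem_through_iff.1 i.2
  rw [dir_sign m i F.rep.pt_mem (Face.pt_mem _), map_sub (A.lin i), eq_level hk F.rep.pt_mem,
    sign_sub_level _ _ (Face.pt_mem _), vadd_sign]
  exact fun h => hi (mem_through_iff.2 ⟨_, h⟩)

open Classical in
/-- The inclusion `i_m` of the faces of `𝒜[G]` into the faces of `𝒜[F]`: on the hyperplanes of
`𝒜[G]` the sign is kept, on the other hyperplanes of `𝒜[F]` it is the sign of `F_m`. -/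
noncomputable def incl [Finite ι] {F G : A.TFace} (m : F ⟶ G) (K : Face G.loc) : Face F.loc where
  sign i := if h : (i : ι) ∈ G.through then K.sign ⟨i, h⟩ else (dir m).sign i
  realized := by
    obtain ⟨x, hx⟩ := Face.exists_comp (dir m) (Face.ofPoint F.loc K.pt)
    refine ⟨x, hx.trans (funext fun i => ?_)⟩
    by_cases h : (i : ι) ∈ G.through
    · rw [dif_pos h, if_pos (dir_eq_zero m i h)]
      exact Face.sign_of_mem K.pt_mem ⟨i, h⟩
    · rw [dif_neg h, if_neg (dir_ne_zero m i h)]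

section

variable [Finite ι]

theorem incl_sign_of_mem {F G : A.TFace} (m : F ⟶ G) (K : Face G.loc) (i : F.through)
    (h : (i : ι) ∈ G.through) : (incl m K).sign i = K.sign ⟨i, h⟩ := dif_pos h

theorem incl_sign_of_notMem {F G : A.TFace} (m : F ⟶ G) (K : Face G.loc) (i : F.through)
    (h : (i : ι) ∉ G.through) : (incl m K).sign i = (dir m).sign i := dif_neg h

theorem incl_mono {F G : A.TFace} (m : F ⟶ G) {K L : Face G.loc} (hKL : K ≤ L) :
    incl m K ≤ incl m L := Face.le_iff.2 fun i => by
  by_cases h : (i : ι) ∈ G.through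
  · rw [incl_sign_of_mem m K i h, incl_sign_of_mem m L i h]
    exact Face.le_iff.1 hKL _
  · rw [incl_sign_of_notMem m K i h, incl_sign_of_notMem m L i h]
    exact Or.inr rfl

/-- The inclusion `i_m` on chambers. -/
noncomputable def inclC {F G : A.TFace} (m : F ⟶ G) (C : Chamber G.loc) : Chamber F.loc :=
  ⟨incl m C.1, fun i => by
    by_cases h : (i : ι) ∈ G.through
    · rw [incl_sign_of_mem m _ i h]; exact C.2 _
    · rw [incl_sign_of_notMem m _ i h]; exact dir_ne_zero m i h⟩

theorem incl_comp_face {F G : A.TFace} (m : F ⟶ G) (K L : Face G.loc) :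
    incl m (K.comp L) = (incl m K).comp (incl m L) := by
  apply Face.ext; funext i
  by_cases h : (i : ι) ∈ G.through
  · simp only [Face.comp, incl_sign_of_mem m _ i h]
  · simp only [Face.comp, incl_sign_of_notMem m _ i h, dir_ne_zero m i h, if_false]

theorem incl_id (F : A.TFace) (K : Face F.loc) : incl (𝟙 F) K = K := by
  apply Face.ext; funext i
  exact incl_sign_of_mem _ _ i i.2

theorem incl_incl {F G L : A.TFace} (m : F ⟶ G) (n : G ⟶ L) (K : Face L.loc) :
    incl (m ≫ n) K = incl m (incl n K) := by
  apply Face.ext; funext i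
  have hp := F.rep.pt_mem
  have hg := G.rep.pt_mem
  have hq := (n.1 +ᵥ L.rep).pt_mem
  have hq' : (n.1 +ᵥ L.rep).pt + intVec m.1 ∈ ((m ≫ n).1 +ᵥ L.rep).cell := by
    change _ ∈ ((m.1 + n.1) +ᵥ L.rep).cell
    rw [add_vadd]; exact add_mem_vadd_cell A hq
  have hg' : G.rep.pt + intVec m.1 ∈ (m.1 +ᵥ G.rep).cell := add_mem_vadd_cell A hg
  by_cases hL : (i : ι) ∈ L.through
  · have hG := through_subset n hL
    rw [incl_sign_of_mem _ _ i hL, incl_sign_of_mem _ _ i hG]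
    exact (incl_sign_of_mem n K ⟨i, hG⟩ hL).symm
  · rw [incl_sign_of_notMem _ _ i hL, dir_sign _ i hp hq']
    by_cases hG : (i : ι) ∈ G.through
    · rw [incl_sign_of_mem _ _ i hG]
      refine Eq.trans ?_ (incl_sign_of_notMem n K ⟨i, hG⟩ hL).symm
      rw [dir_sign n ⟨i, hG⟩ hg hq]
      obtain ⟨k, hk, hk'⟩ := exists_level m hG
      have e : A.lin i (G.rep.pt + intVec m.1) = A.lin i F.rep.pt := by
        rw [eq_level hk hg', eq_level hk' hp]
      rw [map_sub (A.lin i), map_sub (A.lin i), ← e, map_add, map_add]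
      congr 1; ring
    · rw [incl_sign_of_notMem _ _ i hG, dir_sign m i hp hg']
      obtain ⟨k, hk⟩ := mem_through_iff.1 i.2
      rw [map_sub (A.lin i), map_sub (A.lin i), eq_level hk hp, sign_sub_level _ _ hg', sign_sub_level _ _ hq']
      have hle : m.1 +ᵥ G.rep ≤ (m ≫ n).1 +ᵥ L.rep := by
        change _ ≤ (m.1 + n.1) +ᵥ L.rep
        rw [add_vadd]; exact vadd_mono A m.1 n.2
      rcases Face.le_iff.1 hle (i, k) with h | h
      · exact absurd (mem_through_iff.2 ⟨_, h⟩) hG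
      · exact h.symm

/-- The map `𝒟(m)` from the Salvetti poset of `𝒜[G]` to that of `𝒜[F]`:
`[K, C] ↦ [i_m(K), i_m(C)]`. -/
noncomputable def salMap {F G : A.TFace} (m : F ⟶ G) : SalPoset G.loc →o SalPoset F.loc where
  toFun x := ⟨incl m x.face, inclC m x.chamber, incl_mono m x.face_le⟩
  monotone' x y h := by
    refine ⟨incl_mono m h.1, Subtype.ext ?_⟩
    change (incl m x.face).comp (incl m y.chamber.1) = incl m x.chamber.1
    rw [← incl_comp_face, ← h.2]; rfl

theorem salMap_id (F : A.TFace) : salMap (𝟙 F) = OrderHom.id := by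
  refine OrderHom.ext _ _ (funext fun x => ?_)
  exact SalPoset.ext (incl_id F x.face) (Subtype.ext (incl_id F x.chamber.1))

theorem salMap_comp {F G L : A.TFace} (m : F ⟶ G) (n : G ⟶ L) :
    salMap (m ≫ n) = (salMap m).comp (salMap n) := by
  refine OrderHom.ext _ _ (funext fun x => ?_)
  exact SalPoset.ext (incl_incl m n x.face) (Subtype.ext (incl_incl m n x.chamber.1))

end

end TFace

section Salvetti

variable [Finite ι]

/-- The diagram `𝒟 : 𝓕(𝒜)ᵒᵖ ⥤ Preord` of the Salvetti posets of the local arrangements. -/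
noncomputable def diagram : A.TFaceᵒᵖ ⥤ Preord.{0} where
  obj F := Preord.of (SalPoset F.unop.loc)
  map m := Preord.ofHom (TFace.salMap m.unop)
  map_id F := congrArg Preord.ofHom (TFace.salMap_id F.unop)
  map_comp m n := congrArg Preord.ofHom (TFace.salMap_comp n.unop m.unop)

/-- The toric Salvetti category: the Grothendieck construction `∫ 𝒟`. The nerve of this category
is the Salvetti complex `Sal(𝒜)`. -/
abbrev SalCat : Type := Grothendieck (A.diagram ⋙ preordToCat)

variable {A}

/-- The object `(F, x)` of the toric Salvetti category. -/
def obj (F : A.TFace) (x : SalPoset F.loc) : A.SalCat := ⟨Opposite.op F, x⟩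

/-- The arrow `(G, x) ⟶ (F, y)` over `m : F ⟶ G` given by `𝒟(m)(x) ≤ y`, as a `1`-simplex. -/
noncomputable def arrOver {F G : A.TFace} (m : F ⟶ G) (x : SalPoset G.loc) (y : SalPoset F.loc)
    (h : TFace.salMap m x ≤ y) : Arr A.SalCat :=
  ⟨obj G x, obj F y, ⟨m.op, (homOfLE h : TFace.salMap m x ⟶ y)⟩⟩

/-- The arrow `(F, x) ⟶ (F, y)` over the identity given by `x ≤ y`, as a `1`-simplex. -/
noncomputable def arrIn (F : A.TFace) (x y : SalPoset F.loc) (h : x ≤ y) : Arr A.SalCat :=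
  ⟨obj F x, obj F y,
    (Grothendieck.ι (A.diagram ⋙ preordToCat) (Opposite.op F)).map (homOfLE h : x ⟶ y)⟩

end Salvetti

/-! ### Layers -/

/-- A layer: a connected component of an intersection of hypertori. -/
def IsLayer (L : Set (Fin d → UnitAddCircle)) : Prop :=
  ∃ S : Set ι, ∃ x ∈ ⋂ i ∈ S, A.tor i, L = connectedComponentIn (⋂ i ∈ S, A.tor i) x

/-- The flat `X_L`: the intersection of the hyperplanes `H₀` for the hypertori `H ⊇ L`. The
dimension of the layer `L` is the dimension of `X_L`. -/
noncomputable def flat (L : Set (Fin d → UnitAddCircle)) : Submodule ℝ (Fin d → ℝ) :=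
  ⨅ i ∈ {i | L ⊆ A.tor i}, A.hyp i

variable {A}

/-- `L` is the support of the face `F`: the smallest layer that contains `F`. -/
def TFace.IsSupport (F : A.TFace) (L : Set (Fin d → UnitAddCircle)) : Prop :=
  A.IsLayer L ∧ F.carrier ⊆ L ∧ ∀ L', A.IsLayer L' → F.carrier ⊆ L' → L ⊆ L'

section Cycles

theorem wall_le_left {n : ℕ} (g : Gallery A.central n) (F : A.TFace) (i : Fin n) :
    F.res (g.wall i) ≤ (F.resC (g.chamber i.castSucc)).1 :=
  restrict_mono _ (g.wall_left i).1

theorem wall_le_right {n : ℕ} (g : Gallery A.central n) (F : A.TFace) (i : Fin n) :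
    F.res (g.wall i) ≤ (F.resC (g.chamber i.succ)).1 :=
  restrict_mono _ (g.wall_right i).1

variable [Finite ι]

/-- For a face `W` of `𝒜[F]` contained in the closures of the chambers `C` and `C'`, and two
chambers `D`, `D'` of `𝒜[F]`, the chain
`([C,C] → [W,D_W]) - ([C',C'] → [W,D_W]) + ([C',C'] → [W,D'_W]) - ([C,C] → [W,D'_W])`. -/
noncomputable def squareChain (F : A.TFace) (W : Face F.loc) (C C' D D' : Chamber F.loc)
    (h : W ≤ C.1) (h' : W ≤ C'.1) : Arr A.SalCat →₀ ℤ :=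
  Finsupp.single (arrIn F _ _ (SalPoset.vertex_le_edge h D)) 1
    - Finsupp.single (arrIn F _ _ (SalPoset.vertex_le_edge h' D)) 1
    + Finsupp.single (arrIn F _ _ (SalPoset.vertex_le_edge h' D')) 1
    - Finsupp.single (arrIn F _ _ (SalPoset.vertex_le_edge h D')) 1

theorem squareChain_mem (F : A.TFace) (W : Face F.loc) (C C' D D' : Chamber F.loc)
    (h : W ≤ C.1) (h' : W ≤ C'.1) : squareChain F W C C' D D' h h' ∈ Cycles A.SalCat := by
  rw [LinearMap.mem_ker, squareChain]
  simp only [map_add, map_sub, bd₁, Finsupp.lift_apply, Finsupp.sum_single_index, zero_smul,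
    one_smul, arrIn]
  abel

/-! ### The cycles `Λ` and `Ξ`

A gallery `g = (C₀, W₀, C₁, …)` of `𝒜₀` induces a gallery of `𝒜[F]`, by restricting chambers and
walls. The `i`-th step is seen in `𝒜[F]` if `C_i(F) ≠ C_{i+1}(F)`; in that case `W_i(F)` is the
wall of `𝒜[F]` between these two chambers. Skipping the steps that are not seen numbers
the distinct chambers among the `C_i(F)`. -/

variable {n : ℕ} (g : Gallery A.central n)

/-- The `i`-th step of the gallery is seen in `𝒜[F]`. -/
def Seen (F : A.TFace) (i : Fin n) : Prop :=
  F.resC (g.chamber i.castSucc) ≠ F.resC (g.chamber i.succ)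

/-- The vertex `v_i = [C_i(F), C_i(F)]`. -/
noncomputable def v (F : A.TFace) (i : Fin (n + 1)) : SalPoset F.loc :=
  SalPoset.vertex (F.resC (g.chamber i))

/-- The element `e_i = [W_i(F), B(F)_{W_i(F)}]`, between `v_i` and `v_{i+1}`. -/
noncomputable def e (B : Chamber A.central) (F : A.TFace) (i : Fin n) : SalPoset F.loc :=
  SalPoset.edge (F.res (g.wall i)) (F.resC B)

/-- The arrow `v_i ⟶ e_i`. -/
noncomputable def leftArr (B : Chamber A.central) (F : A.TFace) (i : Fin n) : Arr A.SalCat :=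
  arrIn F (v g F i.castSucc) (e g B F i) (SalPoset.vertex_le_edge (wall_le_left g F i) _)

/-- The arrow `v_{i+1} ⟶ e_i`. -/
noncomputable def rightArr (B : Chamber A.central) (F : A.TFace) (i : Fin n) : Arr A.SalCat :=
  arrIn F (v g F i.succ) (e g B F i) (SalPoset.vertex_le_edge (wall_le_right g F i) _)

/-- The edges of the closed path `Λ_B^M`: for the faces `F` of the layer `M` the arrows
`v_i ⟶ e_i ⟵ v_{i+1}` over `F`, and for the one-dimensional faces `G` and zero-dimensional
faces `P` of `M` the arrows `(G, v) ⟶ (P, v_i)`, where `v` is the only vertex over `G`. -/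
def lambdaArrows (M : Set (Fin d → UnitAddCircle)) (B : Chamber A.central) :
    Set (Arr A.SalCat) :=
  {a | ∃ F : A.TFace, F.carrier ⊆ M ∧ ∃ i, Seen g F i ∧ (a = leftArr g B F i ∨ a = rightArr g B F i)}
  ∪ {a | ∃ (P G : A.TFace) (m : P ⟶ G), P.carrier ⊆ M ∧ G.carrier ⊆ M ∧ P.dim = 0 ∧ G.dim = 1 ∧
      ∃ (i : Fin (n + 1)) (h : TFace.salMap m (v g G 0) ≤ v g P i),
        a = arrOver m (v g G 0) (v g P i) h}

/-- `z` is the `1`-cycle `[Λ_B^M]`: it is a cycle supported on the closed path `Λ_B^M`, and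
the coefficient of the first arrow `v_0 ⟶ e_0` over the base vertex `P₀` is `1`. -/
def IsLambdaCycle (M : Set (Fin d → UnitAddCircle)) (P₀ : A.TFace) (B : Chamber A.central)
    (z : Arr A.SalCat →₀ ℤ) : Prop :=
  z ∈ Cycles A.SalCat ∧ (z.support : Set (Arr A.SalCat)) ⊆ lambdaArrows g M B ∧
    ∃ i : Fin n, v g P₀ i.castSucc = v g P₀ 0 ∧ Seen g P₀ i ∧ z (leftArr g B P₀ i) = 1

open Classical in
/-- The `1`-cycle `[Ξ(H; B, F)]` for a hypertorus `H` through `F`: it runs through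
`v_i, [W_i(F), B(F)_{W_i(F)}], v_{i+1}, [W_i(F), (-B(F))_{W_i(F)}]`, where `i` is the step of the
gallery with `|W_i(F)| = H₀` (for a face `F` of the layer in question and `H` not containing this
layer there is exactly one such step), and the coefficient of
`v_i ⟶ [W_i(F), B(F)_{W_i(F)}]` is `1`. -/
noncomputable def xiChain (H : ι) (B : Chamber A.central) (F : A.TFace) : Arr A.SalCat →₀ ℤ :=
  ∑ i : Fin n, if (F.res (g.wall i)).hull = A.hyp H then
    squareChain F (F.res (g.wall i)) (F.resC (g.chamber i.castSucc)) (F.resC (g.chamber i.succ))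
      (F.resC B) (F.resC (negChamber B)) (wall_le_left g F i) (wall_le_right g F i) else 0

/-- The index set `S_F(B, B') \ 𝒜_M`: the hypertori `H` through `F` that do not contain `M` and
whose hyperplane `H₀` separates `B` from `B'`. -/
def sepSet (M : Set (Fin d → UnitAddCircle)) (F : A.TFace) (B B' : Chamber A.central) : Set ι :=
  {H | H ∈ F.through ∧ Separates H B B' ∧ ¬ M ⊆ A.tor H}

/-! ### The classes `ω` -/

/-- The `1`-cycle `[Ω^(m)]` for `m : F ⟶ G` and a chamber `C` of `𝒜₀`: with
`C₁ = C(F)_{F_m}` and `C₂ = (-C(F))_{F_m}` it runs through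
`[C₁, C₁], [F_m, C₁], [C₂, C₂], [F_m, C₂]`, and the coefficient of `[C₁, C₁] ⟶ [F_m, C₁]` is `1`. -/
noncomputable def omegaChain (C : Chamber A.central) {F G : A.TFace} (m : F ⟶ G) :
    Arr A.SalCat →₀ ℤ :=
  squareChain F (TFace.dir m) ((TFace.dir m).compChamber (F.resC C))
    ((TFace.dir m).compChamber (F.resC (negChamber C))) (F.resC C) (F.resC (negChamber C))
    (Face.le_comp _ _) (Face.le_comp _ _)

/-- `c` is the class `ω_H`, i.e. the homology class of `[Ω^(m)]` for some `m : F ⟶ G` such that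
the support of `G` is the hypertorus `H`. -/
def IsOmegaClass (C : Chamber A.central) (H : ι) (c : H₁ A.SalCat) : Prop :=
  ∃ (F G : A.TFace) (m : F ⟶ G), G.IsSupport (A.tor H) ∧
    c = homologyClass (omegaChain C m) (squareChain_mem _ _ _ _ _ _ _ _)

open Classical in
/-- The sign `ε(H, B)` with respect to the chosen chambers `HC H` of `𝒜₀`. -/
noncomputable def eps (HC : ι → Chamber A.central) (H : ι) (B : Chamber A.central) : ℤ :=
  if Separates H (HC H) B then -1 else 1

end Cycles

end ToricArrangement

/-! ### Local structure of faces -/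

namespace RealArr

section Affine

variable {d : ℕ} {κ : Type} {f : κ → (Fin d → ℝ) →ᵃ[ℝ] ℝ}

open Topology Filter

/-! The faces contained in the one-dimensional layer `M` form a circle on which vertices and edges
alternate. Let `u` span the flat of `M` and lie in a face of the first chamber of the gallery. On
the hyperplanes transversal to `u` the first chamber has the signs of `u` and the last chamber those
of `-u`; on the others the two agree (`exists_isGalleryAlong`). Hence no step is seen over an edge,
while over a vertex `P` the path is a zigzag `v_0 → e_0 ← v_1 → … ← v_k`. The edge following `P` in
direction `u` is attached at `v_0`, the preceding one at the last vertex. Thus `Λ` is a closed path.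

Existence of the cycle is an explicit alternating sum of arrows: the boundaries left at the edges
cancel because each edge follows exactly one vertex and precedes exactly one (`IsLine.sum_next`).
For uniqueness, a cycle is paired with `0`-cochains whose coboundary is nonzero on just two arrows
of the path (`coeff_relation`). This ties all coefficients to each other, so one of them determines
the cycle (`eq_zero_of_coeff`).

The chain formula is local. Replacing `B` by `B'` keeps all vertices and changes `e_i` only if the
hyperplane crossed at step `i` separates `B` from `B'`; then `e_i(B')` is the opposite element and
the two half-turns differ by the square `Ξ` (`finsum_step`). This needs two facts: a minimal gallery
crosses every separating hyperplane exactly once (`Gallery.IsMinimal.exists_bijective`), and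
distinct hypertori through one face have distinct hyperplanes (`eq_of_ker_eq`).

For homology it remains to see that all loops around one hypertorus `H` are homologous. Over a fixed
face and for a fixed chamber `B`, the elements `[K, B_K]` form a cone with apex `[0, B]`. For two
chambers adjacent across `H` the difference of the two cones is constant on each side of `H`, and a
loop around `H` is the difference of these two constants (`IsLoopAround.mk_eq`). An arrow `F ⟶ G`
carries loops over `G` to homologous loops over `F` (`IsLoopAround.mk_incl`), and a lift of `H` to
the universal cover is connected, so loops over different faces agree as well (`loopsAgree`). The
square `Ξ` is then `ω_H` or `-ω_H`, according to whether `B` and the first chamber are on the same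
side of `H`. -/

theorem Face.ofPoint_eq {F : Face f} {x : Fin d → ℝ} (hx : x ∈ F.cell) : Face.ofPoint f x = F :=
  Face.ext hx

theorem Face.mem_cell_ofPoint (f : κ → (Fin d → ℝ) →ᵃ[ℝ] ℝ) (x : Fin d → ℝ) :
    x ∈ (Face.ofPoint f x).cell := rfl

theorem Face.ofPoint_sign (f : κ → (Fin d → ℝ) →ᵃ[ℝ] ℝ) (x : Fin d → ℝ) (k : κ) :
    (Face.ofPoint f x).sign k = SignType.sign (f k x) := rfl

/-- Points near `x` lie in faces whose closure contains `x`. -/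
theorem eventually_ofPoint_le [Finite κ] (f : κ → (Fin d → ℝ) →ᵃ[ℝ] ℝ) (x : Fin d → ℝ) :
    ∀ᶠ y in 𝓝 x, Face.ofPoint f x ≤ Face.ofPoint f y := by
  have key : ∀ k, ∀ᶠ y in 𝓝 x, SignType.sign (f k x) = 0 ∨
      SignType.sign (f k x) = SignType.sign (f k y) := by
    intro k
    have hc : ContinuousAt (f k) x := (f k).continuous_of_finiteDimensional.continuousAt
    rcases lt_trichotomy (f k x) 0 with h0 | h0 | h0
    · filter_upwards [hc.eventually (Iio_mem_nhds h0)] with y hy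
      right; rw [sign_neg h0, sign_neg hy]
    · exact Eventually.of_forall fun y => Or.inl (by rw [h0, sign_zero])
    · filter_upwards [hc.eventually (Ioi_mem_nhds h0)] with y hy
      right; rw [sign_pos h0, sign_pos hy]
  filter_upwards [eventually_all.2 key] with y hy
  exact Face.le_iff.2 hy

theorem eventually_smul_of_eventually {p : (Fin d → ℝ) → Prop} {x : Fin d → ℝ}
    (h : ∀ᶠ y in 𝓝 x, p y) (w : Fin d → ℝ) : ∀ᶠ t in 𝓝 (0 : ℝ), p (x + t • w) := by
  have hc : ContinuousAt (fun t : ℝ => x + t • w) 0 := by fun_prop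
  have : Tendsto (fun t : ℝ => x + t • w) (𝓝 0) (𝓝 x) := by simpa [ContinuousAt] using hc
  exact this.eventually h

theorem exists_pos_of_eventually {p : (Fin d → ℝ) → Prop} {x : Fin d → ℝ}
    (h : ∀ᶠ y in 𝓝 x, p y) (w : Fin d → ℝ) : ∃ t : ℝ, 0 < t ∧ p (x + t • w) := by
  have h1 := eventually_smul_of_eventually h w
  have h2 : ∀ᶠ t in 𝓝[>] (0 : ℝ), 0 < t ∧ p (x + t • w) :=
    (eventually_mem_nhdsWithin).and (nhdsWithin_le_nhds h1)
  exact h2.exists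

/-- The direction space of a face is the intersection of the directions of the hyperplanes
that contain it. -/
theorem Face.vectorSpan_cell {F : Face f} {p : Fin d → ℝ} (hp : p ∈ F.cell)
    (hnear : ∀ᶠ y in 𝓝 p, F ≤ Face.ofPoint f y) :
    vectorSpan ℝ F.cell = ⨅ k ∈ {k | F.sign k = 0}, LinearMap.ker (f k).linear := by
  apply le_antisymm
  · rw [vectorSpan_def, Submodule.span_le]
    rintro _ ⟨x, hx, y, hy, rfl⟩
    simp only [Set.mem_ofPred_eq, SetLike.mem_coe, Submodule.mem_iInf, LinearMap.mem_ker]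
    intro k hk
    have h1 := sign_of_mem hx k
    have h2 := sign_of_mem hy k
    rw [hk, sign_eq_zero_iff] at h1 h2
    rw [AffineMap.linearMap_vsub, h1, h2, vsub_self]
  · intro w hw
    simp only [Set.mem_ofPred_eq, Submodule.mem_iInf, LinearMap.mem_ker] at hw
    obtain ⟨t, ht, hle⟩ := exists_pos_of_eventually hnear w
    -- Being near `p` preserves the nonzero signs; `w` is tangent to the hyperplanes through `F`,
    -- which preserves the zero ones.
    have hmem : p + t • w ∈ F.cell := by
      funext k
      rcases le_iff.1 hle k with h | h
      · have h1 := sign_of_mem hp k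
        rw [h, sign_eq_zero_iff] at h1
        change SignType.sign (f k (p + t • w)) = _
        rw [add_comm, ← vadd_eq_add, AffineMap.map_vadd, map_smul, hw k h, h1, h]
        simp
      · exact h.symm
    have h2 : t • w ∈ vectorSpan ℝ F.cell := by
      have := vsub_mem_vectorSpan ℝ hmem hp
      simpa using this
    exact (Submodule.smul_mem_iff _ ht.ne').1 h2

theorem Face.comp_sign_of_eq_zero [Finite κ] {F : Face f} {k : κ} (h : F.sign k = 0) (G : Face f) :
    (F.comp G).sign k = G.sign k := if_pos h

theorem Face.comp_sign_of_ne_zero [Finite κ] {F : Face f} {k : κ} (h : F.sign k ≠ 0) (G : Face f) :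
    (F.comp G).sign k = F.sign k := if_neg h

/-- A point strictly between a point of `F` and a point of `G ≥ F` lies in `G`. -/
theorem Face.lineMap_mem_cell {F G : Face f} (h : F ≤ G) {x y : Fin d → ℝ} (hx : x ∈ F.cell)
    (hy : y ∈ G.cell) {t : ℝ} (h0 : 0 < t) (h1 : t ≤ 1) : AffineMap.lineMap x y t ∈ G.cell := by
  funext k
  change SignType.sign (f k _) = _
  rw [lineMap_apply_form]
  have hsx := sign_of_mem hx k
  have hsy := sign_of_mem hy k
  have h1' : 0 ≤ 1 - t := by linarith
  rcases le_iff.1 h k with h' | h'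
  · rw [h', sign_eq_zero_iff] at hsx
    rw [hsx, mul_zero, zero_add, sign_mul, sign_pos h0, one_mul, hsy]
  · rw [← h'] at hsy
    rw [← h']
    rcases lt_trichotomy (f k x) 0 with h2 | h2 | h2
    · rw [← hsx, sign_neg h2, sign_eq_neg_one_iff] at hsy
      rw [← hsx, sign_neg h2]
      exact sign_neg (by nlinarith [mul_neg_of_pos_of_neg h0 hsy, mul_nonpos_of_nonneg_of_nonpos h1' h2.le] : _ < (0 : ℝ))
    · rw [← hsx, h2, sign_zero, sign_eq_zero_iff] at hsy
      rw [← hsx, h2, hsy]; simp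
    · rw [← hsx, sign_pos h2, sign_eq_one_iff] at hsy
      rw [← hsx, sign_pos h2]
      exact sign_pos (by nlinarith [mul_pos h0 hsy, mul_nonneg h1' h2.le] : (0 : ℝ) < _)

end Affine

/-! ### Walls and galleries of central arrangements -/

section Linear

variable {d : ℕ} {κ : Type} [Finite κ] {φ : κ → (Fin d → ℝ) →ₗ[ℝ] ℝ}

theorem Face.vectorSpan_cell_linForms (F : Face (linForms φ)) :
    vectorSpan ℝ F.cell = ⨅ k ∈ {k | F.sign k = 0}, LinearMap.ker (φ k) :=
  Face.vectorSpan_cell F.pt_mem (by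
    have h := eventually_ofPoint_le (linForms φ) F.pt
    rwa [Face.ofPoint_eq F.pt_mem] at h)

/-- Differences of points of the cell lie in its linear span, so for a central arrangement the span
is squeezed between the direction space and the intersection of the hyperplanes. -/
theorem Face.hull_linForms (F : Face (linForms φ)) :
    F.hull = ⨅ k ∈ {k | F.sign k = 0}, LinearMap.ker (φ k) := by
  apply le_antisymm
  · rw [Face.hull, Submodule.span_le]
    intro x hx
    simp only [Set.mem_ofPred_eq, SetLike.mem_coe, Submodule.mem_iInf, LinearMap.mem_ker]
    intro k hk
    have h1 := Face.sign_of_mem hx k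
    rwa [hk, sign_eq_zero_iff] at h1
  · rw [← Face.vectorSpan_cell_linForms, vectorSpan_def, Submodule.span_le]
    rintro _ ⟨x, hx, y, hy, rfl⟩
    exact sub_mem (Submodule.subset_span hx) (Submodule.subset_span hy)

theorem ne_zero_of_isChamber (C : Chamber (linForms φ)) (k : κ) : φ k ≠ 0 := by
  intro h
  have h1 := Face.sign_of_mem C.1.pt_mem k
  apply C.2 k
  rw [← h1]
  change SignType.sign (φ k _) = 0
  simp [h]

theorem Chamber.dim_eq (C : Chamber (linForms φ)) : C.1.dim = d := by
  have h : (⨅ k ∈ {k | C.1.sign k = 0}, LinearMap.ker (φ k)) = ⊤ :=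
    iInf₂_eq_top.2 fun k hk => absurd hk (C.2 k)
  rw [Face.dim, Face.vectorSpan_cell_linForms, h, finrank_top]
  simp

theorem finrank_ker_add_one {φ : (Fin d → ℝ) →ₗ[ℝ] ℝ} (h : φ ≠ 0) :
    Module.finrank ℝ (LinearMap.ker φ) + 1 = d := by
  have := Module.Dual.finrank_ker_add_one_of_ne_zero (f := φ) h
  simpa using this

/-- The hyperplanes containing a wall of a chamber coincide with the hull of the wall. -/
theorem Face.IsWall.hull_eq_ker {W : Face (linForms φ)} {C : Chamber (linForms φ)}
    (h : W.IsWall C.1) {k : κ} (hk : W.sign k = 0) : W.hull = LinearMap.ker (φ k) := by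
  have hd := h.2
  rw [C.dim_eq, Face.dim, Face.vectorSpan_cell_linForms, ← Face.hull_linForms] at hd
  apply Submodule.eq_of_le_of_finrank_eq
  · rw [Face.hull_linForms]; exact iInf₂_le k hk
  · have := finrank_ker_add_one (ne_zero_of_isChamber C k)
    omega

theorem Face.isWall_of_hull {W : Face (linForms φ)} {C : Chamber (linForms φ)}
    (hle : W ≤ C.1) {k : κ} (h : W.hull = LinearMap.ker (φ k)) : W.IsWall C.1 := by
  refine ⟨hle, ?_⟩
  rw [C.dim_eq, Face.dim, Face.vectorSpan_cell_linForms, ← Face.hull_linForms, h]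
  exact finrank_ker_add_one (ne_zero_of_isChamber C k)

theorem Face.hull_eq_ker_of_iff {W : Face (linForms φ)} {k : κ}
    (h0 : W.sign k = 0) (h : ∀ k', W.sign k' = 0 → LinearMap.ker (φ k') = LinearMap.ker (φ k)) :
    W.hull = LinearMap.ker (φ k) := by
  rw [Face.hull_linForms]
  exact le_antisymm (iInf₂_le k h0) (le_iInf₂ fun k' hk' => (h k' hk').ge)

theorem exists_smul_of_ker_eq {V : Type*} [AddCommGroup V] [Module ℝ V] {φ ψ : V →ₗ[ℝ] ℝ}
    (hφ : φ ≠ 0) (h : LinearMap.ker φ = LinearMap.ker ψ) : ∃ c : ℝ, ψ = c • φ := by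
  obtain ⟨x₀, hx₀⟩ : ∃ x, φ x ≠ 0 := by
    by_contra! h'; exact hφ (LinearMap.ext h')
  refine ⟨ψ x₀ / φ x₀, LinearMap.ext fun x => ?_⟩
  have h1 : x - (φ x / φ x₀) • x₀ ∈ LinearMap.ker ψ := by
    rw [← h, LinearMap.mem_ker]; simp [hx₀]
  rw [LinearMap.mem_ker, map_sub, map_smul, sub_eq_zero] at h1
  rw [h1, LinearMap.smul_apply, smul_eq_mul, smul_eq_mul]; field_simp

theorem linForms_sign (F : Face (linForms φ)) (k : κ) :
    F.sign k = SignType.sign (φ k F.pt) := (Face.sign_of_mem F.pt_mem k).symm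

/-- Parallel hypertori make the same hyperplane occur under several indices. Their forms are
proportional, so the signs differ by one factor common to all faces. -/
theorem exists_sign_mul_of_ker_eq {k k' : κ} (hφ : φ k ≠ 0)
    (h : LinearMap.ker (φ k) = LinearMap.ker (φ k')) :
    ∃ s : SignType, ∀ F : Face (linForms φ), F.sign k' = s * F.sign k := by
  obtain ⟨c, hc⟩ := exists_smul_of_ker_eq hφ h
  refine ⟨SignType.sign c, fun F => ?_⟩
  rw [linForms_sign, linForms_sign, hc, ← sign_mul]; rfl

theorem separates_of_ker_eq {k k' : κ} {C D : Chamber (linForms φ)}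
    (h : LinearMap.ker (φ k) = LinearMap.ker (φ k')) (hs : Separates k C D) :
    Separates k' C D := by
  obtain ⟨s, hs'⟩ := exists_sign_mul_of_ker_eq (ne_zero_of_isChamber C k') h.symm
  intro h'
  exact hs (by rw [hs', hs', h'])

theorem sign_eq_zero_of_ker_eq {k k' : κ} {F : Face (linForms φ)} (hφ : φ k ≠ 0)
    (h : LinearMap.ker (φ k) = LinearMap.ker (φ k')) (h0 : F.sign k = 0) : F.sign k' = 0 := by
  obtain ⟨s, hs'⟩ := exists_sign_mul_of_ker_eq hφ h
  rw [hs', h0, mul_zero]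

/-- The set of hyperplanes that separate two chambers. -/
def sepHyps (C D : Chamber (linForms φ)) : Set (Submodule ℝ (Fin d → ℝ)) :=
  {X | ∃ k, Separates k C D ∧ LinearMap.ker (φ k) = X}

instance (C D : Chamber (linForms φ)) : Finite (sepHyps C D) :=
  ((Set.toFinite {k | Separates k C D}).image fun k => LinearMap.ker (φ k)).to_subtype

theorem dense_ne_zero {ψ : (Fin d → ℝ) →ₗ[ℝ] ℝ} (h : ψ ≠ 0) : Dense {x | ψ x ≠ 0} := by
  have h1 : {x | ψ x ≠ 0} = ((LinearMap.ker ψ : Submodule ℝ (Fin d → ℝ)) : Set (Fin d → ℝ))ᶜ := by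
    ext x; simp
  rw [h1, ← interior_eq_empty_iff_dense_compl]
  by_contra hne
  have := Submodule.eq_top_of_nonempty_interior' _ (Set.nonempty_iff_ne_empty.2 hne)
  exact h (LinearMap.ker_eq_top.1 this)

theorem Chamber.isOpen_cell (C : Chamber (linForms φ)) : IsOpen C.1.cell := by
  rw [isOpen_iff_mem_nhds]
  intro x hx
  filter_upwards [eventually_ofPoint_le (linForms φ) x] with y hy
  rw [Face.ofPoint_eq hx] at hy
  funext k
  exact ((Face.le_iff.1 hy k).resolve_left (C.2 k)).symm

/-- For such `x` the segment to the chosen point of `D` meets different hyperplanes at different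
parameters. The exceptional points lie in finitely many proper subspaces, which cannot cover an open
chamber. -/
theorem exists_generic_mem (C D : Chamber (linForms φ)) : ∃ x ∈ C.1.cell, ∀ k k',
    LinearMap.ker (φ k) ≠ LinearMap.ker (φ k') → φ k x * φ k' D.1.pt ≠ φ k' x * φ k D.1.pt := by
  have hD : ∀ k, φ k D.1.pt ≠ 0 := fun k h => D.2 k (by rw [linForms_sign, h, sign_zero])
  let I := {p : κ × κ // LinearMap.ker (φ p.1) ≠ LinearMap.ker (φ p.2)}
  let ψ : I → (Fin d → ℝ) →ₗ[ℝ] ℝ := fun p =>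
    (φ p.1.2 D.1.pt) • φ p.1.1 - (φ p.1.1 D.1.pt) • φ p.1.2
  have hψ : ∀ p, ψ p ≠ 0 := by
    intro p hp
    apply p.2
    have h1 : ∀ x, φ p.1.2 D.1.pt * φ p.1.1 x = φ p.1.1 D.1.pt * φ p.1.2 x := fun x =>
      sub_eq_zero.1 (LinearMap.congr_fun hp x)
    ext x
    rw [LinearMap.mem_ker, LinearMap.mem_ker]
    constructor <;> intro hx <;> have := h1 x <;> rw [hx] at this <;> simpa [hD] using this
  have hdense : Dense (⋂ p, {x | ψ p x ≠ 0}) :=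
    dense_iInter_of_isOpen
      (fun p => isOpen_ne_fun ((ψ p).continuous_of_finiteDimensional) continuous_const)
      (fun p => dense_ne_zero (hψ p))
  obtain ⟨x, hx, hx'⟩ := hdense.inter_open_nonempty _ C.isOpen_cell ⟨_, C.1.pt_mem⟩
  refine ⟨x, hx, fun k k' hk h => ?_⟩
  refine Set.mem_iInter.1 hx' ⟨(k, k'), hk⟩ ?_
  change φ k' D.1.pt * φ k x - φ k D.1.pt * φ k' x = 0
  linarith

/-- A chamber `C ≠ D` has a wall whose hyperplane separates it from `D`. -/
theorem exists_wall_between (C D : Chamber (linForms φ)) (hCD : C ≠ D) :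
    ∃ (W : Face (linForms φ)) (k : κ), W ≤ C.1 ∧ Separates k C D ∧
      ∀ k', W.sign k' = 0 ↔ LinearMap.ker (φ k') = LinearMap.ker (φ k) := by
  obtain ⟨x, hx, hgen⟩ := exists_generic_mem C D
  let y := D.1.pt
  have hxs : ∀ k, SignType.sign (φ k x) = C.1.sign k := fun k => Face.sign_of_mem hx k
  have hys : ∀ k, SignType.sign (φ k y) = D.1.sign k := fun k => Face.sign_of_mem D.1.pt_mem k
  have hne : {k | Separates k C D}.Nonempty := by
    by_contra h
    rw [Set.not_nonempty_iff_eq_empty] at h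
    apply hCD
    apply Subtype.ext; ext1; funext k
    by_contra hk
    exact (Set.ext_iff.1 h k).1 hk
  -- For a separating hyperplane, `τ k` is the parameter at which the segment from `x` to `y` meets
  -- it; the first one met carries the wall.
  let τ : κ → ℝ := fun k => φ k x / (φ k x - φ k y)
  obtain ⟨k, hk, hmin⟩ := Set.exists_min_image _ τ (Set.toFinite {k | Separates k C D}) hne
  have hsep : ∀ k', Separates k' C D → (0 < φ k' x ∧ φ k' y < 0) ∨ (φ k' x < 0 ∧ 0 < φ k' y) := by
    intro k' h
    rw [Separates, ← hxs, ← hys] at h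
    have h1 := C.2 k'; have h2 := D.2 k'
    rw [← hxs, Ne, sign_eq_zero_iff] at h1
    rw [← hys, Ne, sign_eq_zero_iff] at h2
    rcases lt_or_gt_of_ne h1 with a | a <;> rcases lt_or_gt_of_ne h2 with b | b
    · exact absurd (by rw [sign_neg a, sign_neg b]) h
    · exact Or.inr ⟨a, b⟩
    · exact Or.inl ⟨a, b⟩
    · exact absurd (by rw [sign_pos a, sign_pos b]) h
  have hτ : 0 < τ k ∧ τ k < 1 := by
    rcases hsep k hk with ⟨a, b⟩ | ⟨a, b⟩
    · exact ⟨div_pos a (by linarith), (div_lt_one (by linarith)).2 (by linarith)⟩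
    · exact ⟨div_pos_of_neg_of_neg a (by linarith), (div_lt_one_of_neg (by linarith)).2 (by linarith)⟩
  let w : Fin d → ℝ := AffineMap.lineMap x y (τ k)
  have hw : ∀ k', φ k' w = (1 - τ k) * φ k' x + τ k * φ k' y := fun k' =>
    Face.lineMap_apply_form (linForms φ) x y (τ k) k'
  have hk0 : φ k w = 0 := by
    rw [hw]
    have : φ k x - φ k y ≠ 0 := by rcases hsep k hk with ⟨a, b⟩ | ⟨a, b⟩ <;> intro h <;> linarith
    simp only [τ]; field_simp; ring
  have hker : ∀ k', φ k' w = 0 → LinearMap.ker (φ k') = LinearMap.ker (φ k) := by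
    intro k' h0
    by_contra hne'
    have hg := hgen k' k hne'
    rw [hw] at h0
    have h1 := hk0
    rw [hw] at h1
    apply hg
    have e1 : τ k * φ k y = -((1 - τ k) * φ k x) := by linarith
    have e2 : τ k * φ k' y = -((1 - τ k) * φ k' x) := by linarith
    have : τ k * (φ k' x * φ k y) = τ k * (φ k x * φ k' y) := by
      calc _ = φ k' x * (τ k * φ k y) := by ring
        _ = φ k x * (τ k * φ k' y) := by rw [e1, e2]; ring
        _ = _ := by ring
    exact mul_left_cancel₀ hτ.1.ne' this
  refine ⟨Face.ofPoint _ w, k, Face.le_iff.2 fun k' => ?_, hk, fun k' => ⟨fun h => ?_, fun h => ?_⟩⟩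
  -- By minimality of `τ k`, no separating hyperplane has been passed before `w`, so each sign at
  -- `w` is zero or still the sign on `C`.
  · rw [Face.ofPoint_sign, ← hxs]
    change SignType.sign (φ k' w) = 0 ∨ SignType.sign (φ k' w) = _
    have hp := hτ.1; have hp' : 0 < 1 - τ k := by linarith [hτ.2]
    by_cases hs : Separates k' C D
    · have hm := hmin k' hs
      rcases hsep k' hs with ⟨a, b⟩ | ⟨a, b⟩
      · have hlt : 0 < φ k' x - φ k' y := by linarith
        have h2 := (le_div_iff₀ hlt).1 hm
        have h3 : 0 ≤ φ k' w := by rw [hw]; linarith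
        rcases h3.eq_or_lt with h | h
        · left; rw [← h, sign_zero]
        · right; rw [sign_pos h, sign_pos a]
      · have hlt : φ k' x - φ k' y < 0 := by linarith
        have h2 := (le_div_iff_of_neg hlt).1 hm
        have h3 : φ k' w ≤ 0 := by rw [hw]; linarith
        rcases h3.eq_or_lt with h | h
        · left; rw [h, sign_zero]
        · right; rw [sign_neg h, sign_neg a]
    · right
      have hs' : SignType.sign (φ k' x) = SignType.sign (φ k' y) := by
        rw [hxs, hys]; exact not_not.1 hs
      have hx0 : φ k' x ≠ 0 := fun h => C.2 k' (by rw [← hxs, h, sign_zero])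
      rcases lt_or_gt_of_ne hx0 with a | a
      · have b : φ k' y < 0 := by rwa [sign_neg a, eq_comm, sign_eq_neg_one_iff] at hs'
        rw [sign_neg a, hw]
        exact sign_neg (by nlinarith [mul_neg_of_pos_of_neg hp b, mul_neg_of_pos_of_neg hp' a])
      · have b : 0 < φ k' y := by rwa [sign_pos a, eq_comm, sign_eq_one_iff] at hs'
        rw [sign_pos a, hw]
        exact sign_pos (by nlinarith [mul_pos hp b, mul_pos hp' a])
  · exact hker k' (sign_eq_zero_iff.1 h)
  · refine sign_eq_zero_of_ker_eq (ne_zero_of_isChamber C k) h.symm ?_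
    exact sign_eq_zero_iff.2 hk0

/-- Two chambers are joined by a gallery whose length is the number of separating hyperplanes. -/
theorem exists_gallery (D : Chamber (linForms φ)) : ∀ (m : ℕ) (C : Chamber (linForms φ)),
    (sepHyps C D).ncard = m → ∃ g : Gallery (linForms φ) m,
      g.chamber 0 = C ∧ g.chamber (Fin.last m) = D := by
  intro m
  induction m with
  | zero =>
    intro C hC
    have hCD : C = D := by
      by_contra hne
      obtain ⟨W, k, -, hk, -⟩ := exists_wall_between C D hne
      rw [Set.ncard_eq_zero (Set.toFinite _)] at hC
      exact (Set.ext_iff.1 hC _).1 ⟨k, hk, rfl⟩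
    exact ⟨⟨fun _ => C, Fin.elim0, fun i => i.elim0, fun i => i.elim0⟩, rfl, hCD⟩
  | succ m ih =>
    intro C hC
    have hCD : C ≠ D := by
      rintro rfl
      have : sepHyps C C = ∅ := by
        exact Set.eq_empty_of_forall_notMem fun _ ⟨k, hk, _⟩ => hk rfl
      rw [this] at hC; simp at hC
    obtain ⟨W, k, hWC, hk, hW⟩ := exists_wall_between C D hCD
    -- The chamber on the other side of the wall: it has the signs of `D` on the hyperplane of `W`
    -- and those of `C` elsewhere, so one separating hyperplane is lost.
    let C' := W.compChamber D
    have hsign : ∀ k', W.sign k' ≠ 0 → C'.1.sign k' = C.1.sign k' := fun k' h => by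
      rw [← (Face.le_iff.1 hWC k').resolve_left h]
      exact Face.comp_sign_of_ne_zero h _
    have hsign0 : ∀ k', W.sign k' = 0 → C'.1.sign k' = D.1.sign k' := fun k' h =>
      Face.comp_sign_of_eq_zero h _
    have hsep : sepHyps C' D = sepHyps C D \ {LinearMap.ker (φ k)} := by
      ext X
      constructor
      · rintro ⟨k', hk', rfl⟩
        have hne : W.sign k' ≠ 0 := fun h => hk' (hsign0 k' h)
        refine ⟨⟨k', ?_, rfl⟩, fun h => hne ((hW k').2 h)⟩
        change C.1.sign k' ≠ _
        rw [← hsign k' hne]; exact hk'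
      · rintro ⟨⟨k', hk', rfl⟩, hne⟩
        have hne : W.sign k' ≠ 0 := fun h => hne ((hW k').1 h)
        refine ⟨k', ?_, rfl⟩
        change C'.1.sign k' ≠ _
        rw [hsign k' hne]; exact hk'
    obtain ⟨g, hg0, hg1⟩ := ih C' (by
      have hmem : LinearMap.ker (φ k) ∈ sepHyps C D := ⟨k, hk, rfl⟩
      rw [hsep, Set.ncard_sdiff_singleton_of_mem hmem, hC]; rfl)
    have hhull : W.hull = LinearMap.ker (φ k) :=
      Face.hull_eq_ker_of_iff ((hW k).2 rfl) fun k' h => (hW k').1 h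
    refine ⟨⟨Fin.cons C g.chamber, Fin.cons W g.wall, ?_, ?_⟩, rfl, ?_⟩
    · intro i
      refine Fin.cases ?_ (fun j => ?_) i
      · exact Face.isWall_of_hull hWC hhull
      · simpa using g.wall_left j
    · intro i
      refine Fin.cases ?_ (fun j => ?_) i
      · change W.IsWall (g.chamber 0).1
        rw [hg0]
        exact Face.isWall_of_hull (W.le_comp D.1) hhull
      · simpa using g.wall_right j
    · exact hg1

/-! ### Crossings of a minimal gallery -/

namespace Gallery

variable {n : ℕ} (g : Gallery (linForms φ) n)

/-- The `i`-th step of the gallery crosses the `k`-th hyperplane. -/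
def Crosses (i : Fin n) (k : κ) : Prop := Separates k (g.chamber i.castSucc) (g.chamber i.succ)

variable {g}

theorem Crosses.sign_wall {i : Fin n} {k : κ} (h : g.Crosses i k) : (g.wall i).sign k = 0 := by
  by_contra h0
  apply h
  rw [← (Face.le_iff.1 (g.wall_left i).1 k).resolve_left h0,
    ← (Face.le_iff.1 (g.wall_right i).1 k).resolve_left h0]

theorem Crosses.hull_eq {i : Fin n} {k : κ} (h : g.Crosses i k) :
    (g.wall i).hull = LinearMap.ker (φ k) := (g.wall_left i).hull_eq_ker h.sign_wall

/-- Between two indices at which the sides differ there is a crossing. -/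
theorem exists_crosses {k : κ} : ∀ {a b : ℕ} (hab : a ≤ b) (hb : b < n + 1),
    (g.chamber ⟨a, by omega⟩).1.sign k ≠ (g.chamber ⟨b, hb⟩).1.sign k →
      ∃ i : Fin n, a ≤ i ∧ (i : ℕ) < b ∧ g.Crosses i k := by
  intro a b hab
  induction b, hab using Nat.le_induction with
  | base => intro hb h; exact absurd rfl h
  | succ b hab ih =>
    intro hb h
    by_cases h' : (g.chamber ⟨a, by omega⟩).1.sign k = (g.chamber ⟨b, by omega⟩).1.sign k
    · refine ⟨⟨b, by omega⟩, hab, Nat.lt_succ_self b, ?_⟩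
      rw [h'] at h; exact h
    · obtain ⟨i, h1, h2, h3⟩ := ih (by omega) h'
      exact ⟨i, h1, by omega, h3⟩

/-- Every separating hyperplane is crossed at some step, and a step crosses only one hyperplane, the
hull of its wall; this gives the injection. A gallery as long as the number of separating
hyperplanes exists, so minimality makes the injection bijective. -/
theorem IsMinimal.exists_bijective (hg : g.IsMinimal) :
    ∃ F : sepHyps (g.chamber 0) (g.chamber (Fin.last n)) → Fin n, Function.Bijective F ∧
      ∀ X k, LinearMap.ker (φ k) = X.1 → g.Crosses (F X) k := by
  have h1 : ∀ X : sepHyps (g.chamber 0) (g.chamber (Fin.last n)), ∃ i : Fin n,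
      ∀ k, LinearMap.ker (φ k) = X.1 → g.Crosses i k := by
    rintro ⟨_, k, hk, rfl⟩
    obtain ⟨i, -, -, hi⟩ := exists_crosses (g := g) (k := k) (Nat.zero_le n) (Nat.lt_succ_self n) hk
    exact ⟨i, fun k' hk' => separates_of_ker_eq hk'.symm hi⟩
  choose F hF using h1
  have hinj : Function.Injective F := by
    rintro ⟨X, k, hk, hX⟩ ⟨X', k', hk', hX'⟩ h
    have e1 := hF ⟨X, k, hk, hX⟩ k hX
    have e2 := hF ⟨X', k', hk', hX'⟩ k' hX'
    rw [h] at e1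
    apply Subtype.ext
    change X = X'
    rw [← hX, ← hX']
    exact e1.hull_eq.symm.trans e2.hull_eq
  obtain ⟨g', h0, h1⟩ := exists_gallery (g.chamber (Fin.last n)) _ (g.chamber 0) rfl
  have hle := hg _ g' h0 h1
  refine ⟨F, ?_, hF⟩
  have := Fintype.ofFinite (sepHyps (g.chamber 0) (g.chamber (Fin.last n)))
  rw [Fintype.bijective_iff_injective_and_card]
  refine ⟨hinj, le_antisymm (Fintype.card_le_of_injective F hinj) ?_⟩
  rw [← Nat.card_coe_set_eq, Nat.card_eq_fintype_card] at hle
  simpa using hle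

/-- Each step of a minimal gallery crosses the hyperplanes that contain its wall. -/
theorem IsMinimal.crosses_of_sign_wall (hg : g.IsMinimal) {i : Fin n} {k : κ}
    (h : (g.wall i).sign k = 0) : g.Crosses i k := by
  obtain ⟨F, hF, hc⟩ := hg.exists_bijective
  -- By surjectivity no step is idle: step `i` crosses some hyperplane, and this can only be the
  -- hull of its wall.
  obtain ⟨⟨X, k', hk', hX⟩, rfl⟩ := hF.2 i
  have h1 := hc ⟨X, k', hk', hX⟩ k' hX
  exact separates_of_ker_eq (h1.hull_eq.symm.trans ((g.wall_left _).hull_eq_ker h)) h1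

/-- A minimal gallery crosses only hyperplanes that separate its ends. -/
theorem IsMinimal.separates (hg : g.IsMinimal) {i : Fin n} {k : κ} (h : g.Crosses i k) :
    Separates k (g.chamber 0) (g.chamber (Fin.last n)) := by
  obtain ⟨F, hF, hc⟩ := hg.exists_bijective
  obtain ⟨⟨X, k', hk', hX⟩, rfl⟩ := hF.2 i
  exact separates_of_ker_eq ((hc ⟨X, k', hk', hX⟩ k' hX).hull_eq.symm.trans h.hull_eq) hk'

/-- A minimal gallery crosses each hyperplane at most once. -/
theorem IsMinimal.crosses_unique (hg : g.IsMinimal) {i j : Fin n} {k : κ} (hi : g.Crosses i k)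
    (hj : g.Crosses j k) : i = j := by
  obtain ⟨F, hF, hc⟩ := hg.exists_bijective
  obtain ⟨⟨X, k₁, h₁, hX⟩, rfl⟩ := hF.2 i
  obtain ⟨⟨X', k₂, h₂, hX'⟩, rfl⟩ := hF.2 j
  congr 1
  apply Subtype.ext
  change X = X'
  rw [← hX, ← hX', ← (hc ⟨X, k₁, h₁, hX⟩ k₁ hX).hull_eq, ← (hc ⟨X', k₂, h₂, hX'⟩ k₂ hX').hull_eq, hi.hull_eq, hj.hull_eq]

theorem IsMinimal.sign_of_le (hg : g.IsMinimal) {i : Fin n} {k : κ} (hi : g.Crosses i k)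
    {j : Fin (n + 1)} (hj : j ≤ i.castSucc) : (g.chamber j).1.sign k = (g.chamber 0).1.sign k := by
  by_contra h
  obtain ⟨i', -, h2, h3⟩ := exists_crosses (g := g) (k := k) (Nat.zero_le j) j.2 (Ne.symm h)
  rw [hg.crosses_unique h3 hi] at h2
  have := Fin.le_def.1 hj
  simp at this; omega

theorem IsMinimal.sign_of_lt (hg : g.IsMinimal) {i : Fin n} {k : κ} (hi : g.Crosses i k)
    {j : Fin (n + 1)} (hj : i.succ ≤ j) :
    (g.chamber j).1.sign k = (g.chamber (Fin.last n)).1.sign k := by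
  by_contra h
  obtain ⟨i', h1, -, h3⟩ := exists_crosses (g := g) (k := k) (Nat.lt_succ_iff.1 j.2)
    (Nat.lt_succ_self n) h
  rw [hg.crosses_unique h3 hi] at h1
  have := Fin.le_def.1 hj
  simp at this; omega

end Gallery

end Linear

end RealArr

/-! ### Chains modulo boundaries, and cochains -/

namespace NerveChains

variable {C : Type} [Category.{0} C]

variable (C) in
/-- Chains modulo boundaries. -/
abbrev ChainsModBd : Type := (Arr C →₀ ℤ) ⧸ LinearMap.range (bd₂ C)

/-- The class of an arrow modulo boundaries. -/
noncomputable def arrClass (a : Arr C) : ChainsModBd C :=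
  Submodule.Quotient.mk (Finsupp.single a 1)

theorem arrClass_comp {x y z : C} (f : x ⟶ y) (g : y ⟶ z) :
    arrClass (⟨x, z, f ≫ g⟩ : Arr C) = arrClass ⟨x, y, f⟩ + arrClass ⟨y, z, g⟩ := by
  rw [arrClass, arrClass, arrClass, ← Submodule.Quotient.mk_add, Submodule.Quotient.eq]
  refine ⟨-Finsupp.single ⟨x, y, z, f, g⟩ 1, ?_⟩
  rw [map_neg]
  simp only [bd₂, Finsupp.lift_apply, Finsupp.sum_single_index, zero_smul, one_smul]
  abel

variable (C) in
/-- Homology classes as chains modulo boundaries. -/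
noncomputable def homologyToChains : H₁ C →ₗ[ℤ] ChainsModBd C :=
  Submodule.mapQ _ _ (Cycles C).subtype le_rfl

/-- Cycles modulo boundaries embed in chains modulo boundaries. Identities in homology may therefore
be checked there, where a single arrow has a class and composition becomes addition. -/
theorem homologyToChains_injective : Function.Injective (homologyToChains C) := by
  refine (injective_iff_map_eq_zero _).2 fun a => ?_
  refine Submodule.Quotient.induction_on _ a fun z hz => ?_
  refine (Submodule.Quotient.mk_eq_zero _).2 ?_
  exact (Submodule.Quotient.mk_eq_zero (LinearMap.range (bd₂ C)) (x := z.1)).1 hz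

/-- A `0`-cochain pairs to zero with the boundary of a cycle. -/
theorem sum_mul_sub_eq_zero {w : Arr C →₀ ℤ} (hw : w ∈ Cycles C) (φ : C → ℤ) :
    w.sum (fun a c => c * (φ a.2.1 - φ a.1)) = 0 := by
  have h1 : Finsupp.lift ℤ ℤ C φ (bd₁ C w) = 0 := by rw [LinearMap.mem_ker.1 hw, map_zero]
  have h2 : bd₁ C w = ∑ a ∈ w.support,
      w a • (Finsupp.single a.2.1 (1 : ℤ) - Finsupp.single a.1 (1 : ℤ)) := Finsupp.lift_apply ..
  rw [h2, map_sum] at h1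
  rw [Finsupp.sum, ← h1]
  refine Finset.sum_congr rfl fun a _ => ?_
  rw [map_smul, map_sub]
  simp [Finsupp.lift_apply]

/-- If a `0`-cochain changes only along two arrows `a`, `b` of the support of a cycle, this
relates the coefficients of these arrows. -/
theorem coeff_relation {w : Arr C →₀ ℤ} (hw : w ∈ Cycles C) (φ : C → ℤ) {a b : Arr C}
    (hab : a ≠ b) (h : ∀ c, w c ≠ 0 → c ≠ a → c ≠ b → φ c.2.1 = φ c.1) :
    w a * (φ a.2.1 - φ a.1) + w b * (φ b.2.1 - φ b.1) = 0 := by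
  classical
  have h1 := sum_mul_sub_eq_zero hw φ
  -- The support is enlarged by `a` and `b` so that both terms occur even if their coefficients
  -- vanish.
  rw [Finsupp.sum_of_support_subset w (s := insert a (insert b w.support))
    (fun x hx => by simp [Finsupp.mem_support_iff.1 hx]) _ (by simp)] at h1
  rw [← h1, Finset.sum_eq_add a b hab]
  · intro c _ hc
    by_cases h0 : w c = 0
    · simp [h0]
    · rw [h c h0 hc.1 hc.2]; simp
  · simp
  · simp

end NerveChains

/-! ### Arrow classes in the toric Salvetti category -/

namespace ToricArrangement

variable {d : ℕ} {ι : Type} [Finite ι] {A : ToricArrangement d ι}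

/-- The fibres are preorders, so an arrow is determined by its ends and its base arrow. -/
theorem salCat_hom_ext {X Y : A.SalCat} {f g : X ⟶ Y} (h : f.base = g.base) : f = g :=
  Grothendieck.ext _ _ h rfl

theorem arrClass_eq_add {X Y Z : A.SalCat} (f : X ⟶ Y) (g : Y ⟶ Z) (k : X ⟶ Z)
    (h : k.base = f.base ≫ g.base) :
    arrClass (⟨X, Z, k⟩ : Arr A.SalCat) = arrClass ⟨X, Y, f⟩ + arrClass ⟨Y, Z, g⟩ := by
  rw [← arrClass_comp, salCat_hom_ext (f := k) (g := f ≫ g) h]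

theorem arrClass_arrIn_add {F : A.TFace} {x y z : SalPoset F.loc} (h : x ≤ y) (h' : y ≤ z) :
    arrClass (arrIn F x z (h.trans h')) = arrClass (arrIn F x y h) + arrClass (arrIn F y z h') :=
  arrClass_eq_add _ _ _ (Category.id_comp (𝟙 (Opposite.op F))).symm

theorem arrClass_arrOver_add {F G : A.TFace} (m : F ⟶ G) {x : SalPoset G.loc}
    {y z : SalPoset F.loc} (h : TFace.salMap m x ≤ y) (h' : y ≤ z) :
    arrClass (arrOver m x z (h.trans h')) =
      arrClass (arrOver m x y h) + arrClass (arrIn F y z h') :=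
  arrClass_eq_add _ _ _ (Category.comp_id m.op).symm

theorem arrClass_arrIn_add_arrOver {F G : A.TFace} (m : F ⟶ G) {x y : SalPoset G.loc}
    {z : SalPoset F.loc} (h : x ≤ y) (h' : TFace.salMap m y ≤ z) :
    arrClass (arrOver m x z (((TFace.salMap m).monotone h).trans h')) =
      arrClass (arrIn G x y h) + arrClass (arrOver m y z h') :=
  arrClass_eq_add _ _ _ (Category.id_comp m.op).symm

/-- The maps `𝒟(m)` move arrows by chains that depend only on their ends. -/
theorem arrClass_salMap {F G : A.TFace} (m : F ⟶ G) {x y : SalPoset G.loc} (h : x ≤ y) :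
    arrClass (arrIn F (TFace.salMap m x) (TFace.salMap m y) ((TFace.salMap m).monotone h)) =
      arrClass (arrIn G x y h) + arrClass (arrOver m y (TFace.salMap m y) le_rfl) -
        arrClass (arrOver m x (TFace.salMap m x) le_rfl) := by
  -- The arrow from `(G, x)` to `(F, 𝒟(m)(y))` factors both through `(G, y)` and through `(F,
  -- 𝒟(m)(x))`.
  rw [← arrClass_arrIn_add_arrOver m h le_rfl,
    arrClass_arrOver_add m le_rfl ((TFace.salMap m).monotone h)]
  abel

end ToricArrangement

/-! ### Loops around one hyperplane over one face -/

namespace ToricArrangement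

variable {d : ℕ} {ι : Type} [Finite ι] {A : ToricArrangement d ι}

section Local

variable {F G : A.TFace}

open Classical in
/-- The class of the arrow `(F, x) ⟶ (F, y)` modulo boundaries, and `0` if there is none. -/
noncomputable def salClass (F : A.TFace) (x y : SalPoset F.loc) : ChainsModBd A.SalCat :=
  if h : x ≤ y then arrClass (arrIn F x y h) else 0

theorem salClass_of_le {x y : SalPoset F.loc} (h : x ≤ y) :
    salClass F x y = arrClass (arrIn F x y h) := dif_pos h

theorem salClass_trans {x y z : SalPoset F.loc} (h : x ≤ y) (h' : y ≤ z) :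
    salClass F x z = salClass F x y + salClass F y z := by
  rw [salClass_of_le h, salClass_of_le h', salClass_of_le (h.trans h'), arrClass_arrIn_add h h']

/-- The loop given by `squareChain F W C C' D D'` runs around the hyperplane `H`. -/
structure IsLoopAround (F : A.TFace) (H : F.through) (W : Face F.loc) (C C' D D' : Chamber F.loc) :
    Prop where
  zero_iff : ∀ i, W.sign i = 0 ↔ i = H
  le : W ≤ C.1
  le' : W ≤ C'.1
  left : C.1.sign H = D.1.sign H
  right : C'.1.sign H = D'.1.sign H
  ne : C.1.sign H ≠ C'.1.sign H

theorem IsLoopAround.swap {H : F.through} {W : Face F.loc} {C C' D D' : Chamber F.loc}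
    (h : IsLoopAround F H W C C' D D') : IsLoopAround F H W C' C D' D :=
  ⟨h.zero_iff, h.le', h.le, h.right, h.left, h.ne.symm⟩

theorem squareChain_swap (F : A.TFace) (W : Face F.loc) (C C' D D' : Chamber F.loc)
    (h : W ≤ C.1) (h' : W ≤ C'.1) :
    squareChain F W C' C D' D h' h = squareChain F W C C' D D' h h' := by
  simp only [squareChain]; abel

theorem squareChain_neg (F : A.TFace) (W : Face F.loc) (C C' D D' : Chamber F.loc)
    (h : W ≤ C.1) (h' : W ≤ C'.1) :
    squareChain F W C C' D' D h h' = -squareChain F W C C' D D' h h' := by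
  simp only [squareChain]; abel

theorem mk_squareChain (F : A.TFace) (W : Face F.loc) (C C' D D' : Chamber F.loc)
    (h : W ≤ C.1) (h' : W ≤ C'.1) :
    (Submodule.Quotient.mk (squareChain F W C C' D D' h h') : ChainsModBd A.SalCat) =
      salClass F (SalPoset.vertex C) (SalPoset.edge W D)
        - salClass F (SalPoset.vertex C') (SalPoset.edge W D)
        + salClass F (SalPoset.vertex C') (SalPoset.edge W D')
        - salClass F (SalPoset.vertex C) (SalPoset.edge W D') := by
  rw [salClass_of_le (SalPoset.vertex_le_edge h D), salClass_of_le (SalPoset.vertex_le_edge h' D),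
    salClass_of_le (SalPoset.vertex_le_edge h D'), salClass_of_le (SalPoset.vertex_le_edge h' D')]
  simp only [squareChain, arrClass, Submodule.Quotient.mk_sub, Submodule.Quotient.mk_add]

/-- The face of a local arrangement that contains the origin. -/
noncomputable def center (F : A.TFace) : Face F.loc := Face.ofPoint F.loc 0

theorem center_sign (F : A.TFace) (i : F.through) : (center F).sign i = 0 := by
  change SignType.sign (A.lin i 0) = 0
  simp

theorem edge_eq_of_comp_eq {K : Face F.loc} {B B' : Chamber F.loc}
    (h : ∀ i, K.sign i = 0 → B.1.sign i = B'.1.sign i) :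
    SalPoset.edge K B = SalPoset.edge K B' := by
  refine SalPoset.ext rfl (Subtype.ext (Face.ext (funext fun i => ?_)))
  change (K.comp B.1).sign i = (K.comp B'.1).sign i
  by_cases h0 : K.sign i = 0
  · rw [Face.comp_sign_of_eq_zero h0, Face.comp_sign_of_eq_zero h0, h i h0]
  · rw [Face.comp_sign_of_ne_zero h0, Face.comp_sign_of_ne_zero h0]

theorem vertex_eq_edge (C B : Chamber F.loc) :
    SalPoset.vertex C = SalPoset.edge C.1 B :=
  SalPoset.ext rfl (Subtype.ext (Face.comp_of_isChamber C.2 B.1).symm)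

/-- For fixed `B`, the map `K ↦ [K, B_K]` is an order-reversing section over all faces; its greatest
element is `[0, B]`, the apex of the cone in `coneClass`. -/
theorem edge_le_edge {K K' : Face F.loc} (h : K' ≤ K) (B : Chamber F.loc) :
    SalPoset.edge K B ≤ SalPoset.edge K' B := by
  refine ⟨h, Subtype.ext (Face.ext (funext fun i => ?_))⟩
  change (K.comp (K'.comp B.1)).sign i = (K.comp B.1).sign i
  by_cases h0 : K.sign i = 0
  · rw [Face.comp_sign_of_eq_zero h0, Face.comp_sign_of_eq_zero h0, Face.comp_sign_of_eq_zero]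
    rcases Face.le_iff.1 h i with h1 | h1
    · exact h1
    · rw [h1, h0]
  · rw [Face.comp_sign_of_ne_zero h0, Face.comp_sign_of_ne_zero h0]

theorem center_le (K : Face F.loc) : center F ≤ K := Face.le_iff.2 fun i => Or.inl (center_sign F i)

/-- The arrow from `[K, B_K]` to the top element `[0, B]` of the section given by `B`. -/
noncomputable def coneClass (B : Chamber F.loc) (K : Face F.loc) : ChainsModBd A.SalCat :=
  salClass F (SalPoset.edge K B) (SalPoset.edge (center F) B)

theorem salClass_edge {K K' : Face F.loc} (h : K' ≤ K) (B : Chamber F.loc) :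
    salClass F (SalPoset.edge K B) (SalPoset.edge K' B) = coneClass B K - coneClass B K' := by
  rw [coneClass, salClass_trans (edge_le_edge h B) (edge_le_edge (center_le K') B)]
  exact (add_sub_cancel_right _ _).symm

/-- Away from `H` the sections of `B` and `B'` coincide, so the arrow from `K` down to `K'` is the
same in both. Written with either cone, it yields the equality. -/
theorem coneClass_sub_eq_of_le {H : F.through} {B B' : Chamber F.loc}
    (hB : ∀ i, i ≠ H → B.1.sign i = B'.1.sign i) {K K' : Face F.loc} (h : K' ≤ K)
    (h0 : K'.sign H ≠ 0) : coneClass B K - coneClass B' K = coneClass B K' - coneClass B' K' := by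
  have h1 : K.sign H ≠ 0 := by rwa [← (Face.le_iff.1 h H).resolve_left h0]
  have e : ∀ K : Face F.loc, K.sign H ≠ 0 → SalPoset.edge K B = SalPoset.edge K B' := fun K hK =>
    edge_eq_of_comp_eq fun i hi => hB i (by rintro rfl; exact hK hi)
  have e1 := salClass_edge h B
  rw [e K h1, e K' h0, salClass_edge h B'] at e1
  exact sub_eq_sub_iff_sub_eq_sub.1 e1.symm

theorem isPreconnected_side {V : Type*} [AddCommGroup V] [Module ℝ V] [TopologicalSpace V]
    [IsTopologicalAddGroup V] [ContinuousSMul ℝ V] (φ : V →ₗ[ℝ] ℝ) (s : SignType) :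
    IsPreconnected {x | SignType.sign (φ x) = s} := by
  apply Convex.isPreconnected
  rcases s with _ | _ | _
  · have : {x | SignType.sign (φ x) = SignType.zero} = {x | φ x = 0} := by
      ext x; exact sign_eq_zero_iff
    rw [this]; exact convex_hyperplane φ.isLinear 0
  · have : {x | SignType.sign (φ x) = SignType.neg} = {x | φ x < 0} := by
      ext x; exact sign_eq_neg_one_iff
    rw [this]; exact convex_halfSpace_lt φ.isLinear 0
  · have : {x | SignType.sign (φ x) = SignType.pos} = {x | 0 < φ x} := by
      ext x; exact sign_eq_one_iff
    rw [this]; exact convex_halfSpace_gt φ.isLinear 0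

/-- The difference of the cones of two adjacent chambers is constant on the sides of the hyperplane
between them. -/
theorem coneClass_sub_eq {H : F.through} {B B' : Chamber F.loc}
    (hB : ∀ i, i ≠ H → B.1.sign i = B'.1.sign i) {K K' : Face F.loc} (h : K.sign H = K'.sign H)
    (h0 : K.sign H ≠ 0) : coneClass B K - coneClass B' K = coneClass B K' - coneClass B' K' := by
  let f : Face F.loc → ChainsModBd A.SalCat := fun K => coneClass B K - coneClass B' K
  change f K = f K'
  -- Points near `x` lie in faces above that of `x`, so the difference of cones is locally constant
  -- on a side of `H`, which is connected.
  have hconn := isPreconnected_side (A.lin H.1) (K.sign H)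
  have := hconn.induction₂ (fun x y => f (Face.ofPoint F.loc x) = f (Face.ofPoint F.loc y))
    (fun x hx => by
      filter_upwards [nhdsWithin_le_nhds (eventually_ofPoint_le F.loc x)] with y hy
      refine (coneClass_sub_eq_of_le hB hy ?_).symm
      exact fun h => h0 (hx.symm.trans h))
    (fun x y z _ _ _ h1 h2 => h1.trans h2) (fun x y _ _ h => h.symm)
    (x := K.pt) (y := K'.pt) (Face.sign_of_mem K.pt_mem H)
    ((Face.sign_of_mem K'.pt_mem H).trans h.symm)
  rwa [Face.ofPoint_eq K.pt_mem, Face.ofPoint_eq K'.pt_mem] at this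

/-- The wall `W` sees only the sign on `H`, so `D` and `D'` may be exchanged for any `B` and `B'` on
the right sides. This allows two different loops to be expressed by the same pair of cones; the
terms at `W` itself cancel. -/
theorem IsLoopAround.mk_eq_coneClass {H : F.through} {W : Face F.loc} {C C' D D' : Chamber F.loc}
    (h : IsLoopAround F H W C C' D D') {B B' : Chamber F.loc}
    (hs : C.1.sign H = B.1.sign H) (hs' : C'.1.sign H = B'.1.sign H) :
    (Submodule.Quotient.mk (squareChain F W C C' D D' h.le h.le') : ChainsModBd A.SalCat) =
      (coneClass B C.1 - coneClass B' C.1) - (coneClass B C'.1 - coneClass B' C'.1) := by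
  have e1 : SalPoset.edge W D = SalPoset.edge W B := edge_eq_of_comp_eq fun i hi => by
    obtain rfl := (h.zero_iff i).1 hi
    rw [← h.left, hs]
  have e2 : SalPoset.edge W D' = SalPoset.edge W B' := edge_eq_of_comp_eq fun i hi => by
    obtain rfl := (h.zero_iff i).1 hi
    rw [← h.right, hs']
  have q := fun (E : Chamber F.loc) (hE : W ≤ E.1) (B : Chamber F.loc) =>
    (congrArg (salClass F · (SalPoset.edge W B)) (vertex_eq_edge E B)).trans (salClass_edge hE B)
  rw [mk_squareChain, e1, e2]
  have q1 := q C h.le B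
  have q2 := q C h.le B'
  have q3 := q C' h.le' B
  have q4 := q C' h.le' B'
  rw [q1, q2, q3, q4]
  abel

theorem signType_eq_of_ne {a b c : SignType} (ha : a ≠ 0) (hb : b ≠ 0) (hc : c ≠ 0) (hab : a ≠ b)
    (hac : a ≠ c) : b = c := by
  cases a <;> cases b <;> cases c <;> simp_all

/-- Two loops around the same hyperplane over the same face are homologous. -/
theorem IsLoopAround.mk_eq {H : F.through} {W₁ W₂ : Face F.loc}
    {C₁ C₁' D₁ D₁' C₂ C₂' D₂ D₂' : Chamber F.loc} (h₁ : IsLoopAround F H W₁ C₁ C₁' D₁ D₁')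
    (h₂ : IsLoopAround F H W₂ C₂ C₂' D₂ D₂') :
    (Submodule.Quotient.mk (squareChain F W₁ C₁ C₁' D₁ D₁' h₁.le h₁.le') : ChainsModBd A.SalCat) =
      Submodule.Quotient.mk (squareChain F W₂ C₂ C₂' D₂ D₂' h₂.le h₂.le') := by
  -- Both loops are written with the cones of `C₁` and `C₁'`, which are adjacent across `H` because
  -- `W₁` lies on `H` only. If the second loop starts on the other side it is swapped; this does not
  -- change its chain.
  have key : ∀ {C₂ C₂' D₂ D₂' : Chamber F.loc} (h₂ : IsLoopAround F H W₂ C₂ C₂' D₂ D₂'),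
      C₂.1.sign H = C₁.1.sign H → (Submodule.Quotient.mk
        (squareChain F W₁ C₁ C₁' D₁ D₁' h₁.le h₁.le') : ChainsModBd A.SalCat) =
      Submodule.Quotient.mk (squareChain F W₂ C₂ C₂' D₂ D₂' h₂.le h₂.le') := by
    intro C₂ C₂' D₂ D₂' h₂ hs
    have hs' : C₂'.1.sign H = C₁'.1.sign H :=
      signType_eq_of_ne (C₂.2 H) (C₂'.2 H) (C₁'.2 H) h₂.ne (by rw [hs]; exact h₁.ne)
    have hB : ∀ i, i ≠ H → C₁.1.sign i = C₁'.1.sign i := fun i hi => by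
      have h0 : W₁.sign i ≠ 0 := fun h => hi ((h₁.zero_iff i).1 h)
      rw [← (Face.le_iff.1 h₁.le i).resolve_left h0, ← (Face.le_iff.1 h₁.le' i).resolve_left h0]
    rw [h₁.mk_eq_coneClass rfl rfl, h₂.mk_eq_coneClass hs hs',
      coneClass_sub_eq hB hs (C₂.2 H), coneClass_sub_eq hB hs' (C₂'.2 H)]
  by_cases hs : C₂.1.sign H = C₁.1.sign H
  · exact key h₂ hs
  · rw [key h₂.swap (signType_eq_of_ne (C₂.2 H) (C₂'.2 H) (C₁.2 H) h₂.ne hs), squareChain_swap]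

theorem salMap_edge (m : F ⟶ G) (W : Face G.loc) (C : Chamber G.loc) :
    TFace.salMap m (SalPoset.edge W C) = SalPoset.edge (TFace.incl m W) (TFace.inclC m C) :=
  SalPoset.ext rfl (Subtype.ext (TFace.incl_comp_face m W C.1))

theorem salMap_vertex (m : F ⟶ G) (C : Chamber G.loc) :
    TFace.salMap m (SalPoset.vertex C) = SalPoset.vertex (TFace.inclC m C) := rfl

theorem IsLoopAround.incl (m : F ⟶ G) {H : G.through} {W : Face G.loc} {C C' D D' : Chamber G.loc}
    (h : IsLoopAround G H W C C' D D') :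
    IsLoopAround F ⟨H.1, TFace.through_subset m H.2⟩ (TFace.incl m W) (TFace.inclC m C)
      (TFace.inclC m C') (TFace.inclC m D) (TFace.inclC m D') := by
  have hs : ∀ K : Face G.loc,
      (TFace.incl m K).sign ⟨H.1, TFace.through_subset m H.2⟩ = K.sign H := fun K =>
    TFace.incl_sign_of_mem m K _ H.2
  refine ⟨fun i => ?_, TFace.incl_mono m h.le, TFace.incl_mono m h.le', ?_, ?_, ?_⟩
  · by_cases hi : (i : ι) ∈ G.through
    · rw [TFace.incl_sign_of_mem m W i hi, h.zero_iff, Subtype.ext_iff, Subtype.ext_iff]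
    · rw [TFace.incl_sign_of_notMem m W i hi]
      refine iff_of_false (TFace.dir_ne_zero m i hi) ?_
      rintro rfl; exact hi H.2
  · exact (hs _).trans (h.left.trans (hs _).symm)
  · exact (hs _).trans (h.right.trans (hs _).symm)
  · exact fun e => h.ne ((hs _).symm.trans (e.trans (hs _)))

/-- A loop over `G` is homologous to its image over `F` under an arrow `F ⟶ G`. -/
theorem IsLoopAround.mk_incl (m : F ⟶ G) {H : G.through} {W : Face G.loc}
    {C C' D D' : Chamber G.loc} (h : IsLoopAround G H W C C' D D') :
    (Submodule.Quotient.mk (squareChain F _ _ _ (TFace.inclC m D) (TFace.inclC m D')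
      (h.incl m).le (h.incl m).le') :
      ChainsModBd A.SalCat) = Submodule.Quotient.mk (squareChain G W C C' D D' h.le h.le') := by
  have q : ∀ {x y : SalPoset G.loc}, x ≤ y →
      salClass F (TFace.salMap m x) (TFace.salMap m y) = salClass G x y
        + arrClass (arrOver m y (TFace.salMap m y) le_rfl)
        - arrClass (arrOver m x (TFace.salMap m x) le_rfl) := fun hxy => by
    rw [salClass_of_le hxy, salClass_of_le ((TFace.salMap m).monotone hxy), arrClass_salMap]
  -- Each corner of the square belongs to two arrows, so the arrows joining the corners to their
  -- images cancel.
  rw [mk_squareChain, mk_squareChain, ← salMap_edge, ← salMap_edge, ← salMap_vertex,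
    ← salMap_vertex, q (SalPoset.vertex_le_edge h.le D), q (SalPoset.vertex_le_edge h.le' D),
    q (SalPoset.vertex_le_edge h.le D'), q (SalPoset.vertex_le_edge h.le' D')]
  abel

/-- The loop around `H` at a wall `W` that is given by a chamber of the central arrangement. -/
theorem isLoopAround_compChamber {H : F.through} {W : Face F.loc}
    (hW : ∀ i, W.sign i = 0 ↔ i = H) (E : Chamber A.central) :
    IsLoopAround F H W (W.compChamber (F.resC E)) (W.compChamber (F.resC (negChamber E)))
      (F.resC E) (F.resC (negChamber E)) := by
  have h0 : W.sign H = 0 := (hW H).2 rfl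
  have h1 : ∀ B : Chamber F.loc, (W.compChamber B).1.sign H = B.1.sign H := fun B =>
    Face.comp_sign_of_eq_zero h0 B.1
  refine ⟨hW, W.le_comp _, W.le_comp _, h1 _, h1 _, ?_⟩
  rw [h1, h1]
  change E.1.sign H.1 ≠ -E.1.sign H.1
  have h2 := E.2 H.1
  revert h2
  generalize E.1.sign H.1 = s
  revert s; decide

end Local

end ToricArrangement

/-! ### Universal cover, arrows of the face category, and support -/

namespace ToricArrangement

variable {d : ℕ} {ι : Type} {A : ToricArrangement d ι}

open Topology Filter

/-- The lifted family is infinite but locally finite: if the value of the form minus the level stays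
above its ceiling minus one and below its floor plus one, all signs for `k : ℤ` are controlled at
once. -/
theorem eventually_lifted_le [Finite ι] (A : ToricArrangement d ι) (x : Fin d → ℝ) :
    ∀ᶠ y in 𝓝 x, Face.ofPoint A.lifted x ≤ Face.ofPoint A.lifted y := by
  have key : ∀ i, ∀ᶠ y in 𝓝 x, ∀ k : ℤ, SignType.sign (A.lifted (i, k) x) = 0 ∨
      SignType.sign (A.lifted (i, k) x) = SignType.sign (A.lifted (i, k) y) := by
    intro i
    have hc : ContinuousAt (fun y => A.lin i y - A.level i) x :=
      ((A.lin i).continuous_of_finiteDimensional.sub continuous_const).continuousAt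
    have h1 := hc.eventually (Iio_mem_nhds (Int.lt_floor_add_one (A.lin i x - A.level i)))
    have h2 := hc.eventually (Ioi_mem_nhds
      (sub_lt_iff_lt_add.2 (Int.ceil_lt_add_one (A.lin i x - A.level i))))
    filter_upwards [h1, h2] with y hy1 hy2 k
    simp only [lifted_apply]
    rcases lt_trichotomy (A.lin i x - (A.level i + k)) 0 with h | h | h
    · right
      have h3 : ⌊A.lin i x - A.level i⌋ < k := Int.floor_lt.2 (by linarith)
      have h4 : ((⌊A.lin i x - A.level i⌋ : ℝ)) + 1 ≤ k := by exact_mod_cast h3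
      rw [sign_neg h, sign_neg (by linarith)]
    · left; rw [h, sign_zero]
    · right
      have h3 : k < ⌈A.lin i x - A.level i⌉ := Int.lt_ceil.2 (by linarith)
      have h4 : (k : ℝ) + 1 ≤ ⌈A.lin i x - A.level i⌉ := by exact_mod_cast h3
      rw [sign_pos h, sign_pos (by linarith)]
  filter_upwards [eventually_all.2 key] with y hy
  exact Face.le_iff.2 fun p => hy p.1 p.2

theorem convex_cell {κ : Type} {f : κ → (Fin d → ℝ) →ᵃ[ℝ] ℝ} (F : Face f) :
    Convex ℝ F.cell := by
  rw [convex_iff_segment_subset]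
  intro x hx y hy z hz
  rw [segment_eq_image_lineMap] at hz
  obtain ⟨t, ht, rfl⟩ := hz
  rcases ht.1.eq_or_lt with rfl | h
  · simpa using hx
  · exact Face.lineMap_mem_cell le_rfl hx hy h ht.2

/-- The projection from the universal cover to the compact torus. -/
def proj (x : Fin d → ℝ) : Fin d → UnitAddCircle := fun j => (x j : UnitAddCircle)

theorem continuous_proj : Continuous (proj (d := d)) :=
  continuous_pi fun j => (AddCircle.continuous_mk' 1).comp (continuous_apply j)

theorem proj_add_intVec (x : Fin d → ℝ) (v : Fin d → ℤ) : proj (x + intVec v) = proj x := by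
  funext j
  change ((x j + (v j : ℝ) : ℝ) : UnitAddCircle) = (x j : UnitAddCircle)
  rw [AddCircle.coe_add, add_eq_left, AddCircle.coe_eq_zero_iff]
  exact ⟨v j, by simp⟩

theorem proj_eq_proj_iff {x y : Fin d → ℝ} : proj x = proj y ↔ ∃ v, x = y + intVec v := by
  constructor
  · intro h
    have h1 : ∀ j, ∃ n : ℤ, x j = y j + n := fun j => by
      have h2 : ((x j - y j : ℝ) : UnitAddCircle) = 0 := by
        rw [AddCircle.coe_sub, sub_eq_zero]; exact congrFun h j
      obtain ⟨n, hn⟩ := (AddCircle.coe_eq_zero_iff 1).1 h2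
      exact ⟨n, by simp at hn; linarith⟩
    choose v hv using h1
    exact ⟨v, funext hv⟩
  · rintro ⟨v, rfl⟩; exact proj_add_intVec y v

theorem proj_surjective : Function.Surjective (proj (d := d)) := fun x => by
  have : ∀ j, ∃ r : ℝ, (r : UnitAddCircle) = x j := fun j => QuotientAddGroup.mk_surjective _
  choose y hy using this
  exact ⟨y, funext hy⟩

theorem proj_mem_tor {i : ι} {x : Fin d → ℝ} :
    proj x ∈ A.tor i ↔ ∃ k : ℤ, A.lin i x = A.level i + k := by
  refine (TFace.mem_tor_iff i x).trans (exists_congr fun k => ?_)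
  rw [lifted_apply, sub_eq_zero]

/-- The face of the torus below a lifted face. -/
noncomputable def toT (K : Face A.lifted) : A.TFace := Quotient.mk (AddAction.orbitRel _ _) K

theorem toT_vadd (v : Fin d → ℤ) (K : Face A.lifted) : toT (v +ᵥ K) = toT K :=
  Quotient.sound ⟨v, rfl⟩

theorem toT_rep (F : A.TFace) : toT F.rep = F := Quotient.out_eq F

theorem exists_rep_toT (K : Face A.lifted) : ∃ v : Fin d → ℤ, (toT K).rep = v +ᵥ K := by
  have h : (toT K).rep ∈ AddAction.orbit (Fin d → ℤ) K := Quotient.exact (toT_rep (toT K))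
  obtain ⟨v, hv⟩ := h
  exact ⟨v, hv.symm⟩

theorem ofPoint_add_intVec (x : Fin d → ℝ) (v : Fin d → ℤ) :
    Face.ofPoint A.lifted (x + intVec v) = v +ᵥ Face.ofPoint A.lifted x :=
  Face.ofPoint_eq (add_mem_vadd_cell A (Face.mem_cell_ofPoint _ x))

theorem mem_through_toT {K : Face A.lifted} {i : ι} :
    i ∈ (toT K).through ↔ ∃ k : ℤ, K.sign (i, k) = 0 := by
  obtain ⟨v, hv⟩ := exists_rep_toT K
  rw [TFace.mem_through_iff, hv]
  constructor
  · rintro ⟨k, hk⟩; exact ⟨_, hk⟩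
  · rintro ⟨k, hk⟩
    refine ⟨k + ∑ j, A.char i j * v j, ?_⟩
    rw [vadd_sign]; simpa using hk

theorem mem_through_ofPoint {x : Fin d → ℝ} {i : ι} :
    i ∈ (toT (Face.ofPoint A.lifted x)).through ↔ ∃ k : ℤ, A.lin i x = A.level i + k := by
  rw [mem_through_toT]
  refine exists_congr fun k => ?_
  rw [Face.ofPoint_sign, sign_eq_zero_iff, lifted_apply, sub_eq_zero]

theorem carrier_toT (K : Face A.lifted) : (toT K).carrier = proj '' K.cell := by
  obtain ⟨v, hv⟩ := exists_rep_toT K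
  have h1 : (toT K).rep.cell = (· + intVec v) '' K.cell := by
    rw [hv]
    ext y
    constructor
    · intro hy
      refine ⟨y + intVec (-v), ?_, ?_⟩
      · have := add_mem_vadd_cell A (v := -v) hy
        rwa [neg_vadd_vadd] at this
      · funext j; simp [intVec]
    · rintro ⟨x, hx, rfl⟩
      exact add_mem_vadd_cell A hx
  change proj '' _ = _
  rw [h1, Set.image_image]
  exact Set.image_congr fun x _ => proj_add_intVec x v

/-- Incident points of the universal cover give an arrow of the face category. -/
theorem exists_hom_of_le {x y : Fin d → ℝ}
    (h : Face.ofPoint A.lifted x ≤ Face.ofPoint A.lifted y) :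
    ∃ m : toT (Face.ofPoint A.lifted x) ⟶ toT (Face.ofPoint A.lifted y),
      ∀ i, (TFace.dir m).sign i = SignType.sign (A.lin i (y - x)) := by
  obtain ⟨a, ha⟩ := exists_rep_toT (Face.ofPoint A.lifted x)
  obtain ⟨b, hb⟩ := exists_rep_toT (Face.ofPoint A.lifted y)
  -- Translation by `a` moves the pair of lifts so that the smaller one becomes the chosen
  -- representative; the larger one is then the `(a - b)`-translate of its own.
  have e : (a - b) +ᵥ (toT (Face.ofPoint A.lifted y)).rep = a +ᵥ Face.ofPoint A.lifted y := by
    rw [hb, ← add_vadd]; simp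
  let m : toT (Face.ofPoint A.lifted x) ⟶ toT (Face.ofPoint A.lifted y) :=
    ⟨a - b, by rw [e, ha]; exact vadd_mono A a h⟩
  refine ⟨m, fun i => ?_⟩
  have h1 : x + intVec a ∈ (toT (Face.ofPoint A.lifted x)).rep.cell := by
    rw [ha]; exact add_mem_vadd_cell A (Face.mem_cell_ofPoint _ x)
  have h2 : y + intVec a ∈ (m.1 +ᵥ (toT (Face.ofPoint A.lifted y)).rep).cell := by
    change _ ∈ ((a - b) +ᵥ _ : Face A.lifted).cell
    rw [e]; exact add_mem_vadd_cell A (Face.mem_cell_ofPoint _ y)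
  rw [TFace.dir_sign m i h1 h2, add_sub_add_right_eq_sub]

/-- A generator of the ideal of the coordinates is a common divisor, hence a unit by primitivity;
this is Bézout's identity. -/
theorem exists_lin_intVec_eq_one (A : ToricArrangement d ι) (i : ι) :
    ∃ v : Fin d → ℤ, ∑ j, A.char i j * v j = 1 := by
  obtain ⟨g, hg⟩ := IsPrincipalIdealRing.principal (Ideal.span (Set.range (A.char i)))
  have h1 : IsUnit g := A.primitive i g fun j => by
    have : A.char i j ∈ Ideal.span {g} := by
      rw [Ideal.span, ← hg]; exact Ideal.subset_span ⟨j, rfl⟩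
    exact Ideal.mem_span_singleton.1 this
  have h2 : (1 : ℤ) ∈ Ideal.span (Set.range (A.char i)) := by
    have h3 : Ideal.span (Set.range (A.char i)) = ⊤ := by
      rw [hg]; exact Ideal.span_singleton_eq_top.2 h1
    rw [h3]; trivial
  obtain ⟨c, hc⟩ := Ideal.mem_span_range_iff_exists_fun.1 h2
  exact ⟨c, by simpa [mul_comm] using hc⟩

theorem lin_ne_zero (A : ToricArrangement d ι) (i : ι) : A.lin i ≠ 0 := by
  intro h
  obtain ⟨v, hv⟩ := A.exists_lin_intVec_eq_one i
  have := lin_intVec A i v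
  rw [h, hv] at this
  simp at this

/-- Two hypertori with a common point and parallel hyperplanes are equal. -/
theorem eq_of_ker_eq {i j : ι} (h : LinearMap.ker (A.lin i) = LinearMap.ker (A.lin j))
    {x : Fin d → ℝ} {k l : ℤ} (hi : A.lin i x = A.level i + k) (hj : A.lin j x = A.level j + l) :
    i = j := by
  obtain ⟨c, hc⟩ := exists_smul_of_ker_eq (A.lin_ne_zero i) h
  obtain ⟨v, hv⟩ := A.exists_lin_intVec_eq_one i
  -- The factor is the value of the second character at an integer vector where the first one is
  -- `1`. It divides the second character, so primitivity forces it to be a unit.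
  obtain ⟨n, hn⟩ : ∃ n : ℤ, c = n := by
    refine ⟨∑ t, A.char j t * v t, ?_⟩
    have h1 := lin_intVec A i v
    rw [← lin_intVec, hc, LinearMap.smul_apply, h1, hv]; simp
  have hchar : ∀ t, A.char j t = n * A.char i t := by
    intro t
    have h1 : ∀ i', A.lin i' (Pi.single t 1) = A.char i' t := fun i' => by
      rw [lin_apply]; simp [Pi.single_apply]
    have h2 := h1 j
    rw [hc, LinearMap.smul_apply, h1, hn, smul_eq_mul] at h2
    exact_mod_cast h2.symm
  have hu : IsUnit n := A.primitive j n fun t => ⟨_, hchar t⟩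
  have hlev : (A.level j : UnitAddCircle) = n • (A.level i : UnitAddCircle) := by
    rw [← AddCircle.coe_zsmul, ← sub_eq_zero, ← AddCircle.coe_sub, AddCircle.coe_eq_zero_iff]
    refine ⟨n * k - l, ?_⟩
    have h3 : A.level j + l = n * (A.level i + k) := by
      rw [← hj, ← hi, hc, hn]; rfl
    simp; linarith
  apply A.distinct
  ext y
  change ∑ t, A.char i t • y t = _ ↔ ∑ t, A.char j t • y t = _
  have hs : ∑ t, A.char j t • y t = n • ∑ t, A.char i t • y t := by
    rw [Finset.smul_sum]
    exact Finset.sum_congr rfl fun t _ => by rw [hchar, mul_smul]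
  rw [hs, hlev]
  rcases Int.isUnit_iff.1 hu with rfl | rfl <;> simp

theorem eq_of_mem_through {F : A.TFace} {i j : ι} (hi : i ∈ F.through) (hj : j ∈ F.through)
    (h : LinearMap.ker (A.lin i) = LinearMap.ker (A.lin j)) : i = j := by
  obtain ⟨k, hk⟩ := TFace.mem_through_iff.1 hi
  obtain ⟨l, hl⟩ := TFace.mem_through_iff.1 hj
  exact eq_of_ker_eq h (TFace.eq_level hk F.rep.pt_mem) (TFace.eq_level hl F.rep.pt_mem)

/-- A form that takes discrete values on an affine subspace is constant there. -/
theorem lin_eq_zero_of_forall_mem {i : ι} {x w : Fin d → ℝ}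
    (h : ∀ s : ℝ, ∃ k : ℤ, A.lin i (x + s • w) = A.level i + k) : A.lin i w = 0 := by
  by_contra hw
  obtain ⟨k, hk⟩ := h 0
  -- This step along `w` changes the form by `1 / 2`, which is not an integer.
  obtain ⟨l, hl⟩ := h (1 / (2 * A.lin i w))
  rw [map_add, map_smul, smul_eq_mul] at hk hl
  have h1 : (1 / (2 * A.lin i w)) * A.lin i w = 1 / 2 := by field_simp
  rw [h1] at hl
  have h2 : (2 * (l - k) : ℝ) = 1 := by linarith
  have h3 : (2 * (l - k) : ℤ) = 1 := by exact_mod_cast h2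
  omega

theorem carrier_isPreconnected (F : A.TFace) : _root_.IsPreconnected F.carrier :=
  (convex_cell F.rep).isPreconnected.image _ continuous_proj.continuousOn

/-- A face whose support is a hypertorus lies on no other hypertorus. -/
theorem through_eq_of_isSupport {G : A.TFace} {H : ι} (h : G.IsSupport (A.tor H)) :
    G.through = {H} := by
  ext i
  refine ⟨fun hi => ?_, fun hi => by rw [Set.mem_singleton_iff.1 hi]; exact h.2.1⟩
  have hx : proj G.rep.pt ∈ G.carrier := ⟨_, G.rep.pt_mem, rfl⟩
  -- The component of `tor i` containing the face is a layer, so it contains the support.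
  have hsub : A.tor H ⊆ A.tor i := by
    refine (h.2.2 (connectedComponentIn (A.tor i) (proj G.rep.pt)) ?_ ?_).trans
      (connectedComponentIn_subset _ _)
    · refine ⟨{i}, proj G.rep.pt, ?_, ?_⟩
      · simpa using hi hx
      · simp
    · exact (carrier_isPreconnected G).subset_connectedComponentIn hx hi
  obtain ⟨k, hk⟩ := proj_mem_tor.1 (h.2.1 hx)
  obtain ⟨l, hl⟩ := proj_mem_tor.1 (hi hx)
  have hker : LinearMap.ker (A.lin H) ≤ LinearMap.ker (A.lin i) := fun w hw => by
    refine lin_eq_zero_of_forall_mem (x := G.rep.pt) fun s => ?_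
    refine proj_mem_tor.1 (hsub (proj_mem_tor.2 ⟨k, ?_⟩))
    rw [map_add, map_smul, LinearMap.mem_ker.1 hw, smul_zero, add_zero, hk]
  have hker' := Submodule.eq_of_le_of_finrank_eq hker (by
    have h1 := finrank_ker_add_one (A.lin_ne_zero H)
    have h2 := finrank_ker_add_one (A.lin_ne_zero i)
    omega)
  exact (eq_of_ker_eq hker' hk hl).symm

/-! ### Loops around a hypertorus over different faces -/

section Homology

variable [Finite ι]

/-- All loops around `H` over `F` and over `F'` are homologous. -/
def LoopsAgree (H : ι) (F F' : A.TFace) : Prop :=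
  ∀ (hF : H ∈ F.through) (hF' : H ∈ F'.through) (W : Face F.loc) (C₁ C₂ D₁ D₂ : Chamber F.loc)
    (W' : Face F'.loc) (C₁' C₂' D₁' D₂' : Chamber F'.loc)
    (h : IsLoopAround F ⟨H, hF⟩ W C₁ C₂ D₁ D₂) (h' : IsLoopAround F' ⟨H, hF'⟩ W' C₁' C₂' D₁' D₂'),
    (Submodule.Quotient.mk (squareChain F W C₁ C₂ D₁ D₂ h.le h.le') : ChainsModBd A.SalCat) =
      Submodule.Quotient.mk (squareChain F' W' C₁' C₂' D₁' D₂' h'.le h'.le')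

theorem LoopsAgree.symm {H : ι} {F F' : A.TFace} (h : LoopsAgree H F F') : LoopsAgree H F' F :=
  fun _ _ _ _ _ _ _ _ _ _ _ _ h₁ h₂ => (h _ _ _ _ _ _ _ _ _ _ _ _ h₂ h₁).symm

theorem loopsAgree_of_hom {H : ι} {F F' : A.TFace} (m : F ⟶ F') : LoopsAgree H F F' :=
  fun _ _ _ _ _ _ _ _ _ _ _ _ h h' => (h.mk_eq (h'.incl m)).trans (h'.mk_incl m)

/-- All loops around a hypertorus are homologous, if some face lies on this hypertorus only. -/
theorem loopsAgree (E : Chamber A.central) {H : ι} {G : A.TFace} (hG : G.through = {H})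
    (F : A.TFace) (hF : H ∈ F.through) : LoopsAgree H F G := by
  let y := G.rep.pt
  have hGy : toT (Face.ofPoint A.lifted y) = G := by
    rw [Face.ofPoint_eq G.rep.pt_mem, toT_rep]
  obtain ⟨k, hk⟩ : ∃ k : ℤ, A.lin H y = A.level H + k := by
    rw [← mem_through_ofPoint, hGy, hG]; rfl
  obtain ⟨l, hl⟩ : ∃ l : ℤ, A.lin H F.rep.pt = A.level H + l := by
    rw [← mem_through_ofPoint, Face.ofPoint_eq F.rep.pt_mem, toT_rep]; exact hF
  obtain ⟨v, hv⟩ := A.exists_lin_intVec_eq_one H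
  -- A translate of the point of `F` lying on the same lift of `H` as `y`.
  let x := F.rep.pt + intVec ((k - l) • v)
  have hFx : toT (Face.ofPoint A.lifted x) = F := by
    rw [ofPoint_add_intVec, toT_vadd, Face.ofPoint_eq F.rep.pt_mem, toT_rep]
  have hx : A.lin H x = A.level H + k := by
    have h1 : ∑ j, A.char H j * ((k - l) • v) j = k - l := by
      calc ∑ j, A.char H j * ((k - l) • v) j = ∑ j, (k - l) * (A.char H j * v j) :=
            Finset.sum_congr rfl fun j _ => by rw [Pi.smul_apply, smul_eq_mul]; ring
        _ = k - l := by rw [← Finset.mul_sum, hv, mul_one]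
    rw [map_add, lin_intVec, h1, hl]; push_cast; ring
  rw [← hGy, ← hFx]
  have hconv : _root_.IsPreconnected {x | A.lin H x = A.level H + k} :=
    (convex_hyperplane (A.lin H).isLinear _).isPreconnected
  refine hconv.induction₂ (fun x y => LoopsAgree H (toT (Face.ofPoint A.lifted x))
    (toT (Face.ofPoint A.lifted y))) (fun x _ => ?_) (fun x z x' _ hz _ h h' => ?_)
    (fun x y _ _ h => h.symm) hx hk
  · filter_upwards [nhdsWithin_le_nhds (A.eventually_lifted_le x)] with z hz
    exact loopsAgree_of_hom (exists_hom_of_le hz).choose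
  · intro h₁ h₂ W C₁ C₂ D₁ D₂ W' C₁' C₂' D₁' D₂' hloop hloop'
    have hzt : H ∈ (toT (Face.ofPoint A.lifted z)).through := mem_through_ofPoint.2 ⟨k, hz⟩
    -- Composing two agreements needs an actual loop over the middle face. The direction towards `y`
    -- is a suitable wall: any hypertorus through `z` that contains this direction also passes
    -- through `y`, so it is `H`.
    let V : Face (toT (Face.ofPoint A.lifted z)).loc := Face.ofPoint _ (y - z)
    have hV : ∀ i, V.sign i = 0 ↔ i = ⟨H, hzt⟩ := by
      intro i
      change SignType.sign (A.lin i (y - z)) = 0 ↔ _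
      rw [sign_eq_zero_iff, map_sub, sub_eq_zero]
      constructor
      · intro hi
        obtain ⟨n, hn⟩ := mem_through_ofPoint.1 i.2
        have h3 : (i : ι) ∈ (toT (Face.ofPoint A.lifted y)).through :=
          mem_through_ofPoint.2 ⟨n, hi.trans hn⟩
        rw [hGy, hG] at h3
        exact Subtype.ext h3
      · rintro rfl
        exact hk.trans (Eq.symm hz)
    have hl := isLoopAround_compChamber hV E
    exact (h h₁ hzt _ _ _ _ _ _ _ _ _ _ hloop hl).trans
      (h' hzt h₂ _ _ _ _ _ _ _ _ _ _ hl hloop')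

/-- `LoopsAgree` is vacuous when no loop exists, so transitivity needs a loop over `G`. There `H` is
the only hypertorus and the face of the origin serves as wall. -/
theorem LoopsAgree.trans_through {H : ι} {F F' G : A.TFace} (h : LoopsAgree H F G)
    (h' : LoopsAgree H F' G) (E : Chamber A.central) (hG : G.through = {H}) :
    LoopsAgree H F F' := by
  intro h₁ h₂ W C₁ C₂ D₁ D₂ W' C₁' C₂' D₁' D₂' hloop hloop'
  have hGH : H ∈ G.through := by rw [hG]; rfl
  have hl := isLoopAround_compChamber (F := G) (H := ⟨H, hGH⟩) (W := center G)
    (fun i => iff_of_true (center_sign G i) (Subtype.ext (by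
      exact hG.le i.2))) E
  exact (h h₁ hGH _ _ _ _ _ _ _ _ _ _ hloop hl).trans
    (h' h₂ hGH _ _ _ _ _ _ _ _ _ _ hloop' hl).symm

/-- The class `ω_H` is the class of any loop around `H`. -/
theorem IsOmegaClass.eq_mk {E : Chamber A.central} {H : ι} {c : H₁ A.SalCat}
    (hc : IsOmegaClass E H c) {F : A.TFace} (hF : H ∈ F.through) {W : Face F.loc}
    {C C' D D' : Chamber F.loc} (h : IsLoopAround F ⟨H, hF⟩ W C C' D D') :
    homologyToChains A.SalCat c = Submodule.Quotient.mk (squareChain F W C C' D D' h.le h.le') := by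
  obtain ⟨F', G, m, hG, rfl⟩ := hc
  have hG' := through_eq_of_isSupport hG
  have hGH : H ∈ G.through := by rw [hG']; rfl
  have hF' : H ∈ F'.through := TFace.through_subset m hGH
  have hl := isLoopAround_compChamber (F := F') (H := ⟨H, hF'⟩) (W := TFace.dir m)
    (fun i => ⟨fun h0 => Subtype.ext (by
      by_contra hne
      exact TFace.dir_ne_zero m i (by rw [hG']; exact hne) h0),
      fun h0 => by subst h0; exact TFace.dir_eq_zero m _ hGH⟩) E
  have := (loopsAgree E hG' F' hF').trans_through (loopsAgree E hG' F hF) E hG'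
  exact this hF' hF _ _ _ _ _ _ _ _ _ _ hl h

end Homology

end ToricArrangement

/-! ### One-dimensional layers as circles of vertices and edges -/

namespace ToricArrangement

variable {d : ℕ} {ι : Type} {A : ToricArrangement d ι}

open Topology Filter

theorem isOpenMap_proj : IsOpenMap (proj (d := d)) :=
  IsOpenMap.piMap (f := fun (_ : Fin d) (x : ℝ) => (x : UnitAddCircle))
    (fun _ => QuotientAddGroup.isOpenMap_coe)
    (Eventually.of_forall fun _ => QuotientAddGroup.mk_surjective)

theorem int_eq_of_abs_sub_lt {a b c : ℝ} {k l : ℤ} (ha : a = c + k) (hb : b = c + l)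
    (h : |a - b| < 1) : a = b := by
  rw [ha, hb] at h ⊢
  have h1 : |((k - l : ℤ) : ℝ)| < 1 := by push_cast; convert h using 2; ring
  have h2 : |k - l| < 1 := by exact_mod_cast h1
  have h3 : k = l := sub_eq_zero.1 (Int.abs_lt_one_iff.1 h2)
  rw [h3]

/-- A layer is the image of any lifted translate of its flat. -/
theorem IsLayer.eq_image [Finite ι] {M : Set (Fin d → UnitAddCircle)} (hM : A.IsLayer M)
    {x : Fin d → ℝ} (hx : proj x ∈ M) : M = (fun w => proj (x + w)) '' (A.flat M) := by
  obtain ⟨S, y, -, hMeq⟩ := hM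
  let T := ⋂ i ∈ S, A.tor i
  let V : Submodule ℝ (Fin d → ℝ) := ⨅ i ∈ S, A.hyp i
  have hMT : M ⊆ T := hMeq ▸ connectedComponentIn_subset _ _
  have hT : ∀ {z}, z ∈ T → ∀ i ∈ S, z ∈ A.tor i := fun hz i hi => Set.mem_iInter₂.1 hz i hi
  have hV : ∀ {w}, w ∈ V ↔ ∀ i ∈ S, A.lin i w = 0 := by
    intro w
    simp only [V, Submodule.mem_iInf]; rfl
  have hle : ∀ {w}, w ∈ V → proj (x + w) ∈ M := by
    intro w hw
    have hpre : _root_.IsPreconnected ((fun w => proj (x + w)) '' (V : Set (Fin d → ℝ))) :=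
      V.convex.isPreconnected.image _
        (continuous_proj.comp (continuous_const.add continuous_id)).continuousOn
    have hsub := hpre.subset_connectedComponentIn (x := proj x) (F := T) ⟨0, V.zero_mem, by simp⟩ (by
      rintro _ ⟨w, hw, rfl⟩
      refine Set.mem_iInter₂.2 fun i hi => ?_
      obtain ⟨k, hk⟩ := proj_mem_tor.1 (hT (hMT hx) i hi)
      refine proj_mem_tor.2 ⟨k, ?_⟩
      rw [map_add, hV.1 hw i hi, add_zero, hk])
    rw [hMeq] at hx ⊢
    rw [connectedComponentIn_eq hx]
    exact hsub ⟨w, hw, rfl⟩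
  have hge : ∀ {z}, z ∈ M → ∃ w ∈ V, proj (x + w) = z := by
    intro z hz
    have hpre : _root_.IsPreconnected M := hMeq ▸ isPreconnected_connectedComponentIn
    -- The relation refers to every lift of `a`, so that the differences of successive lifts can be
    -- added in `V`.
    have key := hpre.induction₂
      (fun a b => ∀ x, proj x = a → ∃ w ∈ V, proj (x + w) = b) ?_ ?_ ?_ hx hz x rfl
    · exact key
    · intro a ha
      obtain ⟨x, rfl⟩ := proj_surjective a
      have h1 : ∀ᶠ x' in 𝓝 x, ∀ i, |A.lin i x' - A.lin i x| < 1 := by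
        refine eventually_all.2 fun i => ?_
        have hc : ContinuousAt (fun x' => |A.lin i x' - A.lin i x|) x :=
          ((A.lin i).continuous_of_finiteDimensional.sub continuous_const).abs.continuousAt
        exact hc.eventually (Iio_mem_nhds (by simp))
      have h2 := isOpenMap_proj.image_mem_nhds h1
      filter_upwards [nhdsWithin_le_nhds h2, self_mem_nhdsWithin] with b hb hbM x₁ hx₁
      obtain ⟨x', hx', rfl⟩ := hb
      obtain ⟨v, rfl⟩ := proj_eq_proj_iff.1 hx₁
      refine ⟨x' - x, hV.2 fun i hi => ?_, ?_⟩
      · obtain ⟨k, hk⟩ := proj_mem_tor.1 (hT (hMT ha) i hi)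
        obtain ⟨l, hl⟩ := proj_mem_tor.1 (hT (hMT hbM) i hi)
        rw [map_sub, int_eq_of_abs_sub_lt hl hk (hx' i), sub_self]
      · rw [show x + intVec v + (x' - x) = x' + intVec v by abel, proj_add_intVec]
    · intro a b c _ _ _ h h' x hx
      obtain ⟨w, hw, rfl⟩ := h x hx
      obtain ⟨w', hw', rfl⟩ := h' _ rfl
      exact ⟨w + w', add_mem hw hw', by rw [add_assoc]⟩
    · intro a b _ _ h x' hx'
      obtain ⟨x, rfl⟩ := proj_surjective a
      obtain ⟨w, hw, hb⟩ := h x rfl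
      rw [← hx'] at hb
      obtain ⟨v, hv⟩ := proj_eq_proj_iff.1 hb
      refine ⟨-w, neg_mem hw, ?_⟩
      rw [← proj_add_intVec _ v, show x' + -w + intVec v = x by rw [add_right_comm, ← hv]; abel]
  -- `S` may omit hypertori containing `M`; their forms take discrete values on the translate of
  -- `V`, hence vanish on `V`.
  have hflat : A.flat M = V := by
    apply le_antisymm
    · refine le_iInf₂ fun i hi => iInf₂_le (f := fun i (_ : i ∈ {i | M ⊆ A.tor i}) => A.hyp i) i ?_
      exact fun z hz => hT (hMT hz) i hi
    · refine le_iInf₂ fun i hi w hw => ?_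
      refine lin_eq_zero_of_forall_mem (x := x) fun s => ?_
      exact proj_mem_tor.1 (hi (hle (V.smul_mem s hw)))
  rw [hflat]
  ext z
  refine ⟨fun hz => hge hz, ?_⟩
  rintro ⟨w, hw, rfl⟩
  exact hle hw

/-- A one-dimensional layer of an essential arrangement, with a generator of its flat. -/
structure IsLine (A : ToricArrangement d ι) (M : Set (Fin d → UnitAddCircle)) (u : Fin d → ℝ) :
    Prop where
  layer : A.IsLayer M
  essential : A.IsEssential
  ne_zero : u ≠ 0
  flat_eq : A.flat M = Submodule.span ℝ {u}

/-- A face of a one-dimensional layer with direction `u` is a vertex if some hypertorus through it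
is transversal to `u`. -/
def TFace.IsVertex (F : A.TFace) (u : Fin d → ℝ) : Prop := ∃ i ∈ F.through, A.lin i u ≠ 0

theorem TFace.isVertex_neg {F : A.TFace} {u : Fin d → ℝ} : F.IsVertex (-u) ↔ F.IsVertex u := by
  simp [TFace.IsVertex]

/-- The arrow `m` points in the direction `u`. -/
def PointsTo (u : Fin d → ℝ) {F G : A.TFace} (m : F ⟶ G) : Prop :=
  ∀ i, (TFace.dir m).sign i = SignType.sign (A.lin i u)

theorem exists_hom_of_le' {x y : Fin d → ℝ} {F G : A.TFace}
    (hF : toT (Face.ofPoint A.lifted x) = F) (hG : toT (Face.ofPoint A.lifted y) = G)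
    (h : Face.ofPoint A.lifted x ≤ Face.ofPoint A.lifted y) :
    ∃ m : F ⟶ G, ∀ i, (TFace.dir m).sign i = SignType.sign (A.lin i (y - x)) := by
  subst hF hG
  exact exists_hom_of_le h

theorem toT_ofPoint_pt (F : A.TFace) : toT (Face.ofPoint A.lifted F.rep.pt) = F := by
  rw [Face.ofPoint_eq F.rep.pt_mem, toT_rep]

theorem floor_eq_of_sign_eq {a b : ℝ}
    (h : ∀ k : ℤ, SignType.sign (a - k) = SignType.sign (b - k)) : ⌊a⌋ = ⌊b⌋ := by
  have h1 : ∀ (c : ℝ) (k : ℤ), k ≤ ⌊c⌋ ↔ SignType.sign (c - k) ≠ -1 := fun c k => by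
    rw [Int.le_floor, Ne, sign_eq_neg_one_iff, not_lt, sub_nonneg]
  exact le_antisymm ((h1 b _).2 (h _ ▸ (h1 a _).1 le_rfl))
    ((h1 a _).2 ((h _).symm ▸ (h1 b _).1 le_rfl))

/-- The signs against all lifts of a hypertorus record between which consecutive lifts a point lies.
-/
theorem floor_eq_of_mem_cell {K : Face A.lifted} {x y : Fin d → ℝ} (hx : x ∈ K.cell)
    (hy : y ∈ K.cell) (i : ι) : ⌊A.lin i x - A.level i⌋ = ⌊A.lin i y - A.level i⌋ := by
  refine floor_eq_of_sign_eq fun k => ?_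
  have h1 := Face.sign_of_mem hx (i, k)
  rw [← Face.sign_of_mem hy (i, k), lifted_apply, lifted_apply] at h1
  rwa [sub_sub, sub_sub]

/-- Deck transformations act freely on the lifted faces of an essential arrangement. -/
theorem IsEssential.vadd_injective (hA : A.IsEssential) {K : Face A.lifted} {v w : Fin d → ℤ}
    (h : v +ᵥ K = w +ᵥ K) : v = w := by
  have h1 := add_mem_vadd_cell A (v := v) K.pt_mem
  have h2 := add_mem_vadd_cell A (v := w) K.pt_mem
  rw [h] at h1
  -- The form `i` is shifted by integers while its floor is the same on the common cell, so the two
  -- shifts are equal.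
  have h3 : intVec v - intVec w ∈ ⨅ i, A.hyp i := by
    rw [Submodule.mem_iInf]
    intro i
    have h4 := floor_eq_of_mem_cell h1 h2 i
    rw [map_add, map_add, lin_intVec, lin_intVec, add_sub_right_comm, add_sub_right_comm,
      Int.floor_add_intCast, Int.floor_add_intCast] at h4
    change A.lin i _ = 0
    rw [map_sub, lin_intVec, lin_intVec, add_left_cancel h4, sub_self]
  rw [hA, Submodule.mem_bot, sub_eq_zero] at h3
  funext j
  exact Int.cast_injective (α := ℝ) (congrFun h3 j)

variable {M : Set (Fin d → UnitAddCircle)} {u : Fin d → ℝ}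

theorem IsLine.neg (h : IsLine A M u) : IsLine A M (-u) :=
  ⟨h.layer, h.essential, neg_ne_zero.2 h.ne_zero, by
    rw [h.flat_eq, ← Set.neg_singleton, Submodule.span_neg]⟩

theorem IsLine.lin_eq_zero (h : IsLine A M u) {i : ι} (hi : M ⊆ A.tor i) : A.lin i u = 0 := by
  have h1 : u ∈ A.flat M := by rw [h.flat_eq]; exact Submodule.mem_span_singleton_self u
  have h2 : A.flat M ≤ A.hyp i := iInf₂_le i hi
  exact h2 h1

theorem IsLine.exists_smul (h : IsLine A M u) {w : Fin d → ℝ}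
    (hw : ∀ i, M ⊆ A.tor i → A.lin i w = 0) : ∃ t : ℝ, w = t • u := by
  have h1 : w ∈ A.flat M := by
    simp only [flat, Submodule.mem_iInf]
    exact hw
  rw [h.flat_eq] at h1
  obtain ⟨t, rfl⟩ := Submodule.mem_span_singleton.1 h1
  exact ⟨t, rfl⟩

theorem IsLine.exists_lin_ne_zero (h : IsLine A M u) : ∃ i, A.lin i u ≠ 0 := by
  by_contra! h0
  have : u ∈ ⨅ i, A.hyp i := by rw [Submodule.mem_iInf]; exact h0
  rw [h.essential] at this
  exact h.ne_zero ((Submodule.mem_bot ℝ).1 this)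

variable [Finite ι]

theorem IsLine.proj_mem_iff (h : IsLine A M u) {x y : Fin d → ℝ} (hx : proj x ∈ M) :
    proj y ∈ M ↔ ∃ (t : ℝ) (v : Fin d → ℤ), y = x + t • u + intVec v := by
  rw [h.layer.eq_image hx, h.flat_eq]
  constructor
  · rintro ⟨w, hw, e⟩
    obtain ⟨t, rfl⟩ := Submodule.mem_span_singleton.1 hw
    obtain ⟨v, hv⟩ := proj_eq_proj_iff.1 e.symm
    exact ⟨t, v, hv⟩
  · rintro ⟨t, v, rfl⟩
    exact ⟨t • u, Submodule.smul_mem _ _ (Submodule.mem_span_singleton_self u),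
      (proj_add_intVec _ v).symm⟩

theorem IsLine.proj_add_smul_mem (h : IsLine A M u) {x : Fin d → ℝ} (hx : proj x ∈ M) (t : ℝ) :
    proj (x + t • u) ∈ M :=
  (h.proj_mem_iff hx).2 ⟨t, 0, by funext j; simp [intVec]⟩

theorem subset_tor_of_carrier_subset {F : A.TFace} (hF : F.carrier ⊆ M) {i : ι}
    (hi : M ⊆ A.tor i) : i ∈ F.through := hF.trans hi

theorem proj_pt_mem {F : A.TFace} (hF : F.carrier ⊆ M) : proj F.rep.pt ∈ M :=
  hF ⟨_, F.rep.pt_mem, rfl⟩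

/-- A hypertorus through a face of `M` whose hyperplane is parallel to `M` contains `M`. -/
theorem IsLine.subset_tor (h : IsLine A M u) {F : A.TFace} (hF : F.carrier ⊆ M) {i : ι}
    (hi : i ∈ F.through) (h0 : A.lin i u = 0) : M ⊆ A.tor i := by
  intro z hz
  obtain ⟨y, rfl⟩ := proj_surjective z
  obtain ⟨t, v, rfl⟩ := (h.proj_mem_iff (proj_pt_mem hF)).1 hz
  obtain ⟨k, hk⟩ := TFace.mem_through_iff.1 hi
  rw [proj_add_intVec]
  refine proj_mem_tor.2 ⟨k, ?_⟩
  rw [map_add, map_smul, h0, smul_zero, add_zero, TFace.eq_level hk F.rep.pt_mem]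

theorem IsLine.carrier_subset (h : IsLine A M u) {x : Fin d → ℝ} (hx : proj x ∈ M) :
    (toT (Face.ofPoint A.lifted x)).carrier ⊆ M := by
  rw [carrier_toT]
  rintro _ ⟨y, hy, rfl⟩
  obtain ⟨t, ht⟩ := h.exists_smul (w := y - x) fun i hi => by
    obtain ⟨k, hk⟩ := proj_mem_tor.1 (hi hx)
    have h0 : (Face.ofPoint A.lifted x).sign (i, k) = 0 := by
      rw [Face.ofPoint_sign, sign_eq_zero_iff, lifted_apply, hk, sub_self]
    rw [map_sub, TFace.eq_level h0 hy, hk, sub_self]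
  rw [show y = x + t • u by rw [← ht]; abel]
  exact h.proj_add_smul_mem hx t

/-- Passing from one lift of a hypertorus to another does not change its direction, so only the set
of hypertori through the face matters. -/
theorem TFace.dim_eq (F : A.TFace) :
    F.dim = Module.finrank ℝ (⨅ i ∈ F.through, A.hyp i : Submodule ℝ (Fin d → ℝ)) := by
  have h1 := Face.vectorSpan_cell F.rep.pt_mem (by
    have := A.eventually_lifted_le F.rep.pt
    rwa [Face.ofPoint_eq F.rep.pt_mem] at this)
  have h2 : (⨅ p ∈ {p | F.rep.sign p = 0}, LinearMap.ker (A.lifted p).linear) =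
      ⨅ i ∈ F.through, A.hyp i := by
    have h3 : ∀ p, LinearMap.ker (A.lifted p).linear = A.hyp p.1 := fun p => by
      simp [lifted, hyp]
    simp only [h3]
    apply le_antisymm
    · refine le_iInf₂ fun i hi => ?_
      obtain ⟨k, hk⟩ := TFace.mem_through_iff.1 hi
      exact iInf₂_le (f := fun (p : ι × ℤ) (_ : p ∈ {p | F.rep.sign p = 0}) => A.hyp p.1) (i, k) hk
    · exact le_iInf₂ fun p hp => iInf₂_le p.1 (TFace.mem_through_iff.2 ⟨p.2, hp⟩)
  rw [TFace.dim, Face.dim, h1, h2]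

theorem IsLine.dim_eq_zero (h : IsLine A M u) {F : A.TFace} (hF : F.carrier ⊆ M)
    (hv : F.IsVertex u) : F.dim = 0 := by
  obtain ⟨i, hi, h0⟩ := hv
  rw [TFace.dim_eq]
  suffices (⨅ i ∈ F.through, A.hyp i : Submodule ℝ (Fin d → ℝ)) = ⊥ by rw [this]; simp
  rw [eq_bot_iff]
  intro w hw
  simp only [Submodule.mem_iInf] at hw
  obtain ⟨t, rfl⟩ := h.exists_smul fun i hi => hw i (subset_tor_of_carrier_subset hF hi)
  have h1 : A.lin i (t • u) = 0 := hw i hi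
  rw [map_smul, smul_eq_mul] at h1
  rcases mul_eq_zero.1 h1 with rfl | h2
  · simp
  · exact absurd h2 h0

theorem IsLine.dim_eq_one (h : IsLine A M u) {F : A.TFace} (hF : F.carrier ⊆ M)
    (hv : ¬ F.IsVertex u) : F.dim = 1 := by
  rw [TFace.dim_eq, ← finrank_span_singleton (K := ℝ) h.ne_zero, ← h.flat_eq]
  have h1 : (⨅ i ∈ F.through, A.hyp i) = A.flat M := by
    apply le_antisymm
    · exact le_iInf₂ fun i hi => iInf₂_le i (subset_tor_of_carrier_subset hF hi)
    · refine le_iInf₂ fun i hi =>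
        iInf₂_le (f := fun i (_ : i ∈ {i | M ⊆ A.tor i}) => A.hyp i) i ?_
      refine h.subset_tor hF hi ?_
      by_contra h0
      exact hv ⟨i, hi, h0⟩
  rw [h1]

theorem IsLine.isVertex_iff (h : IsLine A M u) {F : A.TFace} (hF : F.carrier ⊆ M) :
    F.IsVertex u ↔ F.dim = 0 := by
  refine ⟨h.dim_eq_zero hF, fun h0 => ?_⟩
  by_contra hv
  have := h.dim_eq_one hF hv
  omega

theorem IsLine.not_isVertex_iff (h : IsLine A M u) {F : A.TFace} (hF : F.carrier ⊆ M) :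
    ¬ F.IsVertex u ↔ F.dim = 1 := by
  refine ⟨h.dim_eq_one hF, fun h0 hv => ?_⟩
  have := h.dim_eq_zero hF hv
  omega

/-- On a line, a face that is incident with an edge and does not lie below it is this edge. -/
theorem ofPoint_eq_of_not_isVertex {x : Fin d → ℝ} {t : ℝ}
    (hx : ¬ (toT (Face.ofPoint A.lifted x)).IsVertex u)
    (h : Face.ofPoint A.lifted x ≤ Face.ofPoint A.lifted (x + t • u)) :
    Face.ofPoint A.lifted x = Face.ofPoint A.lifted (x + t • u) := by
  ext1; funext p
  rcases Face.le_iff.1 h p with h0 | h0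
  · have h1 : p.1 ∈ (toT (Face.ofPoint A.lifted x)).through := mem_through_toT.2 ⟨p.2, h0⟩
    have h2 : A.lin p.1 u = 0 := by
      by_contra h3; exact hx ⟨_, h1, h3⟩
    rw [Face.ofPoint_sign, Face.ofPoint_sign, lifted_apply, lifted_apply, map_add, map_smul, h2,
      smul_zero, add_zero]
  · exact h0

/-- On a line, the faces strictly above another face are edges. -/
theorem not_isVertex_of_le {x : Fin d → ℝ} {t : ℝ} (ht : t ≠ 0)
    (h : Face.ofPoint A.lifted x ≤ Face.ofPoint A.lifted (x + t • u)) :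
    ¬ (toT (Face.ofPoint A.lifted (x + t • u))).IsVertex u := by
  rintro ⟨i, hi, h0⟩
  obtain ⟨k, hk⟩ := mem_through_toT.1 hi
  have h1 : (Face.ofPoint A.lifted x).sign (i, k) = 0 := by
    rcases Face.le_iff.1 h (i, k) with h' | h'
    · exact h'
    · rw [h', hk]
  rw [Face.ofPoint_sign, sign_eq_zero_iff, lifted_apply] at h1 hk
  rw [map_add, map_smul, smul_eq_mul] at hk
  have : t * A.lin i u = 0 := by linarith
  exact (mul_ne_zero ht h0) this

/-- Every vertex of the line is followed by an edge. -/
theorem IsLine.exists_edge (h : IsLine A M u) {P : A.TFace} (hP : P.carrier ⊆ M) :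
    ∃ (G : A.TFace) (m : P ⟶ G), G.carrier ⊆ M ∧ ¬ G.IsVertex u ∧ PointsTo u m := by
  obtain ⟨t, ht, hle⟩ := exists_pos_of_eventually (A.eventually_lifted_le P.rep.pt) u
  obtain ⟨m, hm⟩ := exists_hom_of_le' (toT_ofPoint_pt P) rfl hle
  refine ⟨_, m, h.carrier_subset (h.proj_add_smul_mem (proj_pt_mem hP) t),
    not_isVertex_of_le ht.ne' hle, fun i => ?_⟩
  rw [hm, add_sub_cancel_left, map_smul, smul_eq_mul, sign_mul, sign_pos ht, one_mul]

/-- The lifts of a face of a line above a given face lie on the line through this face. -/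
theorem IsLine.exists_eq_add_smul (h : IsLine A M u) {P G : A.TFace} (hG : G.carrier ⊆ M)
    (m : P ⟶ G) {q : Fin d → ℝ} (hq : q ∈ (m.1 +ᵥ G.rep).cell) :
    ∃ t : ℝ, q = P.rep.pt + t • u ∧
      ∀ i, (TFace.dir m).sign i = SignType.sign t * SignType.sign (A.lin i u) := by
  obtain ⟨t, ht⟩ := h.exists_smul (w := q - P.rep.pt) fun i hi => by
    obtain ⟨k, hk, hk'⟩ := TFace.exists_level m (subset_tor_of_carrier_subset hG hi)
    rw [map_sub, TFace.eq_level hk hq, TFace.eq_level hk' P.rep.pt_mem, sub_self]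
  refine ⟨t, by rw [← ht]; abel, fun i => ?_⟩
  rw [TFace.dir_sign m i P.rep.pt_mem hq, ht, map_smul, smul_eq_mul, sign_mul]

/-- A hypertorus transversal to `u` at the vertex detects the sign of `t`. -/
theorem PointsTo.pos {P G : A.TFace} {m : P ⟶ G} (hm : PointsTo u m) (hP : P.IsVertex u) {t : ℝ}
    (ht : ∀ i, (TFace.dir m).sign i = SignType.sign t * SignType.sign (A.lin i u)) : 0 < t := by
  obtain ⟨i, hi, h0⟩ := hP
  have h1 := ht ⟨i, hi⟩
  rw [hm] at h1
  have h2 : SignType.sign (A.lin i u) ≠ 0 := sign_ne_zero.2 h0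
  rw [← sign_eq_one_iff]
  revert h1 h2
  change SignType.sign (A.lin i u) = _ * SignType.sign (A.lin i u) → _
  generalize SignType.sign (A.lin i u) = a
  generalize SignType.sign t = b
  revert a b; decide

/-- Every arrow from a vertex to an edge of the line points forward or backward. -/
theorem IsLine.pointsTo_or (h : IsLine A M u) {P G : A.TFace} (hG : G.carrier ⊆ M)
    (hP : P.IsVertex u) (hG' : ¬ G.IsVertex u) (m : P ⟶ G) : PointsTo u m ∨ PointsTo (-u) m := by
  obtain ⟨t, -, ht⟩ := h.exists_eq_add_smul hG m (Face.pt_mem _)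
  rcases lt_trichotomy t 0 with h0 | rfl | h0
  · right; intro i
    rw [ht, sign_neg h0, map_neg, Left.sign_neg]; simp
  · obtain ⟨i, hi, h0⟩ := hP
    have h1 : i ∉ G.through := fun h' => hG' ⟨i, h', h0⟩
    exact absurd (by rw [ht]; simp) (TFace.dir_ne_zero m ⟨i, hi⟩ h1)
  · left; intro i
    rw [ht, sign_pos h0, one_mul]

/-- The edge that follows a vertex is unique. -/
theorem IsLine.edge_unique (h : IsLine A M u) {P G G' : A.TFace} (hP : P.IsVertex u)
    (hG : G.carrier ⊆ M) (hG' : G'.carrier ⊆ M) {m : P ⟶ G} {m' : P ⟶ G'} (hm : PointsTo u m)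
    (hm' : PointsTo u m') : (⟨G, m⟩ : Σ G, P ⟶ G) = ⟨G', m'⟩ := by
  -- On a ray from the vertex, the nearer point lies on the segment from the vertex to the farther
  -- one, hence in the cell of the farther one.
  have key : ∀ {G G' : A.TFace} {m : P ⟶ G} {m' : P ⟶ G'} {t t' : ℝ},
      P.rep.pt + t • u ∈ (m.1 +ᵥ G.rep).cell → P.rep.pt + t' • u ∈ (m'.1 +ᵥ G'.rep).cell →
      0 < t → t ≤ t' → m.1 +ᵥ G.rep = m'.1 +ᵥ G'.rep := by
    intro G G' m m' t t' hq hq' h0 hle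
    have h0' : 0 < t' := h0.trans_le hle
    have h1 := Face.lineMap_mem_cell m'.2 P.rep.pt_mem hq' (div_pos h0 h0')
      ((div_le_one h0').2 hle)
    rw [AffineMap.lineMap_apply, vsub_eq_sub, vadd_eq_add, add_sub_cancel_left, smul_smul,
      div_mul_cancel₀ _ h0'.ne', add_comm] at h1
    rw [← Face.ofPoint_eq hq, ← Face.ofPoint_eq h1]
  have heq : m.1 +ᵥ G.rep = m'.1 +ᵥ G'.rep := by
    have hq := (m.1 +ᵥ G.rep).pt_mem
    have hq' := (m'.1 +ᵥ G'.rep).pt_mem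
    obtain ⟨t, e, ht⟩ := h.exists_eq_add_smul hG m hq
    obtain ⟨t', e', ht'⟩ := h.exists_eq_add_smul hG' m' hq'
    rw [e] at hq
    rw [e'] at hq'
    rcases le_total t t' with hle | hle
    · exact key hq hq' (hm.pos hP ht) hle
    · exact (key hq' hq (hm'.pos hP ht') hle).symm
  have hGG : G = G' := by
    have := congrArg toT heq
    rwa [toT_vadd, toT_vadd, toT_rep, toT_rep] at this
  subst hGG
  have : m = m' := Subtype.ext (h.essential.vadd_injective heq)
  rw [this]

/-- Every edge of the line follows a vertex. -/
theorem IsLine.exists_vertex (h : IsLine A M u) {G : A.TFace} (hG : G.carrier ⊆ M)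
    (hG' : ¬ G.IsVertex u) :
    ∃ (P : A.TFace) (m : P ⟶ G), P.carrier ⊆ M ∧ P.IsVertex u ∧ PointsTo u m := by
  let q := G.rep.pt
  let x : ℝ → Fin d → ℝ := fun t => q + t • (-u)
  have hxG : ∀ t, x t ∈ G.rep.cell ↔ Face.ofPoint A.lifted (x t) = G.rep := fun t =>
    ⟨Face.ofPoint_eq, fun e => by rw [← e]; exact Face.mem_cell_ofPoint _ _⟩
  have hnear : ∀ t, ∀ᶠ s in 𝓝 t, Face.ofPoint A.lifted (x t) ≤ Face.ofPoint A.lifted (x s) := by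
    intro t
    have hc : Tendsto x (𝓝 t) (𝓝 (x t)) := by
      have : Continuous x := by fun_prop
      exact this.continuousAt
    exact hc.eventually (A.eventually_lifted_le (x t))
  have hshift : ∀ s t, x s = x t + (t - s) • u := fun s t => by
    simp only [x, smul_neg, sub_smul]; abel
  have hopen : IsOpen {t | x t ∈ G.rep.cell} := by
    rw [isOpen_iff_mem_nhds]
    intro t ht
    filter_upwards [hnear t] with s hs
    change x t ∈ G.rep.cell at ht
    rw [hxG] at ht
    rw [hxG]
    rw [hshift s t] at hs ⊢
    rw [← ofPoint_eq_of_not_isVertex (by rwa [ht, toT_rep]) hs, ht]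
  obtain ⟨i, hi⟩ := h.exists_lin_ne_zero
  -- Walking backwards from the edge, the first time outside its cell gives the vertex. The cell is
  -- open in the line, so `T` is closed.
  let T := {t | 0 ≤ t ∧ x t ∉ G.rep.cell}
  have hTclosed : IsClosed T := isClosed_Ici.inter hopen.isClosed_compl
  have hTne : T.Nonempty := by
    -- After this time the form `i` has changed by one, so its floor has changed and the cell has
    -- been left.
    refine ⟨1 / |A.lin i u|, by positivity, fun hmem => ?_⟩
    have h1 := floor_eq_of_mem_cell hmem G.rep.pt_mem i
    have h2 : A.lin i (x (1 / |A.lin i u|)) = A.lin i q - 1 / |A.lin i u| * A.lin i u := by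
      simp only [x, map_add, map_smul, map_neg, smul_eq_mul]; ring
    rw [h2] at h1
    rcases lt_or_gt_of_ne hi with h3 | h3
    · rw [abs_of_neg h3, show A.lin i q - 1 / -A.lin i u * A.lin i u - A.level i =
        (A.lin i q - A.level i) + 1 by field_simp; ring, Int.floor_add_one] at h1
      simp [q] at h1
    · rw [abs_of_pos h3, show A.lin i q - 1 / A.lin i u * A.lin i u - A.level i =
        (A.lin i q - A.level i) - 1 by field_simp; ring, Int.floor_sub_one] at h1
      simp [q] at h1
  have hTbdd : BddBelow T := ⟨0, fun t ht => ht.1⟩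
  let t₀ := sInf T
  have ht₀ : t₀ ∈ T := hTclosed.csInf_mem hTne hTbdd
  have hpos : 0 < t₀ := by
    refine lt_of_le_of_ne ht₀.1 fun e => ht₀.2 ?_
    rw [← e]; simpa [x] using G.rep.pt_mem
  have hbelow : ∀ t, 0 ≤ t → t < t₀ → x t ∈ G.rep.cell := fun t h0 hlt => by
    by_contra hn
    exact absurd (csInf_le hTbdd ⟨h0, hn⟩) (not_le.2 hlt)
  obtain ⟨s, hs, hs0, hst⟩ : ∃ s, Face.ofPoint A.lifted (x t₀) ≤ Face.ofPoint A.lifted (x s) ∧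
      0 ≤ s ∧ s < t₀ := by
    have h1 : ∀ᶠ s in 𝓝[<] t₀, Face.ofPoint A.lifted (x t₀) ≤ Face.ofPoint A.lifted (x s) :=
      nhdsWithin_le_nhds (hnear t₀)
    have h2 : ∀ᶠ s in 𝓝[<] t₀, 0 ≤ s := nhdsWithin_le_nhds (Ici_mem_nhds hpos)
    exact (h1.and (h2.and eventually_mem_nhdsWithin)).exists
  have hsG : Face.ofPoint A.lifted (x s) = G.rep := (hxG s).1 (hbelow s hs0 hst)
  have hq : Face.ofPoint A.lifted q = G.rep := Face.ofPoint_eq G.rep.pt_mem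
  have hle : Face.ofPoint A.lifted (x t₀) ≤ Face.ofPoint A.lifted q := by rwa [hq, ← hsG]
  obtain ⟨m, hm⟩ := exists_hom_of_le' rfl (toT_ofPoint_pt G) hle
  refine ⟨_, m, ?_, ?_, fun i => ?_⟩
  · exact h.carrier_subset (h.neg.proj_add_smul_mem (proj_pt_mem hG) t₀)
  -- If the limit point were on an edge, its face would equal the face of `q`, yet the cell has been
  -- left there.
  · by_contra hv
    have e : q = x t₀ + t₀ • u := by simp [x]
    have h1 := ofPoint_eq_of_not_isVertex (t := t₀) hv (by rwa [← e])
    rw [← e, hq, ← hxG] at h1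
    exact ht₀.2 h1
  · rw [hm, show G.rep.pt - x t₀ = t₀ • u by simp [x, q], map_smul, smul_eq_mul, sign_mul,
      sign_pos hpos, one_mul]

/-- The vertex that an edge follows is unique. -/
theorem IsLine.vertex_unique (h : IsLine A M u) {P P' G : A.TFace} (hP : P.IsVertex u)
    (hP' : P'.IsVertex u) (hG : G.carrier ⊆ M) (hG' : ¬ G.IsVertex u) {m : P ⟶ G} {m' : P' ⟶ G}
    (hm : PointsTo u m) (hm' : PointsTo u m') : P = P' := by
  have hlift : ∀ {P : A.TFace} (m : P ⟶ G), P.IsVertex u → PointsTo u m → ∃ t : ℝ, 0 < t ∧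
      toT (Face.ofPoint A.lifted (G.rep.pt - t • u)) = P ∧
      Face.ofPoint A.lifted (G.rep.pt - t • u) ≤ G.rep := by
    intro P m hP hm
    obtain ⟨t, e, ht⟩ := h.exists_eq_add_smul hG m (add_mem_vadd_cell A G.rep.pt_mem)
    have e1 : G.rep.pt - t • u = P.rep.pt + intVec (-m.1) := by
      have : intVec (-m.1) = -intVec m.1 := by funext j; simp [intVec]
      rw [this, ← sub_eq_add_neg, eq_sub_iff_add_eq, sub_add_eq_add_sub, e]; abel
    have e2 : Face.ofPoint A.lifted (G.rep.pt - t • u) = -m.1 +ᵥ P.rep := by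
      rw [e1, ofPoint_add_intVec, Face.ofPoint_eq P.rep.pt_mem]
    refine ⟨t, hm.pos hP ht, by rw [e2, toT_vadd, toT_rep], ?_⟩
    have h1 := vadd_mono A (-m.1) m.2
    rw [neg_vadd_vadd] at h1
    rwa [e2]
  -- Of two vertices behind the same point of the edge, the nearer would lie strictly between the
  -- farther and that point, hence in the edge.
  have key : ∀ {t t' : ℝ}, Face.ofPoint A.lifted (G.rep.pt - t' • u) ≤ G.rep → 0 < t → t < t' →
      (toT (Face.ofPoint A.lifted (G.rep.pt - t • u))).IsVertex u → False := by
    intro t t' hle h0 hlt hv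
    have h0' : 0 < t' := h0.trans hlt
    have h1 := Face.lineMap_mem_cell hle (Face.mem_cell_ofPoint _ _) G.rep.pt_mem
      (t := (t' - t) / t') (div_pos (sub_pos.2 hlt) h0') ((div_le_one h0').2 (by linarith))
    rw [AffineMap.lineMap_apply, vsub_eq_sub, vadd_eq_add, sub_sub_cancel, smul_smul,
      div_mul_cancel₀ _ h0'.ne', show (t' - t) • u + (G.rep.pt - t' • u) = G.rep.pt - t • u by
        rw [sub_smul]; abel] at h1
    rw [Face.ofPoint_eq h1, toT_rep] at hv
    exact hG' hv
  obtain ⟨t, h0, e, hle⟩ := hlift m hP hm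
  obtain ⟨t', h0', e', hle'⟩ := hlift m' hP' hm'
  rcases lt_trichotomy t t' with hlt | rfl | hlt
  · exact (key hle' h0 hlt (by rwa [e])).elim
  · rw [← e, e']
  · exact (key hle h0' hlt (by rwa [e'])).elim

/-- A function on the vertices of a line that takes the same value at both ends of every edge is
constant. -/
theorem IsLine.eq_of_forall_edge (h : IsLine A M u) (c : A.TFace → ℤ)
    (hc : ∀ (P P' G : A.TFace) (m : P ⟶ G) (m' : P' ⟶ G), P.carrier ⊆ M → P'.carrier ⊆ M →
      G.carrier ⊆ M → P.IsVertex u → P'.IsVertex u → ¬ G.IsVertex u → PointsTo u m →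
      PointsTo (-u) m' → c P = c P')
    {P P' : A.TFace} (hP : P.carrier ⊆ M) (hP' : P'.carrier ⊆ M) (hv : P.IsVertex u)
    (hv' : P'.IsVertex u) : c P = c P' := by
  -- This extends `c` to edges as the common value at the incident vertices; it is then locally
  -- constant along the line.
  let Val : A.TFace → ℤ → Prop := fun F a => (F.IsVertex u → c F = a) ∧
    (¬ F.IsVertex u → ∀ (Q : A.TFace) (_ : Q ⟶ F), Q.carrier ⊆ M → Q.IsVertex u → c Q = a)
  have hstep : ∀ {x : Fin d → ℝ} {t : ℝ}, proj x ∈ M →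
      Face.ofPoint A.lifted x ≤ Face.ofPoint A.lifted (x + t • u) → ∀ a,
      Val (toT (Face.ofPoint A.lifted x)) a ↔ Val (toT (Face.ofPoint A.lifted (x + t • u))) a := by
    intro x t hx hle a
    by_cases hxv : (toT (Face.ofPoint A.lifted x)).IsVertex u
    · by_cases ht : t = 0
      · subst ht; simp
      have hy := not_isVertex_of_le ht hle
      obtain ⟨m, -⟩ := exists_hom_of_le hle
      have hxM := h.carrier_subset hx
      have hyM := h.carrier_subset (h.proj_add_smul_mem hx t)
      constructor
      · rintro ⟨h1, -⟩
        refine ⟨fun h' => absurd h' hy, fun _ Q m' hQ hQv => ?_⟩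
        rw [← h1 hxv]
        rcases h.pointsTo_or hyM hxv hy m with hm | hm <;>
          rcases h.pointsTo_or hyM hQv hy m' with hm' | hm'
        · rw [h.vertex_unique hQv hxv hyM hy hm' hm]
        · exact (hc _ _ _ m m' hxM hQ hyM hxv hQv hy hm hm').symm
        · exact hc _ _ _ m' m hQ hxM hyM hQv hxv hy hm' hm
        · rw [h.neg.vertex_unique (TFace.isVertex_neg.2 hQv) (TFace.isVertex_neg.2 hxv) hyM
            (fun h' => hy (TFace.isVertex_neg.1 h')) hm' hm]
      · rintro ⟨-, h1⟩
        exact ⟨fun _ => h1 hy _ m hxM hxv, fun h' => absurd hxv h'⟩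
    · rw [ofPoint_eq_of_not_isVertex hxv hle]
  obtain ⟨t, v, e⟩ := (h.proj_mem_iff (proj_pt_mem hP)).1 (proj_pt_mem hP')
  have hP't : toT (Face.ofPoint A.lifted (P.rep.pt + t • u)) = P' := by
    rw [← toT_vadd v, ← ofPoint_add_intVec, ← e, toT_ofPoint_pt]
  have hconn := (isPreconnected_univ (α := ℝ)).induction₂
    (fun s t => ∀ a, Val (toT (Face.ofPoint A.lifted (P.rep.pt + s • u))) a ↔
      Val (toT (Face.ofPoint A.lifted (P.rep.pt + t • u))) a)
    (fun s _ => by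
      have hcont : Tendsto (fun t : ℝ => P.rep.pt + t • u) (𝓝 s) (𝓝 (P.rep.pt + s • u)) := by
        have : Continuous fun t : ℝ => P.rep.pt + t • u := by fun_prop
        exact this.continuousAt
      rw [nhdsWithin_univ]
      filter_upwards [hcont.eventually (A.eventually_lifted_le _)] with t ht
      have e : P.rep.pt + t • u = P.rep.pt + s • u + (t - s) • u := by rw [sub_smul]; abel
      rw [e] at ht ⊢
      exact hstep (h.proj_add_smul_mem (proj_pt_mem hP) s) ht)
    (fun x y z _ _ _ h1 h2 a => (h1 a).trans (h2 a)) (fun x y _ _ h1 a => (h1 a).symm)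
    (Set.mem_univ 0) (Set.mem_univ t) (c P)
  rw [zero_smul, add_zero, toT_ofPoint_pt, hP't] at hconn
  exact ((hconn.1 ⟨fun _ => rfl, fun h' => absurd hv h'⟩).1 hv').symm

end ToricArrangement

/-! ### The arrows of the closed path -/

namespace ToricArrangement

variable {d : ℕ} {ι : Type} {A : ToricArrangement d ι}
  {M : Set (Fin d → UnitAddCircle)} {u : Fin d → ℝ} [Finite ι]

theorem obj_injective {F : A.TFace} {x y : SalPoset F.loc} (h : obj F x = obj F y) : x = y :=
  eq_of_heq (Grothendieck.mk.inj h).2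

theorem eq_of_obj_eq {F G : A.TFace} {x : SalPoset F.loc} {y : SalPoset G.loc}
    (h : obj F x = obj G y) : F = G :=
  Opposite.op_injective (congrArg Grothendieck.base h)

theorem vertex_injective {F : A.TFace} {C D : Chamber F.loc}
    (h : SalPoset.vertex C = SalPoset.vertex D) : C = D := congrArg SalPoset.chamber h

/-- Distinct elements `[C, C]` are incomparable, so an arrow coming from an edge determines the
vertex `v_i` at its end. -/
theorem eq_of_vertex_le {F : A.TFace} {C D : Chamber F.loc}
    (h : SalPoset.vertex C ≤ SalPoset.vertex D) : C = D := by
  have h1 : D.1 ≤ C.1 := h.1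
  refine Subtype.ext (Face.ext (funext fun i => ?_))
  exact ((Face.le_iff.1 h1 i).resolve_left (D.2 i)).symm

namespace IsLine

variable (h : IsLine A M u)
include h

/-- The edge that follows a vertex in the direction `u`. -/
noncomputable def next {P : A.TFace} (hP : P.carrier ⊆ M) : A.TFace := (h.exists_edge hP).choose

/-- The arrow from a vertex to the edge that follows it. -/
noncomputable def arrow {P : A.TFace} (hP : P.carrier ⊆ M) : P ⟶ h.next hP :=
  (h.exists_edge hP).choose_spec.choose

theorem next_subset {P : A.TFace} (hP : P.carrier ⊆ M) : (h.next hP).carrier ⊆ M :=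
  (h.exists_edge hP).choose_spec.choose_spec.1

theorem next_not_isVertex {P : A.TFace} (hP : P.carrier ⊆ M) : ¬ (h.next hP).IsVertex u :=
  (h.exists_edge hP).choose_spec.choose_spec.2.1

theorem arrow_pointsTo {P : A.TFace} (hP : P.carrier ⊆ M) : PointsTo u (h.arrow hP) :=
  (h.exists_edge hP).choose_spec.choose_spec.2.2

end IsLine

/-- The vertices of a line. -/
abbrev Vtx (A : ToricArrangement d ι) (M : Set (Fin d → UnitAddCircle)) (u : Fin d → ℝ) : Type :=
  {P : A.TFace // P.carrier ⊆ M ∧ P.IsVertex u}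

/-- The edges of a line. -/
abbrev Edg (A : ToricArrangement d ι) (M : Set (Fin d → UnitAddCircle)) (u : Fin d → ℝ) : Type :=
  {P : A.TFace // P.carrier ⊆ M ∧ ¬ P.IsVertex u}

noncomputable instance : Fintype (Vtx A M u) := Fintype.ofFinite _

noncomputable instance : Fintype (Edg A M u) := Fintype.ofFinite _

/-- Each edge of a line follows exactly one vertex. -/
theorem IsLine.sum_next (h : IsLine A M u) {u' : Fin d → ℝ}
    (hu : ∀ F : A.TFace, F.IsVertex u' ↔ F.IsVertex u) {X : Type*} [AddCommMonoid X]
    (f : A.TFace → X) :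
    ∑ P : Vtx A M u', f (h.next P.2.1) = ∑ G : Edg A M u', f G.1 := by
  -- Vertices are taken with respect to `u'`, edges followed in direction `u`; taking opposite
  -- vectors also covers the preceding edges.
  let N : Vtx A M u' → Edg A M u' := fun P =>
    ⟨h.next P.2.1, h.next_subset P.2.1, fun h' => h.next_not_isVertex P.2.1 ((hu _).1 h')⟩
  have hN : Function.Bijective N := by
    constructor
    · intro P P' e
      have e1 : h.next P.2.1 = h.next P'.2.1 := congrArg Subtype.val e
      have h1 := h.arrow_pointsTo P.2.1
      have h2 := h.arrow_pointsTo P'.2.1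
      have key : ∀ {G : A.TFace} (m : P'.1 ⟶ G), PointsTo u m → h.next P.2.1 = G → P = P' := by
        intro G m hm hG
        subst hG
        exact Subtype.ext (h.vertex_unique ((hu _).1 P.2.2) ((hu _).1 P'.2.2)
          (h.next_subset P.2.1) (h.next_not_isVertex P.2.1) h1 hm)
      exact key _ h2 e1
    · rintro ⟨G, hG, hG'⟩
      have hG'' : ¬ G.IsVertex u := fun h' => hG' ((hu _).2 h')
      obtain ⟨P, m, hP, hPv, hm⟩ := h.exists_vertex hG hG''
      refine ⟨⟨P, hP, (hu _).2 hPv⟩, Subtype.ext ?_⟩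
      exact congrArg Sigma.fst (h.edge_unique hPv (h.next_subset hP) hG (h.arrow_pointsTo hP) hm)
  exact hN.sum_comp (fun G => f G.1)

variable {n : ℕ} {g : Gallery A.central n}

/-- A minimal gallery from a chamber adjacent to the line `M` to the opposite chamber. -/
structure IsGalleryAlong (M : Set (Fin d → UnitAddCircle)) (u : Fin d → ℝ)
    (g : Gallery A.central n) : Prop extends IsLine A M u where
  minimal : g.IsMinimal
  start : ∀ i, A.lin i u ≠ 0 → (g.chamber 0).1.sign i = SignType.sign (A.lin i u)
  separates_iff : ∀ i, Separates i (g.chamber 0) (g.chamber (Fin.last n)) ↔ A.lin i u ≠ 0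

theorem seen_iff {F : A.TFace} {i : Fin n} : Seen g F i ↔ ∃ k ∈ F.through, g.Crosses i k := by
  constructor
  · intro h
    by_contra! h'
    apply h
    refine Subtype.ext (Face.ext (funext fun k => ?_))
    exact not_not.1 (h' k.1 k.2)
  · rintro ⟨k, hk, hc⟩ h
    exact hc (congrArg (fun C : Chamber F.loc => C.1.sign ⟨k, hk⟩) h)

namespace IsGalleryAlong

variable (S : IsGalleryAlong M u g)
include S

theorem sign_last {i : ι} (hi : A.lin i u ≠ 0) :
    (g.chamber (Fin.last n)).1.sign i = SignType.sign (A.lin i (-u)) := by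
  have h1 := (S.separates_iff i).2 hi
  rw [Separates, S.start i hi] at h1
  have h2 := (g.chamber (Fin.last n)).2 i
  have h3 : SignType.sign (A.lin i u) ≠ 0 := sign_ne_zero.2 hi
  rw [map_neg, Left.sign_neg]
  revert h1 h2 h3
  generalize SignType.sign (A.lin i u) = a
  generalize (g.chamber (Fin.last n)).1.sign i = b
  revert a b; decide

theorem sign_last_of_eq_zero {i : ι} (hi : A.lin i u = 0) :
    (g.chamber (Fin.last n)).1.sign i = (g.chamber 0).1.sign i := by
  by_contra h
  exact (S.separates_iff i).1 (Ne.symm h) hi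

theorem lin_ne_zero_of_crosses {i : Fin n} {k : ι} (h : g.Crosses i k) : A.lin k u ≠ 0 :=
  (S.separates_iff k).1 (S.minimal.separates h)

theorem exists_crosses {k : ι} (h : A.lin k u ≠ 0) : ∃ i, g.Crosses i k := by
  obtain ⟨i, -, -, hi⟩ := Gallery.exists_crosses (g := g) (k := k) (Nat.zero_le n)
    (Nat.lt_succ_self n) ((S.separates_iff k).2 h)
  exact ⟨i, hi⟩

theorem isVertex_of_seen {F : A.TFace} {i : Fin n} (h : Seen g F i) : F.IsVertex u := by
  obtain ⟨k, hk, hc⟩ := seen_iff.1 h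
  exact ⟨k, hk, S.lin_ne_zero_of_crosses hc⟩

theorem lin_ne_zero_of_notMem {P G : A.TFace} (hP : P.carrier ⊆ M) (hG : G.carrier ⊆ M) {i : ι}
    (hi : i ∈ P.through) (hi' : i ∉ G.through) : A.lin i u ≠ 0 := fun h0 =>
  hi' (subset_tor_of_carrier_subset hG (S.subset_tor hP hi h0))

theorem lin_eq_zero_of_mem {G : A.TFace} (hG' : ¬ G.IsVertex u) {i : ι}
    (hi : i ∈ G.through) : A.lin i u = 0 := by
  by_contra h0; exact hG' ⟨i, hi, h0⟩

/-- On hypertori not containing the edge, `i_m` takes the signs of `u`, which are those of the first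
chamber. -/
theorem salMap_v_of_pointsTo {P G : A.TFace} (hP : P.carrier ⊆ M) (hG : G.carrier ⊆ M)
    {m : P ⟶ G} (hm : PointsTo u m) : TFace.salMap m (v g G 0) = v g P 0 := by
  change SalPoset.vertex (TFace.inclC m (G.resC (g.chamber 0))) =
    SalPoset.vertex (P.resC (g.chamber 0))
  refine congrArg SalPoset.vertex (Subtype.ext (Face.ext (funext fun i => ?_)))
  by_cases hi : (i : ι) ∈ G.through
  · exact TFace.incl_sign_of_mem m _ i hi
  · exact (TFace.incl_sign_of_notMem m _ i hi).trans ((hm i).trans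
      (S.start i (S.lin_ne_zero_of_notMem hP hG i.2 hi)).symm)

/-- Transversal signs become those of `-u`; on the hyperplanes along `M` the first and last chambers
agree. -/
theorem salMap_v_of_pointsTo_neg {P G : A.TFace} (hP : P.carrier ⊆ M) (hG : G.carrier ⊆ M)
    (hG' : ¬ G.IsVertex u) {m : P ⟶ G} (hm : PointsTo (-u) m) :
    TFace.salMap m (v g G 0) = v g P (Fin.last n) := by
  change SalPoset.vertex (TFace.inclC m (G.resC (g.chamber 0))) =
    SalPoset.vertex (P.resC (g.chamber (Fin.last n)))
  refine congrArg SalPoset.vertex (Subtype.ext (Face.ext (funext fun i => ?_)))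
  by_cases hi : (i : ι) ∈ G.through
  · exact (TFace.incl_sign_of_mem m _ i hi).trans
      (S.sign_last_of_eq_zero (S.lin_eq_zero_of_mem hG' hi)).symm
  · exact (TFace.incl_sign_of_notMem m _ i hi).trans ((hm i).trans
      (S.sign_last (S.lin_ne_zero_of_notMem hP hG i.2 hi)).symm)

theorem prev_not_isVertex {P : A.TFace} (hP : P.carrier ⊆ M) : ¬ (S.neg.next hP).IsVertex u :=
  fun h => S.neg.next_not_isVertex hP (TFace.isVertex_neg.2 h)

/-- The arrow of `Λ` into a vertex from the edge that follows it. -/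
noncomputable def up (P : Vtx A M u) : Arr A.SalCat :=
  arrOver (S.arrow P.2.1) (v g _ 0) (v g P.1 0)
    (S.salMap_v_of_pointsTo P.2.1 (S.next_subset P.2.1) (S.arrow_pointsTo P.2.1)).le

/-- The arrow of `Λ` into a vertex from the edge that precedes it. -/
noncomputable def down (P : Vtx A M u) : Arr A.SalCat :=
  arrOver (S.neg.arrow P.2.1) (v g _ 0) (v g P.1 (Fin.last n))
    (S.salMap_v_of_pointsTo_neg P.2.1 (S.neg.next_subset P.2.1) (S.prev_not_isVertex P.2.1)
      (S.neg.arrow_pointsTo P.2.1)).le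

/-- The definition of the path allows any arrow, edge and index here. The edge and the arrow are
unique, and incomparability forces the target to be `v_0`. -/
theorem arrOver_eq_up {P G : A.TFace} (hP : P.carrier ⊆ M) (hPv : P.IsVertex u)
    (hG : G.carrier ⊆ M) {m : P ⟶ G} (hm : PointsTo u m)
    {i : Fin (n + 1)} (h : TFace.salMap m (v g G 0) ≤ v g P i) :
    arrOver m (v g G 0) (v g P i) h = S.up ⟨P, hP, hPv⟩ := by
  have key : ∀ {G' : A.TFace} (m' : P ⟶ G') (h' : TFace.salMap m' (v g G' 0) ≤ v g P 0),
      (⟨G, m⟩ : Σ G, P ⟶ G) = ⟨G', m'⟩ →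
      arrOver m (v g G 0) (v g P i) h = arrOver m' (v g G' 0) (v g P 0) h' := by
    intro G' m' h' e
    cases e
    have e1 : v g P i = v g P 0 := by
      have h1 := S.salMap_v_of_pointsTo hP hG hm
      rw [h1] at h
      exact (congrArg SalPoset.vertex (eq_of_vertex_le h)).symm
    generalize v g P i = x at h e1
    subst e1; rfl
  exact key _ _ (S.edge_unique hPv hG (S.next_subset hP) hm (S.arrow_pointsTo hP))

theorem arrOver_eq_down {P G : A.TFace} (hP : P.carrier ⊆ M) (hPv : P.IsVertex u)
    (hG : G.carrier ⊆ M) (hG' : ¬ G.IsVertex u) {m : P ⟶ G} (hm : PointsTo (-u) m)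
    {i : Fin (n + 1)} (h : TFace.salMap m (v g G 0) ≤ v g P i) :
    arrOver m (v g G 0) (v g P i) h = S.down ⟨P, hP, hPv⟩ := by
  have key : ∀ {G' : A.TFace} (m' : P ⟶ G') (h' : TFace.salMap m' (v g G' 0) ≤ v g P (Fin.last n)),
      (⟨G, m⟩ : Σ G, P ⟶ G) = ⟨G', m'⟩ →
      arrOver m (v g G 0) (v g P i) h = arrOver m' (v g G' 0) (v g P (Fin.last n)) h' := by
    intro G' m' h' e
    cases e
    have e1 : v g P i = v g P (Fin.last n) := by
      have h1 := S.salMap_v_of_pointsTo_neg hP hG hG' hm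
      rw [h1] at h
      exact (congrArg SalPoset.vertex (eq_of_vertex_le h)).symm
    generalize v g P i = x at h e1
    subst e1; rfl
  exact key _ _ (S.neg.edge_unique (TFace.isVertex_neg.2 hPv) hG (S.neg.next_subset hP) hm
    (S.neg.arrow_pointsTo hP))

/-- The arrows of the closed path `Λ`. -/
theorem mem_lambdaArrows_iff {B : Chamber A.central} {a : Arr A.SalCat} :
    a ∈ lambdaArrows g M B ↔
      (∃ (P : Vtx A M u) (i : Fin n), Seen g P.1 i ∧ (a = leftArr g B P.1 i ∨ a = rightArr g B P.1 i))
      ∨ ∃ P : Vtx A M u, a = S.up P ∨ a = S.down P := by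
  constructor
  · rintro (⟨F, hF, i, hs, ha⟩ | ⟨P, G, m, hP, hG, hPd, hGd, i, hle, rfl⟩)
    · exact Or.inl ⟨⟨F, hF, S.isVertex_of_seen hs⟩, i, hs, ha⟩
    · have hPv := (S.isVertex_iff hP).2 hPd
      have hGv := (S.not_isVertex_iff hG).2 hGd
      right
      refine ⟨⟨P, hP, hPv⟩, ?_⟩
      rcases S.pointsTo_or hG hPv hGv m with hm | hm
      · exact Or.inl (S.arrOver_eq_up hP hPv hG hm hle)
      · exact Or.inr (S.arrOver_eq_down hP hPv hG hGv hm hle)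
  · rintro (⟨P, i, hs, ha⟩ | ⟨P, rfl | rfl⟩)
    · exact Or.inl ⟨P.1, P.2.1, i, hs, ha⟩
    · exact Or.inr ⟨P.1, _, S.arrow P.2.1, P.2.1, S.next_subset P.2.1, S.dim_eq_zero P.2.1 P.2.2,
        S.dim_eq_one (S.next_subset P.2.1) (S.next_not_isVertex P.2.1), 0, _, rfl⟩
    · exact Or.inr ⟨P.1, _, S.neg.arrow P.2.1, P.2.1, S.neg.next_subset P.2.1,
        S.dim_eq_zero P.2.1 P.2.2,
        S.dim_eq_one (S.neg.next_subset P.2.1) (S.prev_not_isVertex P.2.1), Fin.last n, _, rfl⟩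

theorem up_injective : Function.Injective S.up := fun _ _ h =>
  Subtype.ext (eq_of_obj_eq (congrArg (fun a : Arr A.SalCat => a.2.1) h))

theorem next_ne (P P' : Vtx A M u) : S.next P.2.1 ≠ P'.1 := fun h =>
  S.next_not_isVertex P.2.1 (h ▸ P'.2.2)

theorem prev_ne (P P' : Vtx A M u) : S.neg.next P.2.1 ≠ P'.1 := fun h =>
  S.prev_not_isVertex P.2.1 (h ▸ P'.2.2)

theorem v_zero_ne_v_last (P : Vtx A M u) : v g P.1 0 ≠ v g P.1 (Fin.last n) := by
  intro h
  obtain ⟨i, hi, h0⟩ := P.2.2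
  exact (S.separates_iff i).2 h0
    (congrArg (fun C : Chamber P.1.loc => C.1.sign ⟨i, hi⟩) (vertex_injective h))

theorem up_ne_down (P P' : Vtx A M u) : S.up P ≠ S.down P' := by
  intro h
  have h1 : obj P.1 (v g _ 0) = obj P'.1 (v g _ (Fin.last n)) :=
    congrArg (fun a : Arr A.SalCat => a.2.1) h
  obtain rfl := Subtype.ext (eq_of_obj_eq h1)
  exact S.v_zero_ne_v_last P (obj_injective h1)

theorem leftArr_ne_up (B : Chamber A.central) (P P' : Vtx A M u) (i : Fin n) :
    leftArr g B P.1 i ≠ S.up P' := fun h =>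
  S.next_ne P' P (eq_of_obj_eq (congrArg (fun a : Arr A.SalCat => a.1) h)).symm

theorem rightArr_ne_up (B : Chamber A.central) (P P' : Vtx A M u) (i : Fin n) :
    rightArr g B P.1 i ≠ S.up P' := fun h =>
  S.next_ne P' P (eq_of_obj_eq (congrArg (fun a : Arr A.SalCat => a.1) h)).symm

theorem rightArr_ne_down (B : Chamber A.central) (P P' : Vtx A M u) (i : Fin n) :
    rightArr g B P.1 i ≠ S.down P' := fun h =>
  S.prev_ne P' P (eq_of_obj_eq (congrArg (fun a : Arr A.SalCat => a.1) h)).symm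

end IsGalleryAlong

/-! ### Coefficients of a cycle on the closed path -/

section Cochains

open Classical in
/-- The indicator of the elements over `P` whose face lies on a given side of `H`. -/
noncomputable def sideInd (P : A.TFace) (H : P.through) (s : SignType) (X : A.SalCat) : ℤ :=
  if ∃ x : SalPoset P.loc, X = obj P x ∧ x.face.sign H = s then 1 else 0

theorem sideInd_obj {P : A.TFace} {H : P.through} {s : SignType} {x : SalPoset P.loc} :
    sideInd P H s (obj P x) = if x.face.sign H = s then 1 else 0 := by
  by_cases h : x.face.sign H = s
  · rw [if_pos h]
    exact if_pos ⟨x, rfl, h⟩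
  · rw [if_neg h]
    exact if_neg fun ⟨y, e, h'⟩ => h (by rwa [obj_injective e])

theorem sideInd_of_ne {P F : A.TFace} (hF : F ≠ P) {H : P.through} {s : SignType}
    {x : SalPoset F.loc} : sideInd P H s (obj F x) = 0 :=
  if_neg fun ⟨_, e, _⟩ => hF (eq_of_obj_eq e)

open Classical in
/-- The indicator of the elements over `P`. -/
noncomputable def baseInd (P : A.TFace) (X : A.SalCat) : ℤ :=
  if X.base = Opposite.op P then 1 else 0

theorem baseInd_obj {P : A.TFace} {x : SalPoset P.loc} : baseInd P (obj P x) = 1 := if_pos rfl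

theorem baseInd_of_ne {P F : A.TFace} (hF : F ≠ P) {x : SalPoset F.loc} :
    baseInd P (obj F x) = 0 := if_neg fun e => hF (Opposite.op_injective e)

end Cochains

namespace IsGalleryAlong

variable (S : IsGalleryAlong M u g) {B : Chamber A.central} {w : Arr A.SalCat →₀ ℤ}
include S

theorem sign_wall_eq_left {i : Fin n} {k : ι} (h : ¬ g.Crosses i k) :
    (g.wall i).sign k = (g.chamber i.castSucc).1.sign k :=
  (Face.le_iff.1 (g.wall_left i).1 k).resolve_left fun h0 =>
    h (S.minimal.crosses_of_sign_wall h0)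

theorem sign_wall_eq_right {i : Fin n} {k : ι} (h : ¬ g.Crosses i k) :
    (g.wall i).sign k = (g.chamber i.succ).1.sign k :=
  (Face.le_iff.1 (g.wall_right i).1 k).resolve_left fun h0 =>
    h (S.minimal.crosses_of_sign_wall h0)

/-- The coefficient of a first half-edge agrees with that of the arrow from the next edge. -/
theorem coeff_left (hw : w ∈ Cycles A.SalCat) (hs : ↑w.support ⊆ lambdaArrows g M B)
    (P : Vtx A M u) {i : Fin n} (hi : Seen g P.1 i) : w (leftArr g B P.1 i) = w (S.up P) := by
  obtain ⟨k, hk, hc⟩ := seen_iff.1 hi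
  -- Over `P` this is `1` up to `v_i` and `0` from `e_i` on. It jumps only on `v_i → e_i` and on the
  -- arrow entering `v_0`.
  let φ := sideInd P.1 ⟨k, hk⟩ ((g.chamber 0).1.sign k)
  have hobj : ∀ x, φ (obj P.1 x) = _ := fun x => sideInd_obj
  have hne : ∀ {F : A.TFace} (_ : F ≠ P.1) (x), φ (obj F x) = 0 := fun hF x => sideInd_of_ne hF
  have hsep : (g.chamber 0).1.sign k ≠ (g.chamber (Fin.last n)).1.sign k := S.minimal.separates hc
  have h0 : (0 : SignType) ≠ (g.chamber 0).1.sign k := ((g.chamber 0).2 k).symm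
  have hrel := coeff_relation hw φ (S.leftArr_ne_up B P P i) (fun c hcw hc1 hc2 => by
    rcases S.mem_lambdaArrows_iff.1 (hs (Finsupp.mem_support_iff.2 hcw)) with
      ⟨F, j, -, rfl | rfl⟩ | ⟨F, rfl | rfl⟩
    · change φ (obj F.1 _) = φ (obj F.1 _)
      by_cases hF : F = P
      · subst hF
        have hcj : ¬ g.Crosses j k := fun h => hc1 (by rw [S.minimal.crosses_unique h hc])
        rw [hobj, hobj]
        exact if_congr (by rw [show (e g B F.1 j).face.sign ⟨k, hk⟩ = _ from
          S.sign_wall_eq_left hcj]; rfl) rfl rfl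
      · rw [hne fun h => hF (Subtype.ext h), hne fun h => hF (Subtype.ext h)]
    · change φ (obj F.1 _) = φ (obj F.1 _)
      by_cases hF : F = P
      · subst hF
        rw [hobj, hobj]
        by_cases hcj : g.Crosses j k
        · obtain rfl := S.minimal.crosses_unique hcj hc
          rw [if_neg, if_neg]
          · change (g.chamber j.succ).1.sign k ≠ _
            rw [S.minimal.sign_of_lt hcj le_rfl]; exact hsep.symm
          · change (g.wall j).sign k ≠ _
            rw [hcj.sign_wall]; exact h0
        · exact if_congr (by rw [show (e g B F.1 j).face.sign ⟨k, hk⟩ = _ from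
            S.sign_wall_eq_right hcj]; rfl) rfl rfl
      · rw [hne fun h => hF (Subtype.ext h), hne fun h => hF (Subtype.ext h)]
    · have hF : F.1 ≠ P.1 := fun h => hc2 (by rw [Subtype.ext h])
      change φ (obj F.1 (v g F.1 0)) = φ (obj (S.next F.2.1) (v g _ 0))
      rw [hne hF, hne (S.next_ne F P)]
    · change φ (obj F.1 (v g F.1 (Fin.last n))) = φ (obj (S.neg.next F.2.1) (v g _ 0))
      rw [hne (S.prev_ne F P)]
      by_cases hF : F = P
      · subst hF
        rw [hobj]
        exact if_neg hsep.symm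
      · rw [hne fun h => hF (Subtype.ext h)])
  have e1 : φ (leftArr g B P.1 i).2.1 = 0 := by
    change φ (obj P.1 _) = 0
    rw [hobj]
    refine if_neg ?_
    change (g.wall i).sign k ≠ _
    rw [hc.sign_wall]; exact h0
  have e2 : φ (leftArr g B P.1 i).1 = 1 := by
    change φ (obj P.1 _) = 1
    rw [hobj]
    exact if_pos (S.minimal.sign_of_le hc le_rfl)
  have e3 : φ (S.up P).2.1 = 1 := by
    exact (hobj _).trans (if_pos rfl)
  have e4 : φ (S.up P).1 = 0 := hne (S.next_ne P P) _
  rw [e1, e2, e3, e4] at hrel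
  linarith

/-- The coefficient of a second half-edge agrees with that of the arrow from the previous edge. -/
theorem coeff_right (hw : w ∈ Cycles A.SalCat) (hs : ↑w.support ⊆ lambdaArrows g M B)
    (P : Vtx A M u) {i : Fin n} (hi : Seen g P.1 i) : w (rightArr g B P.1 i) = w (S.down P) := by
  obtain ⟨k, hk, hc⟩ := seen_iff.1 hi
  -- Over `P` this is `0` up to `e_i` and `1` afterwards. It jumps only on `v_{i+1} → e_i` and on
  -- the arrow entering the last vertex.
  let φ := sideInd P.1 ⟨k, hk⟩ ((g.chamber (Fin.last n)).1.sign k)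
  have hobj : ∀ x, φ (obj P.1 x) = _ := fun x => sideInd_obj
  have hne : ∀ {F : A.TFace} (_ : F ≠ P.1) (x), φ (obj F x) = 0 := fun hF x => sideInd_of_ne hF
  have hsep : (g.chamber 0).1.sign k ≠ (g.chamber (Fin.last n)).1.sign k := S.minimal.separates hc
  have h0 : (0 : SignType) ≠ (g.chamber (Fin.last n)).1.sign k :=
    ((g.chamber (Fin.last n)).2 k).symm
  have hrel := coeff_relation hw φ (S.rightArr_ne_down B P P i) (fun c hcw hc1 hc2 => by
    rcases S.mem_lambdaArrows_iff.1 (hs (Finsupp.mem_support_iff.2 hcw)) with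
      ⟨F, j, -, rfl | rfl⟩ | ⟨F, rfl | rfl⟩
    · change φ (obj F.1 _) = φ (obj F.1 _)
      by_cases hF : F = P
      · subst hF
        rw [hobj, hobj]
        by_cases hcj : g.Crosses j k
        · obtain rfl := S.minimal.crosses_unique hcj hc
          rw [if_neg, if_neg]
          · change (g.chamber j.castSucc).1.sign k ≠ _
            rw [S.minimal.sign_of_le hcj le_rfl]; exact hsep
          · change (g.wall j).sign k ≠ _
            rw [hcj.sign_wall]; exact h0
        · exact if_congr (by rw [show (e g B F.1 j).face.sign ⟨k, hk⟩ = _ from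
            S.sign_wall_eq_left hcj]; rfl) rfl rfl
      · rw [hne fun h => hF (Subtype.ext h), hne fun h => hF (Subtype.ext h)]
    · change φ (obj F.1 _) = φ (obj F.1 _)
      by_cases hF : F = P
      · subst hF
        have hcj : ¬ g.Crosses j k := fun h => hc1 (by rw [S.minimal.crosses_unique h hc])
        rw [hobj, hobj]
        exact if_congr (by rw [show (e g B F.1 j).face.sign ⟨k, hk⟩ = _ from
          S.sign_wall_eq_right hcj]; rfl) rfl rfl
      · rw [hne fun h => hF (Subtype.ext h), hne fun h => hF (Subtype.ext h)]
    · change φ (obj F.1 (v g F.1 0)) = φ (obj (S.next F.2.1) (v g _ 0))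
      rw [hne (S.next_ne F P)]
      by_cases hF : F = P
      · subst hF
        rw [hobj]
        exact if_neg hsep
      · rw [hne fun h => hF (Subtype.ext h)]
    · have hF : F.1 ≠ P.1 := fun h => hc2 (by rw [Subtype.ext h])
      change φ (obj F.1 (v g F.1 (Fin.last n))) = φ (obj (S.neg.next F.2.1) (v g _ 0))
      rw [hne hF, hne (S.prev_ne F P)])
  have e1 : φ (rightArr g B P.1 i).2.1 = 0 := by
    change φ (obj P.1 _) = 0
    rw [hobj]
    refine if_neg ?_
    change (g.wall i).sign k ≠ _
    rw [hc.sign_wall]; exact h0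
  have e2 : φ (rightArr g B P.1 i).1 = 1 := by
    change φ (obj P.1 _) = 1
    rw [hobj]
    exact if_pos (S.minimal.sign_of_lt hc le_rfl)
  have e3 : φ (S.down P).2.1 = 1 := by
    exact (hobj _).trans (if_pos rfl)
  have e4 : φ (S.down P).1 = 0 := hne (S.prev_ne P P) _
  rw [e1, e2, e3, e4] at hrel
  linarith

/-- The indicator of the part over `P` jumps only on the two arrows entering this part. -/
theorem coeff_down (hw : w ∈ Cycles A.SalCat) (hs : ↑w.support ⊆ lambdaArrows g M B)
    (P : Vtx A M u) : w (S.down P) = -w (S.up P) := by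
  have hrel := coeff_relation hw (baseInd P.1) (S.up_ne_down P P) (fun c hcw hc1 hc2 => by
    rcases S.mem_lambdaArrows_iff.1 (hs (Finsupp.mem_support_iff.2 hcw)) with
      ⟨F, j, -, rfl | rfl⟩ | ⟨F, rfl | rfl⟩
    · rfl
    · rfl
    · have hF : F.1 ≠ P.1 := fun h => hc1 (by rw [Subtype.ext h])
      change baseInd _ (obj F.1 (v g F.1 0)) = baseInd _ (obj (S.next F.2.1) (v g _ 0))
      rw [baseInd_of_ne hF, baseInd_of_ne (S.next_ne F P)]
    · have hF : F.1 ≠ P.1 := fun h => hc2 (by rw [Subtype.ext h])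
      change baseInd _ (obj F.1 (v g F.1 (Fin.last n))) = baseInd _ (obj (S.neg.next F.2.1) (v g _ 0))
      rw [baseInd_of_ne hF, baseInd_of_ne (S.prev_ne F P)])
  change w (S.up P) * (baseInd P.1 (obj P.1 _) - baseInd P.1 (obj (S.next P.2.1) _)) +
    w (S.down P) * (baseInd P.1 (obj P.1 _) - baseInd P.1 (obj (S.neg.next P.2.1) _)) = 0 at hrel
  rw [baseInd_obj, baseInd_obj, baseInd_of_ne (S.next_ne P P), baseInd_of_ne (S.prev_ne P P)] at hrel
  linarith

/-- Dually, only two arrows leave the part over an edge: one to the vertex it follows, one to the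
vertex it precedes. -/
theorem coeff_edge (hw : w ∈ Cycles A.SalCat) (hs : ↑w.support ⊆ lambdaArrows g M B)
    {P P' : Vtx A M u} (hPP : S.next P.2.1 = S.neg.next P'.2.1) : w (S.up P) = -w (S.down P') := by
  have hbij : ∀ {Q Q' : Vtx A M u}, S.next Q.2.1 = S.next Q'.2.1 → Q = Q' := by
    intro Q Q' hQ
    have h2 := S.arrow_pointsTo Q'.2.1
    generalize S.arrow Q'.2.1 = m at h2
    revert m
    rw [← hQ]
    intro m hm
    exact Subtype.ext (S.vertex_unique Q.2.2 Q'.2.2 (S.next_subset Q.2.1)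
      (S.next_not_isVertex Q.2.1) (S.arrow_pointsTo Q.2.1) hm)
  have hbij' : ∀ {Q Q' : Vtx A M u}, S.neg.next Q.2.1 = S.neg.next Q'.2.1 → Q = Q' := by
    intro Q Q' hQ
    have h2 := S.neg.arrow_pointsTo Q'.2.1
    generalize S.neg.arrow Q'.2.1 = m at h2
    revert m
    rw [← hQ]
    intro m hm
    exact Subtype.ext (S.neg.vertex_unique (TFace.isVertex_neg.2 Q.2.2)
      (TFace.isVertex_neg.2 Q'.2.2) (S.neg.next_subset Q.2.1)
      (S.neg.next_not_isVertex Q.2.1) (S.neg.arrow_pointsTo Q.2.1) hm)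
  have hrel := coeff_relation hw (baseInd (S.next P.2.1)) (S.up_ne_down P P')
    (fun c hcw hc1 hc2 => by
      rcases S.mem_lambdaArrows_iff.1 (hs (Finsupp.mem_support_iff.2 hcw)) with
        ⟨F, j, -, rfl | rfl⟩ | ⟨F, rfl | rfl⟩
      · rfl
      · rfl
      · change baseInd _ (obj F.1 (v g F.1 0)) = baseInd _ (obj (S.next F.2.1) (v g _ 0))
        rw [baseInd_of_ne (S.next_ne P F).symm, baseInd_of_ne]
        intro h
        exact hc1 (by rw [hbij h])
      · change baseInd _ (obj F.1 (v g F.1 (Fin.last n))) = baseInd _ (obj (S.neg.next F.2.1) (v g _ 0))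
        rw [baseInd_of_ne (S.next_ne P F).symm, baseInd_of_ne]
        intro h
        exact hc2 (by rw [hbij' (h.trans hPP)]))
  have e1 : baseInd (S.next P.2.1) (S.up P).2.1 = 0 := baseInd_of_ne (S.next_ne P P).symm
  have e2 : baseInd (S.next P.2.1) (S.up P).1 = 1 := baseInd_obj
  have e3 : baseInd (S.next P.2.1) (S.down P').2.1 = 0 := baseInd_of_ne (S.next_ne P P').symm
  have e4 : baseInd (S.next P.2.1) (S.down P').1 = 1 := by rw [hPP]; exact baseInd_obj
  rw [e1, e2, e3, e4] at hrel
  linarith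

/-- The sign changes at the edge and at its other end cancel, so the coefficient is transported from
vertex to vertex around the circle. -/
theorem coeff_up (hw : w ∈ Cycles A.SalCat) (hs : ↑w.support ⊆ lambdaArrows g M B)
    (P P' : Vtx A M u) : w (S.up P) = w (S.up P') := by
  classical
  let c : A.TFace → ℤ := fun F =>
    if h : F.carrier ⊆ M ∧ F.IsVertex u then w (S.up ⟨F, h⟩) else 0
  have hc : ∀ P : Vtx A M u, c P.1 = w (S.up P) := fun P => dif_pos P.2
  rw [← hc, ← hc]
  refine S.eq_of_forall_edge c (fun P P' G m m' hP hP' hG hPv hPv' hGv hm hm' => ?_) P.2.1 P'.2.1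
    P.2.2 P'.2.2
  rw [hc ⟨P, hP, hPv⟩, hc ⟨P', hP', hPv'⟩]
  have e1 : S.next hP = G := congrArg Sigma.fst
    (S.edge_unique hPv (S.next_subset hP) hG (S.arrow_pointsTo hP) hm)
  have e2 : S.neg.next hP' = G := congrArg Sigma.fst
    (S.neg.edge_unique (TFace.isVertex_neg.2 hPv') (S.neg.next_subset hP') hG
      (S.neg.arrow_pointsTo hP') hm')
  rw [S.coeff_edge hw hs (P := ⟨P, hP, hPv⟩) (P' := ⟨P', hP', hPv'⟩) (e1.trans e2.symm),
    S.coeff_down hw hs, neg_neg]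

/-- A cycle on the closed path `Λ` is determined by one coefficient. -/
theorem eq_zero_of_coeff (hw : w ∈ Cycles A.SalCat) (hs : ↑w.support ⊆ lambdaArrows g M B)
    (P : Vtx A M u) (h0 : w (S.up P) = 0) : w = 0 := by
  ext a
  by_contra ha
  have hup : ∀ F, w (S.up F) = 0 := fun F => (S.coeff_up hw hs F P).trans h0
  have hdown : ∀ F, w (S.down F) = 0 := fun F => by rw [S.coeff_down hw hs, hup, neg_zero]
  rcases S.mem_lambdaArrows_iff.1 (hs (Finsupp.mem_support_iff.2 ha)) with
    ⟨F, j, hj, rfl | rfl⟩ | ⟨F, rfl | rfl⟩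
  · exact ha ((S.coeff_left hw hs F hj).trans (hup F))
  · exact ha ((S.coeff_right hw hs F hj).trans (hdown F))
  · exact ha (hup F)
  · exact ha (hdown F)

end IsGalleryAlong

end ToricArrangement

/-! ### The cycle, the chain formula and the classes -/

theorem map_finsum_cond {α X Y : Type*} [Finite α] [AddCommMonoid X] [AddCommMonoid Y] (φ : X →+ Y)
    (p : α → Prop) (f : α → X) :
    φ (∑ᶠ (a) (_ : p a), f a) = ∑ᶠ (a) (_ : p a), φ (f a) :=
  φ.map_finsum_mem f (s := {a | p a}) (Set.toFinite _)

theorem Fin.sum_succ_sub_castSucc {X : Type*} [AddCommGroup X] {n : ℕ} (f : Fin (n + 1) → X) :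
    ∑ i : Fin n, (f i.succ - f i.castSucc) = f (Fin.last n) - f 0 := by
  have h := (Fin.sum_univ_succ f).symm.trans (Fin.sum_univ_castSucc f)
  rw [Finset.sum_sub_distrib, sub_eq_sub_iff_add_eq_add, add_comm, h, add_comm]

namespace NerveChains

variable {C : Type} [Category.{0} C]

theorem bd₁_single (a : Arr C) :
    bd₁ C (Finsupp.single a 1) = Finsupp.single a.2.1 1 - Finsupp.single a.1 1 := by
  simp [bd₁, Finsupp.lift_apply]

end NerveChains

namespace ToricArrangement

variable {d : ℕ} {ι : Type} {A : ToricArrangement d ι}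
  {M : Set (Fin d → UnitAddCircle)} {u : Fin d → ℝ} [Finite ι]
  {n : ℕ} {g : Gallery A.central n}

/-- The direction is a point of the face of the first chamber that spans the flat. Being separated
from `-C_0` exactly by the hyperplanes containing the flat means being separated from `C_0` exactly
by the others. -/
theorem exists_isGalleryAlong (hA : A.IsEssential) (hM : A.IsLayer M)
    (hM1 : Module.finrank ℝ (A.flat M) = 1) (hg : AdjacentTo (g.chamber 0) (A.flat M))
    (hmin : g.IsMinimal)
    (hend : IsOp (A.flat M) (negChamber (g.chamber 0)) (g.chamber (Fin.last n))) :
    ∃ u, IsGalleryAlong M u g := by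
  obtain ⟨K, hK, hKM⟩ := hg
  have hKu : K.pt ∈ A.flat M := hKM ▸ Submodule.subset_span K.pt_mem
  have hu : K.pt ≠ 0 := by
    -- If the point were the origin, the face would lie on all hyperplanes and essentiality would
    -- make its hull zero.
    intro h0
    have h1 : A.flat M = ⊥ := by
      rw [← hKM, Face.hull_linForms, ← le_bot_iff, ← hA]
      refine le_iInf fun i => iInf₂_le i ?_
      change K.sign i = 0
      rw [linForms_sign, h0, map_zero, sign_zero]
    rw [h1, finrank_bot] at hM1
    exact zero_ne_one hM1
  have hspan : A.flat M = Submodule.span ℝ {K.pt} := by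
    refine (Submodule.eq_of_le_of_finrank_eq ?_ ?_).symm
    · rwa [Submodule.span_le, Set.singleton_subset_iff]
    · rw [hM1, finrank_span_singleton hu]
  refine ⟨K.pt, ⟨⟨hM, hA, hu, hspan⟩, hmin, fun i hi => ?_, fun i => ?_⟩⟩
  · rw [← linForms_sign K i]
    refine ((Face.le_iff.1 hK i).resolve_left ?_).symm
    rwa [linForms_sign, sign_eq_zero_iff]
  · have h1 := hend.2 i
    rw [hspan, Submodule.span_le, Set.singleton_subset_iff] at h1
    change -(g.chamber 0).1.sign i ≠ _ ↔ A.lin i K.pt = 0 at h1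
    rw [ne_eq (A.lin i K.pt), ← h1, Separates]
    have h2 := (g.chamber 0).2 i
    have h3 := (g.chamber (Fin.last n)).2 i
    revert h2 h3
    generalize (g.chamber 0).1.sign i = a
    generalize (g.chamber (Fin.last n)).1.sign i = b
    revert a b; decide

theorem arrIn_congr {F : A.TFace} {x y y' : SalPoset F.loc} (e : y = y') (h : x ≤ y)
    (h' : x ≤ y') : arrIn F x y h = arrIn F x y' h' := by
  subst e; rfl

open Classical in
/-- The part of the cycle `Λ` over a face. -/
noncomputable def pathChain (g : Gallery A.central n) (B : Chamber A.central) (F : A.TFace) :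
    Arr A.SalCat →₀ ℤ :=
  ∑ i, if Seen g F i then
    Finsupp.single (leftArr g B F i) 1 - Finsupp.single (rightArr g B F i) 1 else 0

/-- The sum telescopes, because a step that is not seen leaves the vertex unchanged. -/
theorem bd₁_pathChain (B : Chamber A.central) (F : A.TFace) :
    bd₁ A.SalCat (pathChain g B F) =
      Finsupp.single (obj F (v g F (Fin.last n))) 1 - Finsupp.single (obj F (v g F 0)) 1 := by
  rw [← Fin.sum_succ_sub_castSucc (fun i => Finsupp.single (obj F (v g F i)) (1 : ℤ)), pathChain,
    map_sum]
  refine Finset.sum_congr rfl fun i _ => ?_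
  split_ifs with h
  · rw [map_sub, bd₁_single, bd₁_single]
    exact sub_sub_sub_cancel_left _ _ _
  · have h1 : v g F i.castSucc = v g F i.succ := congrArg SalPoset.vertex (not_not.1 h)
    rw [h1, map_zero, sub_self]

theorem crosses_of_hull_eq (hg : g.IsMinimal) {F : A.TFace} {H : ι} (hH : H ∈ F.through) {i : Fin n}
    (h : (F.res (g.wall i)).hull = A.hyp H) : g.Crosses i H := by
  refine hg.crosses_of_sign_wall ?_
  have h1 : (F.res (g.wall i)).pt ∈ A.hyp H := h ▸ Submodule.subset_span (Face.pt_mem _)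
  have h2 := Face.sign_of_mem (F.res (g.wall i)).pt_mem ⟨H, hH⟩
  change SignType.sign (A.lin H _) = (g.wall i).sign H at h2
  rw [← h2, LinearMap.mem_ker.1 h1, sign_zero]

/-- All hyperplanes containing the wall are crossed and coincide; distinct hypertori through `F`
have distinct hyperplanes. -/
theorem sign_res_wall_eq_zero_iff (hg : g.IsMinimal) {F : A.TFace} {H : ι} (hH : H ∈ F.through)
    {i : Fin n} (h : g.Crosses i H) (k : F.through) :
    (F.res (g.wall i)).sign k = 0 ↔ k = ⟨H, hH⟩ := by
  constructor
  · intro h0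
    have hk : g.Crosses i k := hg.crosses_of_sign_wall h0
    exact Subtype.ext (eq_of_mem_through k.2 hH (hk.hull_eq.symm.trans h.hull_eq))
  · rintro rfl
    exact h.sign_wall

theorem hull_res_wall (hg : g.IsMinimal) {F : A.TFace} {H : ι} (hH : H ∈ F.through)
    {i : Fin n} (h : g.Crosses i H) : (F.res (g.wall i)).hull = A.hyp H :=
  Face.hull_eq_ker_of_iff (k := (⟨H, hH⟩ : F.through)) h.sign_wall fun k hk => by
    rw [(sign_res_wall_eq_zero_iff hg hH h k).1 hk]

theorem xiChain_eq (hg : g.IsMinimal) {F : A.TFace} {H : ι} (hH : H ∈ F.through) {i : Fin n}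
    (h : g.Crosses i H) (B : Chamber A.central) :
    xiChain g H B F = squareChain F (F.res (g.wall i)) (F.resC (g.chamber i.castSucc))
      (F.resC (g.chamber i.succ)) (F.resC B) (F.resC (negChamber B)) (wall_le_left g F i)
      (wall_le_right g F i) := by
  rw [xiChain, Finset.sum_eq_single i, if_pos (hull_res_wall hg hH h)]
  · exact fun j _ hj => if_neg fun h' => hj (hg.crosses_unique (crosses_of_hull_eq hg hH h') h)
  · exact fun h' => absurd (Finset.mem_univ i) h'

theorem eps_of_eq {HC : ι → Chamber A.central} {H : ι} {B : Chamber A.central}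
    (h : (HC H).1.sign H = B.1.sign H) : eps HC H B = 1 := if_neg (not_not.2 h)

theorem eps_of_ne {HC : ι → Chamber A.central} {H : ι} {B : Chamber A.central}
    (h : (HC H).1.sign H ≠ B.1.sign H) : eps HC H B = -1 := if_pos h

theorem eq_neg_of_ne {a b : SignType} (ha : a ≠ 0) (hb : b ≠ 0) (h : a ≠ b) : a = -b := by
  revert a b; decide

namespace IsGalleryAlong

variable (S : IsGalleryAlong M u g)
include S

theorem not_subset_tor {H : ι} (h : A.lin H u ≠ 0) : ¬ M ⊆ A.tor H := fun h' =>
  h (S.lin_eq_zero h')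

theorem exists_crosses_of_mem_sepSet {F : A.TFace} (hF : F.carrier ⊆ M) {B B' : Chamber A.central}
    {H : ι} (hH : H ∈ sepSet M F B B') : ∃ i, g.Crosses i H :=
  S.exists_crosses fun h0 => hH.2.2 (S.subset_tor hF hH.1 h0)

/-- The summand of the formula for chains at one step of the gallery. -/
theorem finsum_step {F : A.TFace} (B B' : Chamber A.central) (i : Fin n) [Decidable (Seen g F i)]
    [∀ H, Decidable ((F.res (g.wall i)).hull = A.hyp H)] :
    (∑ᶠ (H : ι) (_ : H ∈ sepSet M F B B'), if (F.res (g.wall i)).hull = A.hyp H then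
      squareChain F (F.res (g.wall i)) (F.resC (g.chamber i.castSucc)) (F.resC (g.chamber i.succ))
        (F.resC B) (F.resC (negChamber B)) (wall_le_left g F i) (wall_le_right g F i) else 0) =
    (if Seen g F i then
      Finsupp.single (leftArr g B F i) 1 - Finsupp.single (rightArr g B F i) 1 else 0) -
    (if Seen g F i then
      Finsupp.single (leftArr g B' F i) 1 - Finsupp.single (rightArr g B' F i) (1 : ℤ) else 0) := by
  classical
  have hzero : ∀ H, ¬ g.Crosses i H → (∑ᶠ (_ : H ∈ sepSet M F B B'),
      if (F.res (g.wall i)).hull = A.hyp H then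
      squareChain F (F.res (g.wall i)) (F.resC (g.chamber i.castSucc)) (F.resC (g.chamber i.succ))
        (F.resC B) (F.resC (negChamber B)) (wall_le_left g F i) (wall_le_right g F i) else 0) = 0 :=
    fun H hc => (finsum_congr fun hH =>
      if_neg fun h => hc (crosses_of_hull_eq S.minimal hH.1 h)).trans finsum_zero
  by_cases hs : Seen g F i
  · obtain ⟨k, hk, hc⟩ := seen_iff.1 hs
    rw [if_pos hs, if_pos hs, finsum_eq_single _ k]
    · have hhull := hull_res_wall S.minimal hk hc
      rw [if_pos hhull]
      by_cases hsep : Separates k B B'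
      · rw [finsum_eq_if, if_pos ⟨hk, hsep, S.not_subset_tor (S.lin_ne_zero_of_crosses hc)⟩]
        -- The wall only sees the side of `k`, on which `B'` agrees with `-B`; so the square is one
        -- half-turn minus the other.
        have he : e g B' F i = SalPoset.edge (F.res (g.wall i)) (F.resC (negChamber B)) :=
          edge_eq_of_comp_eq fun j hj => by
            obtain rfl := (sign_res_wall_eq_zero_iff S.minimal hk hc j).1 hj
            exact eq_neg_of_ne (B'.2 k) (B.2 k) hsep.symm
        rw [show leftArr g B' F i = _ from
            arrIn_congr he _ (SalPoset.vertex_le_edge (wall_le_left g F i) _),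
          show rightArr g B' F i = _ from
            arrIn_congr he _ (SalPoset.vertex_le_edge (wall_le_right g F i) _)]
        exact (add_sub_assoc _ _ _).trans ((sub_sub_eq_add_sub _ _ _).trans
          (add_sub_assoc _ _ _)).symm
      · rw [finsum_eq_if, if_neg fun h => hsep h.2.1]
        have he : e g B' F i = e g B F i := edge_eq_of_comp_eq fun j hj => by
          obtain rfl := (sign_res_wall_eq_zero_iff S.minimal hk hc j).1 hj
          exact (not_not.1 hsep).symm
        rw [show leftArr g B' F i = leftArr g B F i from arrIn_congr he _ _,
          show rightArr g B' F i = rightArr g B F i from arrIn_congr he _ _, sub_self]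
    · intro H hH
      by_cases hHF : H ∈ F.through
      · exact hzero H fun h => hH (congrArg Subtype.val
          ((sign_res_wall_eq_zero_iff S.minimal hk hc ⟨H, hHF⟩).1 h.sign_wall))
      · rw [finsum_eq_if, if_neg fun h => hHF h.1]
  · rw [if_neg hs, if_neg hs, sub_self]
    refine (finsum_congr fun H => ?_).trans finsum_zero
    by_cases hH : H ∈ F.through
    · exact hzero H fun h => hs (seen_iff.2 ⟨H, hH, h⟩)
    · rw [finsum_eq_if, if_neg fun h => hH h.1]

theorem finsum_xiChain {F : A.TFace} (B B' : Chamber A.central) :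
    ∑ᶠ (H : ι) (_ : H ∈ sepSet M F B B'), xiChain g H B F =
      pathChain g B F - pathChain g B' F := by
  classical
  have hfin : (sepSet M F B B').Finite := Set.toFinite _
  rw [pathChain, pathChain, ← Finset.sum_sub_distrib, finsum_mem_eq_finite_toFinset_sum _ hfin]
  simp only [xiChain]
  rw [Finset.sum_comm]
  refine Finset.sum_congr rfl fun i _ => ?_
  rw [← finsum_mem_eq_finite_toFinset_sum _ hfin]
  convert S.finsum_step B B' i

/-- Edges contribute nothing to the sums over faces of `M`, since no step is seen there. -/
theorem finsum_carrier_subset {X : Type*} [AddCommMonoid X] {f : A.TFace → X}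
    (hf : ∀ F, ¬ F.IsVertex u → f F = 0) :
    ∑ᶠ (F : A.TFace) (_ : F.carrier ⊆ M), f F = ∑ P : Vtx A M u, f P.1 := by
  classical
  rw [← finsum_eq_sum_of_fintype, finsum_subtype_eq_finsum_cond]
  refine finsum_congr fun F => ?_
  by_cases hF : F.IsVertex u
  · simp only [hF, and_true]
  · simp only [hf F hF, finsum_zero]

theorem pathChain_eq_zero (B : Chamber A.central) {F : A.TFace} (hF : ¬ F.IsVertex u) :
    pathChain g B F = 0 :=
  Finset.sum_eq_zero fun _ _ => if_neg fun h => hF (S.isVertex_of_seen h)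

/-- The cycle `Λ`. -/
noncomputable def lambdaChain (B : Chamber A.central) : Arr A.SalCat →₀ ℤ :=
  ∑ P : Vtx A M u, (pathChain g B P.1 + (Finsupp.single (S.up P) 1 - Finsupp.single (S.down P) 1))

/-- Each vertex contributes its preceding edge minus its following edge; both enumerate every edge
once. -/
theorem lambdaChain_mem_cycles (B : Chamber A.central) : S.lambdaChain B ∈ Cycles A.SalCat := by
  have key : ∀ P : Vtx A M u, bd₁ A.SalCat
      (pathChain g B P.1 + (Finsupp.single (S.up P) 1 - Finsupp.single (S.down P) 1)) =
      Finsupp.single (obj (S.neg.next P.2.1) (v g _ 0)) 1 -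
        Finsupp.single (obj (S.next P.2.1) (v g _ 0)) 1 := by
    intro P
    rw [map_add, map_sub, bd₁_pathChain, bd₁_single, bd₁_single]
    change _ + (Finsupp.single (obj P.1 (v g P.1 0)) 1 - Finsupp.single (obj (S.next P.2.1) _) 1 -
      (Finsupp.single (obj P.1 (v g P.1 (Fin.last n))) 1 -
        Finsupp.single (obj (S.neg.next P.2.1) _) 1)) = _
    abel
  rw [Cycles, LinearMap.mem_ker, lambdaChain, map_sum, Finset.sum_congr rfl fun P _ => key P,
    Finset.sum_sub_distrib, sub_eq_zero,
    S.neg.sum_next (fun _ => TFace.isVertex_neg.symm)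
      (fun F => Finsupp.single (obj F (v g F 0)) (1 : ℤ)),
    S.sum_next (fun _ => Iff.rfl) (fun F => Finsupp.single (obj F (v g F 0)) (1 : ℤ))]

theorem lambdaChain_support (B : Chamber A.central) :
    ↑(S.lambdaChain B).support ⊆ lambdaArrows g M B := by
  have h1 : ∀ {a}, a ∈ lambdaArrows g M B →
      Finsupp.single a (1 : ℤ) ∈ Finsupp.supported ℤ ℤ (lambdaArrows g M B) := fun h =>
    Finsupp.single_mem_supported ℤ 1 h
  rw [← Finsupp.mem_supported ℤ]
  refine sum_mem fun P _ => add_mem (sum_mem fun i _ => ?_) (sub_mem ?_ ?_)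
  · split_ifs with h
    · exact sub_mem (h1 (S.mem_lambdaArrows_iff.2 (Or.inl ⟨P, i, h, Or.inl rfl⟩)))
        (h1 (S.mem_lambdaArrows_iff.2 (Or.inl ⟨P, i, h, Or.inr rfl⟩)))
    · exact zero_mem _
  · exact h1 (S.mem_lambdaArrows_iff.2 (Or.inr ⟨P, Or.inl rfl⟩))
  · exact h1 (S.mem_lambdaArrows_iff.2 (Or.inr ⟨P, Or.inr rfl⟩))

theorem lambdaChain_up (B : Chamber A.central) (P : Vtx A M u) : S.lambdaChain B (S.up P) = 1 := by
  classical
  have hpath : ∀ Q : Vtx A M u, pathChain g B Q.1 (S.up P) = 0 := by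
    intro Q
    rw [pathChain, Finsupp.finsetSum_apply]
    refine Finset.sum_eq_zero fun i _ => ?_
    split_ifs
    · rw [Finsupp.sub_apply, Finsupp.single_eq_of_ne (S.leftArr_ne_up B Q P i).symm,
        Finsupp.single_eq_of_ne (S.rightArr_ne_up B Q P i).symm, sub_zero]
    · rfl
  rw [lambdaChain, Finsupp.finsetSum_apply, Finset.sum_eq_single P]
  · rw [Finsupp.add_apply, hpath, Finsupp.sub_apply, Finsupp.single_eq_same,
      Finsupp.single_eq_of_ne (S.up_ne_down P P), sub_zero, zero_add]
  · intro Q _ hQ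
    rw [Finsupp.add_apply, hpath, Finsupp.sub_apply,
      Finsupp.single_eq_of_ne fun h => hQ (S.up_injective h).symm,
      Finsupp.single_eq_of_ne (S.up_ne_down P Q), sub_zero, zero_add]
  · exact fun h => absurd (Finset.mem_univ P) h

/-- The first step of the gallery that is seen at a vertex. -/
theorem exists_first_seen {P : A.TFace} (hP : P.IsVertex u) :
    ∃ i : Fin n, v g P i.castSucc = v g P 0 ∧ Seen g P i := by
  obtain ⟨k, hk, h0⟩ := hP
  obtain ⟨j, hj⟩ := S.exists_crosses h0
  obtain ⟨i, hi, hmin⟩ := wellFounded_lt.has_min {i : Fin n | Seen g P i}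
    ⟨j, seen_iff.2 ⟨k, hk, hj⟩⟩
  refine ⟨i, ?_, hi⟩
  refine congrArg SalPoset.vertex (Subtype.ext (Face.ext (funext fun l => ?_)))
  by_contra hne
  obtain ⟨i', -, h2, h3⟩ := Gallery.exists_crosses (g := g) (k := (l : ι))
    (Nat.zero_le (i.castSucc : ℕ)) i.castSucc.2 (Ne.symm hne)
  exact hmin i' (seen_iff.2 ⟨l, l.2, h3⟩) h2

theorem isLambdaCycle_lambdaChain (B : Chamber A.central) (P : Vtx A M u) :
    IsLambdaCycle g M P.1 B (S.lambdaChain B) := by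
  obtain ⟨i, hi, hs⟩ := S.exists_first_seen P.2.2
  refine ⟨S.lambdaChain_mem_cycles B, S.lambdaChain_support B, i, hi, hs, ?_⟩
  rw [S.coeff_left (S.lambdaChain_mem_cycles B) (S.lambdaChain_support B) P hs, S.lambdaChain_up]

theorem eq_lambdaChain {B : Chamber A.central} (P : Vtx A M u) {z : Arr A.SalCat →₀ ℤ}
    (hz : IsLambdaCycle g M P.1 B z) : z = S.lambdaChain B := by
  obtain ⟨hc, hsupp, i, -, hs, h1⟩ := hz
  rw [← sub_eq_zero]
  refine S.eq_zero_of_coeff (B := B) (sub_mem hc (S.lambdaChain_mem_cycles B)) ?_ P ?_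
  · rw [← Finsupp.mem_supported ℤ] at hsupp ⊢
    exact sub_mem hsupp ((Finsupp.mem_supported ℤ _).2 (S.lambdaChain_support B))
  · rw [Finsupp.sub_apply, S.lambdaChain_up, ← S.coeff_left hc hsupp P hs, h1, sub_self]

/-- The arrows between edges and vertices do not depend on `B` and cancel, leaving the parts over
the vertices. -/
theorem lambdaChain_sub (B B' : Chamber A.central) :
    S.lambdaChain B - S.lambdaChain B' = ∑ᶠ (F : A.TFace) (_ : F.carrier ⊆ M),
      ∑ᶠ (H : ι) (_ : H ∈ sepSet M F B B'), xiChain g H B F := by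
  simp only [S.finsum_xiChain]
  rw [S.finsum_carrier_subset fun F hF => by
    rw [S.pathChain_eq_zero B hF, S.pathChain_eq_zero B' hF, sub_zero]]
  rw [lambdaChain, lambdaChain, ← Finset.sum_sub_distrib]
  exact Finset.sum_congr rfl fun P _ => add_sub_add_right_eq_sub _ _ _

/-- The class of a cycle `Ξ`. -/
theorem mk_xiChain {F : A.TFace} (hF : F.carrier ⊆ M) {B B' : Chamber A.central} {H : ι}
    (hH : H ∈ sepSet M F B B') {HC : ι → Chamber A.central} {c : H₁ A.SalCat}
    (hc : IsOmegaClass (HC H) H c) :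
    (Submodule.Quotient.mk (xiChain g H B F) : ChainsModBd A.SalCat) =
      (eps HC H (g.chamber 0) * eps HC H B) • homologyToChains A.SalCat c := by
  obtain ⟨i, hi⟩ := S.exists_crosses_of_mem_sepSet hF hH
  have hC := S.minimal.sign_of_le hi le_rfl
  have hne : (g.chamber i.castSucc).1.sign H ≠ (g.chamber i.succ).1.sign H := hi
  have h0 := (g.chamber i.castSucc).2 H
  have h1 := (g.chamber i.succ).2 H
  have hz := sign_res_wall_eq_zero_iff S.minimal hH.1 hi
  have hE := (HC H).2 H
  rw [xiChain_eq S.minimal hH.1 hi]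
  -- Up to its crossing with `H` the gallery is on the side of the first chamber. If `B` is on that
  -- side, `Ξ` is a loop around `H` as it stands; otherwise its negative is one.
  by_cases hs : (g.chamber i.castSucc).1.sign H = B.1.sign H
  · have hloop : IsLoopAround F ⟨H, hH.1⟩ (F.res (g.wall i)) (F.resC (g.chamber i.castSucc))
        (F.resC (g.chamber i.succ)) (F.resC B) (F.resC (negChamber B)) :=
      ⟨hz, wall_le_left g F i, wall_le_right g F i, hs,
        eq_neg_of_ne h1 (B.2 H) (hs ▸ hne.symm), hne⟩
    rw [hc.eq_mk hH.1 hloop]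
    have he : eps HC H (g.chamber 0) * eps HC H B = 1 := by
      by_cases h2 : (HC H).1.sign H = B.1.sign H
      · rw [eps_of_eq h2, eps_of_eq (h2.trans (hs.symm.trans hC)), one_mul]
      · rw [eps_of_ne h2, eps_of_ne (by rwa [← hC, hs])]; norm_num
    rw [he, one_smul]
  · have hloop : IsLoopAround F ⟨H, hH.1⟩ (F.res (g.wall i)) (F.resC (g.chamber i.castSucc))
        (F.resC (g.chamber i.succ)) (F.resC (negChamber B)) (F.resC B) :=
      ⟨hz, wall_le_left g F i, wall_le_right g F i, eq_neg_of_ne h0 (B.2 H) hs,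
        (signType_eq_of_ne h0 h1 (B.2 H) hne hs), hne⟩
    rw [squareChain_neg, hc.eq_mk hH.1 hloop, Submodule.Quotient.mk_neg]
    have he : eps HC H (g.chamber 0) * eps HC H B = -1 := by
      by_cases h2 : (HC H).1.sign H = (g.chamber i.castSucc).1.sign H
      · rw [eps_of_eq (h2.trans hC), eps_of_ne (h2 ▸ hs), one_mul]
      · rw [eps_of_ne (hC ▸ h2), eps_of_eq (signType_eq_of_ne h0 hE (B.2 H) (Ne.symm h2) hs),
          mul_one]
    rw [he, neg_one_smul]

end IsGalleryAlong

end ToricArrangement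

theorem mainTheorem5 {d : ℕ} {ι : Type} [Finite ι] (A : ToricArrangement d ι)
    (hA : A.IsEssential)
    -- a one-dimensional layer and a zero-dimensional face of it
    (M : Set (Fin d → UnitAddCircle)) (hM : A.IsLayer M) (hM1 : Module.finrank ℝ (A.flat M) = 1)
    (P₀ : A.TFace) (hP₀ : P₀.carrier ⊆ M) (hP₀d : P₀.dim = 0)
    -- the chosen chamber adjacent to the flat of `M` and the chosen minimal gallery
    {n : ℕ} (g : RealArr.Gallery A.central n)
    (hg : RealArr.AdjacentTo (g.chamber 0) (A.flat M)) (hmin : g.IsMinimal)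
    (hend : RealArr.IsOp (A.flat M) (RealArr.negChamber (g.chamber 0)) (g.chamber (Fin.last n))) :
    -- the cycles `[Λ_B^M]` exist and are unique
    (∀ B : RealArr.Chamber A.central, ∃! z, ToricArrangement.IsLambdaCycle g M P₀ B z) ∧
    ∀ (B B' : RealArr.Chamber A.central) (z z' : NerveChains.Arr A.SalCat →₀ ℤ)
      (hz : ToricArrangement.IsLambdaCycle g M P₀ B z)
      (hz' : ToricArrangement.IsLambdaCycle g M P₀ B' z'),
      -- the formula for chains
      (z - z' = ∑ᶠ (F : A.TFace) (_ : F.carrier ⊆ M),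
        ∑ᶠ (H : ι) (_ : H ∈ ToricArrangement.sepSet M F B B'),
          ToricArrangement.xiChain g H B F) ∧
      -- the formula for homology classes, for all choices of chambers for the hypertori and
      -- all representatives of the classes of the loops around the hypertori
      ∀ (HC : ι → RealArr.Chamber A.central) (ω : ι → NerveChains.H₁ A.SalCat),
        (∀ H, ToricArrangement.IsOmegaClass (HC H) H (ω H)) →
        (NerveChains.homologyClass z hz.1 - NerveChains.homologyClass z' hz'.1 =
          ∑ᶠ (F : A.TFace) (_ : F.carrier ⊆ M),
          ∑ᶠ (H : ι) (_ : H ∈ ToricArrangement.sepSet M F B B'),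
            (ToricArrangement.eps HC H (g.chamber 0) * ToricArrangement.eps HC H B) • ω H) ∧
        -- its form for chambers `HC H` chosen on the same side of `H₀` as the first chamber
        ((∀ H, ¬ M ⊆ A.tor H → ToricArrangement.eps HC H (g.chamber 0) = 1) →
          NerveChains.homologyClass z hz.1 - NerveChains.homologyClass z' hz'.1 =
            ∑ᶠ (F : A.TFace) (_ : F.carrier ⊆ M),
            ∑ᶠ (H : ι) (_ : H ∈ ToricArrangement.sepSet M F B B'),
              ToricArrangement.eps HC H B • ω H) := by
  obtain ⟨u, S⟩ := ToricArrangement.exists_isGalleryAlong hA hM hM1 hg hmin hend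
  let P : ToricArrangement.Vtx A M u := ⟨P₀, hP₀, (S.isVertex_iff hP₀).2 hP₀d⟩
  refine ⟨fun B => ⟨S.lambdaChain B, S.isLambdaCycle_lambdaChain B P,
    fun z hz => S.eq_lambdaChain P hz⟩, fun B B' z z' hz hz' => ?_⟩
  have hsub : z - z' = ∑ᶠ (F : A.TFace) (_ : F.carrier ⊆ M),
      ∑ᶠ (H : ι) (_ : H ∈ ToricArrangement.sepSet M F B B'),
        ToricArrangement.xiChain g H B F := by
    rw [S.eq_lambdaChain P hz, S.eq_lambdaChain P hz', S.lambdaChain_sub]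
  refine ⟨hsub, fun HC ω hω => ?_⟩
  have hclass : NerveChains.homologyClass z hz.1 - NerveChains.homologyClass z' hz'.1 =
      ∑ᶠ (F : A.TFace) (_ : F.carrier ⊆ M),
      ∑ᶠ (H : ι) (_ : H ∈ ToricArrangement.sepSet M F B B'),
        (ToricArrangement.eps HC H (g.chamber 0) * ToricArrangement.eps HC H B) • ω H := by
    -- Single squares are compared with `ω_H` modulo boundaries, where the chain formula can be
    -- applied term by term.
    apply homologyToChains_injective
    let mk := (Submodule.mkQ (LinearMap.range (bd₂ A.SalCat))).toAddMonoidHom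
    have h1 : homologyToChains A.SalCat
        (NerveChains.homologyClass z hz.1 - NerveChains.homologyClass z' hz'.1) = mk (z - z') := rfl
    rw [h1, hsub, map_finsum_cond mk]
    refine Eq.trans ?_ (map_finsum_cond (homologyToChains A.SalCat).toAddMonoidHom _ _).symm
    refine finsum_congr fun F => finsum_congr fun hF => ?_
    rw [map_finsum_cond mk]
    refine Eq.trans ?_ (map_finsum_cond (homologyToChains A.SalCat).toAddMonoidHom _ _).symm
    refine finsum_congr fun H => finsum_congr fun hH => ?_
    exact (S.mk_xiChain hF hH (hω H)).trans (map_smul _ _ _).symm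
  refine ⟨hclass, fun hsame => hclass.trans ?_⟩
  refine finsum_congr fun F => finsum_congr fun _ => finsum_congr fun H => finsum_congr fun hH => ?_
  rw [hsame H hH.2.2, one_mul]
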